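/- Let $\lambda>0$ and, for $\mu\ge 0$ and $\Re a>0$ (i.e. $|\arg a|<\pi/2$), let \[S_\mu^-(a;\lambda)=\sum_{n=0}^\infty\frac{(-1)^n e^{-\lambda n}}{(n^2+a^2)^\mu},\] with principal powers here and below. Put $B_k=\int_0^\infty \tau^{2k}\frac{\sin\lambda\tau}{\sinh\pi\tau}\,d\tau$, define $A_k$ by $\frac{\sin\lambda x}{\sinh\pi x}=\frac{\lambda}{\pi}\sum_{k\ge0}(-1)^kA_kx^{2k}$ near $x=0$, write $(\mu)_k$ for the rising factorial, let $K_\nu$ be the modified Bessel function on $|\arg z|<\pi$, and put $X_k^{\pm}=(2k+1)\pi a\pm i\lambda a$. For $\mu\ge0$, $\mu\notin\{1,2,\dots\}$, let \[T_\mu(a;\lambda)=\frac{\sqrt\pi\,2^{1/2-\mu}\,\Gamma(1-\mu)}{\pi\, a^{2\mu-1}}\sum_{k=0}^\infty\Bigl\{ie^{-\pi i\mu}\frac{K_{1/2-\mu}(X_k^+)}{(X_k^+)^{1/2-\mu}}-ie^{\pi i\mu}\frac{K_{1/2-\mu}(X_k^-)}{(X_k^-)^{1/2-\mu}}\Bigr\}\]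 (note $\Gamma(1-\mu)/\pi=1/(\Gamma(\mu)\sin\pi\mu)$ when $\mu\neq0$). Then the following hold. (i) The series $S_\mu^-(a;\lambda)$ converges for $\mu\ge0$, $\Re a>0$. For $\mu>0$ it is differentiable in $a$, and $S_{\mu+1}^-(a;\lambda)=-\frac{1}{2\mu a}\,\frac{\partial}{\partial a}S_\mu^-(a;\lambda)$. (ii) For every $\mu\ge0$ with $\mu\notin\{1,2,\dots\}$ there is a (necessarily unique) function $H_\mu^-(\cdot;\lambda)$, analytic in $\Re a>0$, such that for $\Re a>0$, $|a|<1$, \[H_\mu^-(a;\lambda)=\frac{\lambda a^{1-2\mu}}{2\pi}\Gamma(1-\mu)\sum_{k=0}^\infty\frac{(-1)^kA_k\Gamma(k+\frac12)}{\Gamma(k+\frac32-\mu)}a^{2k}\] ($1/\Gamma$ being $0$ at the poles of $\Gamma$). If $\mu<1$, then $H_\mu^-(a;\lambda)=a^{1-2\mu}\int_0^1\frac{\sin\lambda at}{\sinh\pi at}\frac{dt}{(1-t^2)^\mu}$ for all $\Re a>0$. The series $T_\mu$ converges and \[S_\mu^-(a;\lambda)=\frac{1}{2a^{2\mu}}+H_\mu^-(a;\lambda)+T_\mu(a;\lambda)\qquad(\Re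 a>0).\] For real $a>0$ and $\mu>0$, $\mu\notin\{1,2,\dots\}$, the same identity holds with $T_\mu(a;\lambda)$ written as the convergent series \[\frac{2^{3/2-\mu}\sqrt\pi}{a^{2\mu-1}\Gamma(\mu)}\sum_{k=0}^\infty\frac{\sin(\pi\mu-\theta_k)}{\sin\pi\mu}\left|\frac{K_{1/2-\mu}(X_k^+)}{(X_k^+)^{1/2-\mu}}\right|,\qquad\theta_k=\arg\bigl((X_k^+)^{\mu-1/2}K_{1/2-\mu}(X_k^+)\bigr).\] At an integer $\mu=m\ge1$ the representation holds as a limit: $\frac{1}{2a^{2\mu}}+H_\mu^-(a;\lambda)+T_\mu(a;\lambda)\to S_m^-(a;\lambda)$ as $\mu\to m$, $\mu\ne m$, for each $a$ with $\Re a>0$. (iii) With $F_n(a)={}_{n+1}F_n(1,ia,\dots,ia;1+ia,\dots,1+ia;-e^{-\lambda})$ and $\mathcal F_n=F_n(a)+F_n(-a)$, for $\Re a>0$, \[S_1^-=\frac{\mathcal F_1}{2a^2},\quad S_2^-=\frac{\mathcal F_1+\mathcal F_2}{4a^4},\quad S_3^-=\frac{3\mathcal F_1+3\mathcal F_2+2\mathcal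 F_3}{16a^6},\quad S_4^-=\frac{5\mathcal F_1+5\mathcal F_2+4\mathcal F_3+2\mathcal F_4}{32a^8},\] \[S_5^-=\frac{35\mathcal F_1+35\mathcal F_2+30\mathcal F_3+20\mathcal F_4+8\mathcal F_5}{256a^{10}}.\] (iv) For every $\mu\ge0$, \[S_\mu^-(a;\lambda)\sim\frac{1}{2a^{2\mu}}+\frac{1}{a^{2\mu}}\sum_{k=0}^\infty\frac{(\mu)_kB_k}{k!\,a^{2k}}\] as $|a|\to\infty$ in $|\arg a|<\pi/2$, in the sense of Poincaré, uniformly in closed subsectors: for every $\phi<\pi/2$ and $N\ge0$, the error after the terms $k<N$ is $O(|a|^{-2\mu-2N})$ as $|a|\to\infty$ in $|\arg a|\le\phi$. For $\mu\notin\{1,2,\dots\}$ the function $H_\mu^-(a;\lambda)$ has the expansion $a^{-2\mu}\sum_k(\mu)_kB_k/(k!\,a^{2k})$ in the same sense in each sector $|\arg a|\le\phi$ with $\phi<\arctan(\pi/\lambda)$. (v) When $\mu=0$ the right-hand side in (iv) (truncated after any positive number of terms of the sum) equals $e^\lambda/(1+e^\lambda)$, which is $S_0^-(a;\lambda)$.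 -/

import Mathlib

open Real Filter Topology Asymptotics

noncomputable section

/-- The `n`-th term `(-1)^n e^{-λ n} / (n² + a²)^μ` of the alternating Mathieu-exponential series.
For `Re a > 0` the number `n² + a²` is off the cut of the principal power. -/
def mathieuTerm (lam mu : ℝ) (a : ℂ) (n : ℕ) : ℂ :=
  (-1) ^ n * Complex.exp (-(lam * n)) / ((n : ℂ) ^ 2 + a ^ 2) ^ (mu : ℂ)

/-- The sum `S_μ^-(a; λ)`. -/
def mathieuS (lam mu : ℝ) (a : ℂ) : ℂ := ∑' n : ℕ, mathieuTerm lam mu a n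

/-- The function `x ↦ sin λx / sinh πx`, with its limit value `λ/π` at `x = 0`. -/
def sinQuot (lam : ℝ) : ℂ → ℂ :=
  Function.update (fun x : ℂ => Complex.sin (lam * x) / Complex.sinh (π * x)) 0 (lam / π)

/-- The coefficients `A_k` of the Maclaurin series
`sin λx / sinh πx = (λ/π) ∑ (-1)^k A_k x^{2k}`. -/
def coeffA (lam : ℝ) (k : ℕ) : ℂ :=
  (-1) ^ k * (π / lam) * (iteratedDeriv (2 * k) (sinQuot lam) 0 / (Nat.factorial (2 * k) : ℂ))

/-- `B_k = ∫_0^∞ τ^{2k} sin λτ / sinh πτ dτ`. -/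
def coeffB (lam : ℝ) (k : ℕ) : ℝ :=
  ∫ τ in Set.Ioi (0 : ℝ), τ ^ (2 * k) * (Real.sin (lam * τ) / Real.sinh (π * τ))

/-- The integral `a^{1-2μ} ∫_0^1 (sin λat / sinh πat) (1-t²)^{-μ} dt`, meaningful for `μ < 1`. -/
def integralH (lam mu : ℝ) (a : ℂ) : ℂ :=
  a ^ ((1 - 2 * mu : ℝ) : ℂ) * ∫ t in (0 : ℝ)..1,
    Complex.sin (lam * a * t) / Complex.sinh (π * a * t) / (((1 - t ^ 2) ^ mu : ℝ) : ℂ)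

/-- The `k`-th term of
`(λ a^{1-2μ} / 2π) Γ(1-μ) ∑ (-1)^k A_k Γ(k+1/2) / Γ(k+3/2-μ) a^{2k}`.
Mathlib's `Γ` is `0` at the poles, and `x / 0 = 0`, so that `1/Γ` vanishes there as it should. -/
def seriesTermH (lam mu : ℝ) (a : ℂ) (k : ℕ) : ℂ :=
  lam * a ^ ((1 - 2 * mu : ℝ) : ℂ) / (2 * π) * (Real.Gamma (1 - mu) : ℂ) *
    ((-1) ^ k * coeffA lam k * (Real.Gamma (k + 1 / 2) : ℂ) / (Real.Gamma (k + 3 / 2 - mu) : ℂ)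
      * a ^ (2 * k))

/-- `H` is the function `H_μ^-(·; λ)` on the half-plane `Re a > 0`: it is analytic there, and for
`|a| < 1` it is the sum of its convergent series. By the identity theorem there is at most one such
function on the half-plane. -/
def IsMathieuH (lam mu : ℝ) (H : ℂ → ℂ) : Prop :=
  DifferentiableOn ℂ H {a : ℂ | 0 < a.re} ∧
    ∀ a : ℂ, 0 < a.re → ‖a‖ < 1 → HasSum (seriesTermH lam mu a) (H a)

/-- The modified Bessel function `K_ν(z)` of real order, for `|arg z| < π`, through
`K_ν(z) = √(π/2z) e^{-z} / Γ(ν+1/2) ∫_0^∞ e^{-t} t^{ν-1/2} (1 + t/2z)^{ν-1/2} dt` (`ν > -1/2`) and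
`K_{-ν} = K_ν`. -/
def besselK (ν : ℝ) (z : ℂ) : ℂ :=
  (π / (2 * z)) ^ (1 / 2 : ℂ) * Complex.exp (-z) / (Real.Gamma (|ν| + 1 / 2) : ℂ) *
    ∫ t in Set.Ioi (0 : ℝ),
      ((Real.exp (-t) * t ^ (|ν| - 1 / 2) : ℝ) : ℂ) * (1 + t / (2 * z)) ^ ((|ν| - 1 / 2 : ℝ) : ℂ)

/-- `X_k = (2k+1)πa + iλa` for `s = 1`, and its counterpart `(2k+1)πa - iλa` for `s = -1`. -/
def besselX (lam : ℝ) (s : ℝ) (a : ℂ) (k : ℕ) : ℂ :=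
  (2 * k + 1) * π * a + s * lam * Complex.I * a

/-- `K_{1/2-μ}(X) / X^{1/2-μ}`. -/
def besselQuot (mu : ℝ) (X : ℂ) : ℂ := besselK (1 / 2 - mu) X / X ^ ((1 / 2 - mu : ℝ) : ℂ)

/-- The `k`-th term of the series of Bessel functions, that is, of the contributions beyond the two
branch points `± i a`, in the form that is analytic in `a`. The factor `Γ(1-μ)/π` is
`1 / (Γ(μ) sin πμ)`, which is thereby given its limit value `1/π` at `μ = 0`. -/
def besselTerm (lam mu : ℝ) (a : ℂ) (k : ℕ) : ℂ :=
  (Real.sqrt π * 2 ^ (1 / 2 - mu) * (Real.Gamma (1 - mu) / π) : ℝ) * a ^ ((1 - 2 * mu : ℝ) : ℂ) *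
    (Complex.I * Complex.exp (-(π * mu * Complex.I)) * besselQuot mu (besselX lam 1 a k)
      - Complex.I * Complex.exp (π * mu * Complex.I) * besselQuot mu (besselX lam (-1) a k))

/-- `T_μ(a; λ)`, the sum of the Bessel terms. -/
def mathieuT (lam mu : ℝ) (a : ℂ) : ℂ := ∑' k : ℕ, besselTerm lam mu a k

/-- For `a > 0`: `(sin (πμ - θ_k) / sin πμ) |K_{1/2-μ}(X_k) / X_k^{1/2-μ}|`, where
`θ_k = arg (X_k^{μ-1/2} K_{1/2-μ}(X_k))`. -/
def realBesselTerm (lam mu a : ℝ) (k : ℕ) : ℝ :=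
  Real.sin (π * mu - Complex.arg (besselX lam 1 a k ^ ((mu - 1 / 2 : ℝ) : ℂ)
      * besselK (1 / 2 - mu) (besselX lam 1 a k))) / Real.sin (π * mu)
    * ‖besselQuot mu (besselX lam 1 a k)‖

/-- The partial sum `a^{-2μ} ∑_{k<N} (μ)_k B_k / (k! a^{2k})`. -/
def algebraicSum (lam mu : ℝ) (N : ℕ) (a : ℂ) : ℂ :=
  a ^ ((-2 * mu : ℝ) : ℂ) * ∑ k ∈ Finset.range N,
    (((ascPochhammer ℝ k).eval mu * coeffB lam k : ℝ) : ℂ) / ((Nat.factorial k : ℂ) * a ^ (2 * k))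

/-- The filter `|a| → ∞` in the sector `|arg a| ≤ φ`. -/
def inftyInSector (φ : ℝ) : Filter ℂ :=
  Bornology.cobounded ℂ ⊓ 𝓟 {a : ℂ | |Complex.arg a| ≤ φ}

/-- The generalised hypergeometric series `pFq`. -/
def hypergeometricPFQ {p q : ℕ} (α : Fin p → ℂ) (β : Fin q → ℂ) (z : ℂ) : ℂ :=
  ∑' k : ℕ, (∏ i, (ascPochhammer ℂ k).eval (α i)) / (∏ j, (ascPochhammer ℂ k).eval (β j))
    * (z ^ k / (Nat.factorial k : ℂ))

/-- `F_n(a)`, the function `_{n+1}F_n (1, ia, …, ia; 1+ia, …, 1+ia; -e^{-λ})`. -/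
def hyperF (lam : ℝ) (n : ℕ) (a : ℂ) : ℂ :=
  hypergeometricPFQ (Fin.cons 1 (fun _ : Fin n => Complex.I * a))
    (fun _ : Fin n => 1 + Complex.I * a) (-Complex.exp (-lam))

/-- `ℱ_n = F_n(a) + F_n(-a)`. -/
def hyperFsym (lam : ℝ) (n : ℕ) (a : ℂ) : ℂ := hyperF lam n a + hyperF lam n (-a)

end

section

open MeasureTheory

/-! The representation comes from the alternating Abel–Plana formula `tsum_alternating_eq`: `∑
(-1)^n g(n) = g(0)/2 + (i/2) ∫_0^∞ (g(iy) - g(-iy)) / sinh πy dy`, where `g` is analytic in the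
right half-plane and `g(±iy)` are boundary values. Take `g(z) = e^{-λz} (z² + a²)^{-μ}` with `a > 0`
and `0 ≤ μ < 1`. The branch points are `±ia`. For `y < a` the two powers coincide and the
exponentials combine to a sine, which gives `integralH`. For `y > a` the powers carry the phases
`e^{∓πiμ}`, and expanding `1 / sinh πy` in the exponentials `e^{-(2k+1)πy}` leaves integrals of `(y²
- a²)^{-μ} e^{-cy}`, which are Bessel functions: this part is `T`. So the representation holds for
real `a` (`mathieuS_eq_of_real`), and the identity theorem extends it to `Re a > 0`.

For `μ ≥ 1` the singularity at `y = a` is not integrable. Instead one uses that every component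
satisfies the same ladder `dX_μ/da = -2μ a X_{μ+1}`: the sum `S`, the term `1/(2a^{2μ})`, the Bessel
series `T`, and each term of the power series of `H`. With `H` defined as `S - 1/(2a^{2μ}) - T`
(`mathieuH`) the representation is automatic; what has to be proved is that this `H` has the stated
integral and power series. For `μ < 1` both follow from the above and the Beta integral, and the
ladder carries the power series from `μ` to `μ + 1` (`hasSum_seriesTermH_add_one`). The limit at an
integer is then the continuity of `S` in `μ`.

The asymptotic expansion of `S` does not use the representation. One expands `(1 + n²/a²)^{-μ}`
binomially under the sum; Abel–Plana for `z^{2k} e^{-λz}` evaluates the resulting sums as `(-1)^k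
B_k`, plus `1/2` when `k = 0` (`tsum_alternating_pow_mul_exp`). Since `T` is exponentially small for
`|arg a| ≤ φ < arctan(π/λ)`, the expansion passes to `H` there.

For the closed forms, `ℱ_n` is the sum over `k` of `(-e^{-λ})^k (u^n + v^n)`, where `u, v` are the
roots of `X² - 2wX + w` and `w = a²/(k² + a²)`. Expressing `w^m` through the power sums of `u, v`
gives the combinations of `ℱ_1, …, ℱ_m`. -/

/-! ### Holomorphic parameter integrals and the identity theorem on the half-plane. -/

/-- Cauchy's estimate converts the bound on the integrand into a Lipschitz bound on a smaller ball,
so no separate domination of the derivative is needed. -/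
theorem hasDerivAt_integral_of_holomorphic {α : Type*} [MeasurableSpace α] {μ : Measure α}
    {F : ℂ → α → ℂ} {z₀ : ℂ} {r : ℝ} (hr : 0 < r) {b : α → ℝ} (hb : Integrable b μ)
    (hmeas : ∀ z ∈ Metric.ball z₀ r, AEStronglyMeasurable (F z) μ)
    (hdiff : ∀ᵐ t ∂μ, DifferentiableOn ℂ (fun z => F z t) (Metric.ball z₀ r))
    (hbound : ∀ᵐ t ∂μ, ∀ z ∈ Metric.ball z₀ r, ‖F z t‖ ≤ b t) :
    Integrable (fun t => deriv (fun z => F z t) z₀) μ ∧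
      HasDerivAt (fun z => ∫ t, F z t ∂μ) (∫ t, deriv (fun z => F z t) z₀ ∂μ) z₀ := by
  have hz₀ : z₀ ∈ Metric.ball z₀ r := Metric.mem_ball_self hr
  have hderiv : ∀ᵐ t ∂μ, HasDerivAt (fun z => F z t) (deriv (fun z => F z t) z₀) z₀ := by
    filter_upwards [hdiff] with t ht
    exact (ht.differentiableAt (Metric.isOpen_ball.mem_nhds hz₀)).hasDerivAt
  have hm' : AEStronglyMeasurable (fun t => deriv (fun z => F z t) z₀) μ := by
    -- The derivative is measurable as a limit of difference quotients; the increments `r/(n+2)`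
    -- stay strictly inside the ball already at `n = 0`.
    have hseq : Tendsto (fun n : ℕ => z₀ + ((r / (n + 2) : ℝ) : ℂ)) atTop (𝓝[≠] z₀) := by
      refine tendsto_nhdsWithin_iff.2 ⟨?_, Eventually.of_forall fun n => ?_⟩
      · have h1 : Tendsto (fun n : ℕ => r / ((n : ℝ) + 2)) atTop (𝓝 0) :=
          tendsto_const_nhds.div_atTop
            (tendsto_atTop_add_const_right _ _ tendsto_natCast_atTop_atTop)
        have h2 := (Complex.continuous_ofReal.tendsto 0).comp h1
        simpa using (tendsto_const_nhds (x := z₀)).add h2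
      · have : r / ((n : ℝ) + 2) ≠ 0 := by positivity
        exact fun h => this (by exact_mod_cast add_eq_left.1 h)
    refine aestronglyMeasurable_of_tendsto_ae atTop
      (f := fun (n : ℕ) t => slope (fun z => F z t) z₀ (z₀ + ((r / (n + 2) : ℝ) : ℂ)))
      (fun n => ?_) ?_
    · simp only [slope_def_module]
      have hn : z₀ + ((r / (n + 2) : ℝ) : ℂ) ∈ Metric.ball z₀ r := ?_
      · exact ((hmeas _ hn).sub (hmeas _ hz₀)).const_smul (z₀ + ((r / (n + 2) : ℝ) : ℂ) - z₀)⁻¹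
      rw [Metric.mem_ball, dist_eq_norm, add_sub_cancel_left, Complex.norm_real,
        Real.norm_of_nonneg (by positivity)]
      exact div_lt_self hr (by have := Nat.cast_nonneg (α := ℝ) n; linarith)
    · filter_upwards [hderiv] with t ht
      exact (hasDerivAt_iff_tendsto_slope.1 ht).comp hseq
  -- Circles of radius `r/3` about points of the ball of radius `r/2` stay inside the ball of radius
  -- `r`, since `1/2 + 1/3 < 1`.
  refine hasDerivAt_integral_of_dominated_loc_of_lip (bound := fun t => b t / (r / 3))
    (Metric.ball_mem_nhds z₀ (half_pos hr)) ?_ ?_ hm' ?_ (hb.div_const _) hderiv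
  · filter_upwards [Metric.ball_mem_nhds z₀ hr] with z hz using hmeas z hz
  · exact hb.mono' (hmeas _ hz₀) (hbound.mono fun t ht => ht _ hz₀)
  · filter_upwards [hdiff, hbound] with t hd hbt
    have hb0 : 0 ≤ b t := (norm_nonneg _).trans (hbt _ hz₀)
    refine (convex_ball z₀ (r / 2)).lipschitzOnWith_of_nnnorm_deriv_le (𝕜 := ℂ) (fun z hz => ?_)
      fun z hz => ?_
    · refine hd.differentiableAt (Metric.isOpen_ball.mem_nhds ?_)
      exact Metric.ball_subset_ball (by linarith) hz
    · have hsub : Metric.closedBall z (r / 3) ⊆ Metric.ball z₀ r := by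
        intro w hw
        rw [Metric.mem_closedBall] at hw
        rw [Metric.mem_ball] at hz ⊢
        linarith [dist_triangle w z z₀]
      have h3 : ‖deriv (fun z => F z t) z‖ ≤ b t / (r / 3) :=
        Complex.norm_deriv_le_of_forall_mem_sphere_norm_le (by positivity)
          (hd.diffContOnCl_ball hsub) fun w hw => hbt w (hsub (Metric.sphere_subset_closedBall hw))
      rw [← NNReal.coe_le_coe, coe_nnnorm, Real.coe_nnabs]
      exact h3.trans (le_abs_self _)

/-- The positive reals accumulate at `1`. This is the device by which identities between principal
powers are checked only where no branch question arises. -/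
theorem eqOn_re_pos_of_eq_on_pos_reals {f g : ℂ → ℂ}
    (hf : DifferentiableOn ℂ f {a : ℂ | 0 < a.re}) (hg : DifferentiableOn ℂ g {a : ℂ | 0 < a.re})
    (h : ∀ x : ℝ, 0 < x → f x = g x) : ∀ a : ℂ, 0 < a.re → f a = g a := by
  have ho : IsOpen {a : ℂ | 0 < a.re} := isOpen_lt continuous_const Complex.continuous_re
  have hc : IsPreconnected {a : ℂ | 0 < a.re} := (convex_halfSpace_re_gt 0).isPreconnected
  have h1 : (1 : ℂ) ∈ {a : ℂ | 0 < a.re} := by simp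
  have key := (hf.analyticOnNhd ho).eqOn_of_preconnected_of_frequently_eq (hg.analyticOnNhd ho) hc h1
    (by
      have hseq : Tendsto (fun n : ℕ => (1 : ℂ) + ((1 / ((n : ℝ) + 1) : ℝ) : ℂ)) atTop (𝓝[≠] 1) := by
        refine tendsto_nhdsWithin_iff.2 ⟨?_, Eventually.of_forall fun n => ?_⟩
        · have h2 := (Complex.continuous_ofReal.tendsto 0).comp tendsto_one_div_add_atTop_nhds_zero_nat
          simpa using (tendsto_const_nhds (x := (1 : ℂ))).add h2
        · have : (1 : ℝ) / ((n : ℝ) + 1) ≠ 0 := by positivity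
          simpa using Nat.cast_add_one_ne_zero (R := ℂ) n
      refine hseq.frequently (Frequently.of_forall fun n => ?_)
      have := h (1 + 1 / ((n : ℝ) + 1)) (by positivity)
      simpa using this)
  exact fun a ha => key ha

/-! ### Vertical line integrals and the alternating Abel–Plana formula. -/

theorem integrable_exp_neg_mul_abs {c : ℝ} (hc : 0 < c) :
    Integrable (fun y : ℝ => Real.exp (-c * |y|)) := by
  have h1 : IntegrableOn (fun y : ℝ => Real.exp (-c * |y|)) (Set.Ioi 0) := by
    refine (integrableOn_exp_mul_Ioi (neg_lt_zero.2 hc) 0).congr_fun (fun y hy => ?_)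
      measurableSet_Ioi
    simp only [abs_of_pos (show (0 : ℝ) < y from hy)]
  have h2 : IntegrableOn (fun y : ℝ => Real.exp (-c * |y|)) (Set.Iic 0) := by
    refine (integrableOn_exp_mul_Iic hc 0).congr_fun (fun y hy => ?_) measurableSet_Iic
    simp only [abs_of_nonpos (show y ≤ (0 : ℝ) from hy)]
    ring_nf
  have := h2.union h1
  rwa [Set.Iic_union_Ioi, integrableOn_univ] at this

/-- Cauchy's theorem for a vertical strip. -/
theorem integral_vertical_line_eq {f : ℂ → ℂ} {a b c C : ℝ} (hab : a < b) (hc : 0 < c)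
    {s : Set ℂ} (hs : s.Countable) (hcont : ContinuousOn f {z : ℂ | a ≤ z.re ∧ z.re ≤ b})
    (hd : ∀ z : ℂ, a < z.re → z.re < b → z ∉ s → DifferentiableAt ℂ f z)
    (hbound : ∀ z : ℂ, a ≤ z.re → z.re ≤ b → 1 ≤ |z.im| → ‖f z‖ ≤ C * Real.exp (-c * |z.im|))
    (ha : Integrable fun y : ℝ => f (a + y * Complex.I))
    (hb : Integrable fun y : ℝ => f (b + y * Complex.I)) :
    ∫ y : ℝ, f (a + y * Complex.I) = ∫ y : ℝ, f (b + y * Complex.I) := by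
  -- Cauchy on the rectangle of height `2T`; the two horizontal sides are exponentially small in
  -- `T`.
  have hrect : ∀ T : ℝ, 0 < T →
      (∫ y : ℝ in -T..T, f (b + y * Complex.I)) - (∫ y : ℝ in -T..T, f (a + y * Complex.I))
        = Complex.I * ((∫ x : ℝ in a..b, f (x + (-T : ℝ) * Complex.I))
          - ∫ x : ℝ in a..b, f (x + T * Complex.I)) := by
    intro T hT
    have h := Complex.integral_boundary_rect_eq_zero_of_differentiable_on_off_countable f
      ⟨a, -T⟩ ⟨b, T⟩ s hs
      (hcont.mono fun z hz => by
        rw [Complex.mem_reProdIm, Set.uIcc_of_le hab.le] at hz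
        exact hz.1)
      (fun z hz => by
        have h1 := hz.1
        rw [Complex.mem_reProdIm] at h1
        simp only [min_eq_left hab.le, max_eq_right hab.le] at h1
        exact hd z h1.1.1 h1.1.2 hz.2)
    simp only [smul_eq_mul] at h
    have hI := Complex.I_mul_I
    linear_combination (-Complex.I) * h + ((∫ y : ℝ in -T..T, f (b + y * Complex.I))
      - (∫ y : ℝ in -T..T, f (a + y * Complex.I))) * hI
  have hhor : ∀ σ : ℝ, |σ| = 1 →
      Tendsto (fun T : ℝ => ∫ x : ℝ in a..b, f (x + (σ * T : ℝ) * Complex.I)) atTop (𝓝 0) := by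
    intro σ hσ
    have hlim : Tendsto (fun T : ℝ => C * Real.exp (-c * T) * |b - a|) atTop (𝓝 0) := by
      have : Tendsto (fun T : ℝ => Real.exp (-c * T)) atTop (𝓝 0) :=
        Real.tendsto_exp_atBot.comp (tendsto_id.const_mul_atTop_of_neg (neg_lt_zero.2 hc))
      simpa using (this.const_mul C).mul_const |b - a|
    refine squeeze_zero_norm' ?_ hlim
    filter_upwards [eventually_ge_atTop 1] with T hT
    refine intervalIntegral.norm_integral_le_of_norm_le_const fun x hx => ?_
    rw [Set.uIoc_of_le hab.le] at hx
    have him : |(x + (σ * T : ℝ) * Complex.I : ℂ).im| = T := by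
      simp [abs_mul, hσ, abs_of_nonneg (zero_le_one.trans hT)]
    have hre : (x + (σ * T : ℝ) * Complex.I : ℂ).re = x := by simp
    have := hbound (x + (σ * T : ℝ) * Complex.I) (by rw [hre]; exact hx.1.le) (by rw [hre]; exact hx.2)
      (by rw [him]; exact hT)
    rwa [him] at this
  have h1 := (intervalIntegral_tendsto_integral hb tendsto_neg_atTop_atBot tendsto_id).sub
    (intervalIntegral_tendsto_integral ha tendsto_neg_atTop_atBot tendsto_id)
  have h2 := ((hhor (-1) (by simp)).sub (hhor 1 (by simp))).const_mul Complex.I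
  have h3 : Tendsto (fun T : ℝ => (∫ y : ℝ in -T..T, f (b + y * Complex.I))
      - (∫ y : ℝ in -T..T, f (a + y * Complex.I))) atTop (𝓝 (Complex.I * (0 - 0))) := by
    refine h2.congr' ?_
    filter_upwards [eventually_gt_atTop 0] with T hT
    rw [hrect T hT]
    simp
  have := tendsto_nhds_unique h1 h3
  simp only [sub_zero, mul_zero] at this
  exact (sub_eq_zero.1 this).symm

theorem normSq_sin (z : ℂ) : ‖Complex.sin z‖ ^ 2 = Real.sin z.re ^ 2 + Real.sinh z.im ^ 2 := by
  rw [← Complex.normSq_eq_norm_sq, Complex.normSq_apply, Complex.sin_eq z]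
  have h1 := Real.cosh_sq z.im
  have h2 := Real.sin_sq_add_cos_sq z.re
  simp only [Complex.add_re, Complex.mul_re, Complex.add_im, Complex.mul_im, Complex.I_re,
    Complex.I_im, ← Complex.ofReal_sin, ← Complex.ofReal_cos, ← Complex.ofReal_sinh,
    ← Complex.ofReal_cosh, Complex.ofReal_re, Complex.ofReal_im]
  linear_combination Real.sin z.re ^ 2 * h1 + Real.sinh z.im ^ 2 * h2


theorem abs_sinh_im_le_norm_sin (z : ℂ) : |Real.sinh z.im| ≤ ‖Complex.sin z‖ := by
  refine abs_le_of_sq_le_sq' ?_ (norm_nonneg _) |> abs_le.2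
  rw [normSq_sin]
  nlinarith [sq_nonneg (Real.sin z.re)]

theorem exp_abs_le_norm_sin_pi_mul {z : ℂ} (hz : 1 ≤ |z.im|) :
    Real.exp (π * |z.im|) / 4 ≤ ‖Complex.sin (π * z)‖ := by
  refine le_trans ?_ (abs_sinh_im_le_norm_sin _)
  have him : (π * z : ℂ).im = π * z.im := by simp
  rw [him, Real.abs_sinh, abs_mul, abs_of_pos pi_pos, Real.sinh_eq]
  have h1 : 1 ≤ π * |z.im| := by nlinarith [pi_gt_three]
  have h2 : (2 : ℝ) ≤ Real.exp (π * |z.im|) := by linarith [Real.add_one_le_exp (π * |z.im|)]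
  have h3 : Real.exp (-(π * |z.im|)) ≤ 1 := Real.exp_le_one_iff.2 (by linarith)
  linarith

/-- Midway between its zeros the sine is, up to sign, a hyperbolic cosine. Hence `1 / sin πz` can be
integrated exactly along these lines, which replaces a residue computation. -/
theorem sin_pi_mul_half_integer_line (m : ℕ) (y : ℝ) :
    Complex.sin (π * (((m : ℝ) + 1 / 2 : ℝ) + y * Complex.I)) = (-1) ^ m * (Real.cosh (π * y) : ℂ) := by
  have h1 : (π * (((m : ℝ) + 1 / 2 : ℝ) + y * Complex.I) : ℂ)
      = ((π * y : ℝ) * Complex.I + π / 2) + m * π := by push_cast; ring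
  rw [h1, Complex.sin_antiperiodic.add_nat_mul_eq, Complex.sin_add_pi_div_two, Complex.cos_mul_I,
    Complex.ofReal_cosh]

theorem integral_inv_cosh_pi_mul :
    Integrable (fun y : ℝ => (Real.cosh (π * y))⁻¹) ∧ ∫ y : ℝ, (Real.cosh (π * y))⁻¹ = 1 := by
  have hcosh : ∀ y : ℝ, Real.exp (π * |y|) / 2 ≤ Real.cosh (π * y) := by
    intro y
    rw [← Real.cosh_abs, abs_mul, abs_of_pos pi_pos, Real.cosh_eq]
    linarith [Real.exp_pos (-(π * |y|))]
  have hint : Integrable (fun y : ℝ => (Real.cosh (π * y))⁻¹) := by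
    refine ((integrable_exp_neg_mul_abs pi_pos).const_mul 2).mono' ?_ (Eventually.of_forall fun y => ?_)
    · have : Continuous fun y : ℝ => (Real.cosh (π * y))⁻¹ :=
        Continuous.inv₀ (by fun_prop) fun y => (Real.cosh_pos _).ne'
      exact this.aestronglyMeasurable
    · rw [Real.norm_of_nonneg (inv_nonneg.2 (Real.cosh_pos _).le), neg_mul, Real.exp_neg]
      have := inv_anti₀ (by positivity) (hcosh y)
      rwa [inv_div, div_eq_mul_inv] at this
  refine ⟨hint, ?_⟩
  have hder : ∀ y : ℝ, HasDerivAt (fun y : ℝ => Real.arctan (Real.sinh (π * y)) / π)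
      ((Real.cosh (π * y))⁻¹) y := by
    intro y
    have h := ((((hasDerivAt_id y).const_mul π).sinh).arctan).div_const π
    refine h.congr_deriv ?_
    have h1 := Real.cosh_sq (π * y)
    have h2 := (Real.cosh_pos (π * y)).ne'
    simp only [id]
    rw [add_comm, ← h1]
    field_simp
  have htop : Tendsto (fun y : ℝ => Real.sinh (π * y)) atTop atTop := by
    refine tendsto_atTop_mono' _ ?_ (tendsto_id.const_mul_atTop pi_pos)
    filter_upwards [eventually_ge_atTop 0] with y hy
    exact Real.self_le_sinh_iff.2 (mul_nonneg pi_pos.le hy)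
  have hbot : Tendsto (fun y : ℝ => Real.sinh (π * y)) atBot atBot := by
    have := tendsto_neg_atTop_atBot.comp (htop.comp tendsto_neg_atBot_atTop)
    refine this.congr fun y => ?_
    simp [Real.sinh_neg]
  have h := integral_of_hasDerivAt_of_tendsto hder hint
    (((Real.tendsto_arctan_atBot.mono_right nhdsWithin_le_nhds).comp hbot).div_const π)
    (((Real.tendsto_arctan_atTop.mono_right nhdsWithin_le_nhds).comp htop).div_const π)
  rw [h]
  field_simp
  ring

theorem sin_pi_mul_eq_zero {z : ℂ} (h : Complex.sin (π * z) = 0) : ∃ k : ℤ, z = k := by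
  obtain ⟨k, hk⟩ := Complex.sin_eq_zero_iff.1 h
  refine ⟨k, ?_⟩
  have hpi : (π : ℂ) ≠ 0 := Complex.ofReal_ne_zero.2 pi_ne_zero
  exact mul_left_cancel₀ hpi (by rw [hk]; ring)

/-- Growth `e^{|y|}` is beaten because `cosh πy ≥ e^{3|y|}/2`, leaving `2 e^{-2|y|}`. The explicit
constant `K` is kept so that the integrals can be shown to vanish as the line moves right. -/
theorem integrable_div_sin_half_integer_line {h : ℂ → ℂ} {K : ℝ}
    (hcont : ContinuousOn h {z : ℂ | 0 < z.re}) (m : ℕ)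
    (hK : ∀ y : ℝ, ‖h (((m : ℝ) + 1 / 2 : ℝ) + y * Complex.I)‖ ≤ K * Real.exp |y|) :
    Integrable (fun y : ℝ => h (((m : ℝ) + 1 / 2 : ℝ) + y * Complex.I) /
      Complex.sin (π * (((m : ℝ) + 1 / 2 : ℝ) + y * Complex.I))) ∧
    ‖∫ y : ℝ, h (((m : ℝ) + 1 / 2 : ℝ) + y * Complex.I) /
      Complex.sin (π * (((m : ℝ) + 1 / 2 : ℝ) + y * Complex.I))‖
      ≤ K * ∫ y : ℝ, 2 * Real.exp (-2 * |y|) := by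
  have hb : ∀ y : ℝ, ‖h (((m : ℝ) + 1 / 2 : ℝ) + y * Complex.I) /
      Complex.sin (π * (((m : ℝ) + 1 / 2 : ℝ) + y * Complex.I))‖ ≤ K * (2 * Real.exp (-2 * |y|)) := by
    intro y
    rw [sin_pi_mul_half_integer_line, norm_div, norm_mul, norm_pow, norm_neg, norm_one, one_pow,
      one_mul, Complex.norm_real, Real.norm_of_nonneg (Real.cosh_pos _).le, div_le_iff₀ (Real.cosh_pos _)]
    refine (hK y).trans ?_
    have hK0 : 0 ≤ K := by
      have := (norm_nonneg _).trans (hK y)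
      exact nonneg_of_mul_nonneg_left this (Real.exp_pos _)
    rw [mul_assoc]
    refine mul_le_mul_of_nonneg_left ?_ hK0
    have h1 : Real.exp (3 * |y|) / 2 ≤ Real.cosh (π * y) := by
      rw [← Real.cosh_abs, abs_mul, abs_of_pos pi_pos, Real.cosh_eq]
      have := Real.exp_le_exp.2 (mul_le_mul_of_nonneg_right pi_gt_three.le (abs_nonneg y))
      linarith [Real.exp_pos (-(π * |y|))]
    have h2 : Real.exp |y| = 2 * Real.exp (-2 * |y|) * (Real.exp (3 * |y|) / 2) := by
      rw [show |y| = -2 * |y| + 3 * |y| by ring, Real.exp_add]; ring_nf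
    rw [h2]
    gcongr
  have hi : Integrable fun y : ℝ => K * (2 * Real.exp (-2 * |y|)) :=
    ((integrable_exp_neg_mul_abs two_pos).const_mul 2).const_mul K
  refine ⟨hi.mono' ?_ (Eventually.of_forall hb), ?_⟩
  · refine Continuous.aestronglyMeasurable (Continuous.div ?_ (by fun_prop) fun y => ?_)
    · refine hcont.comp_continuous (by fun_prop) fun y => ?_
      have : (0 : ℝ) < m + 1 / 2 := by positivity
      simpa using this
    · rw [sin_pi_mul_half_integer_line]
      exact mul_ne_zero (pow_ne_zero _ (by norm_num))
        (Complex.ofReal_ne_zero.2 (Real.cosh_pos _).ne')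
  · rw [← integral_const_mul]
    exact norm_integral_le_of_norm_le hi (Eventually.of_forall hb)

theorem integral_const_div_sin_half_integer_line (w : ℂ) (m : ℕ) :
    ∫ y : ℝ, w / Complex.sin (π * (((m : ℝ) + 1 / 2 : ℝ) + y * Complex.I)) = (-1) ^ m * w := by
  have h : ∀ y : ℝ, w / Complex.sin (π * (((m : ℝ) + 1 / 2 : ℝ) + y * Complex.I))
      = ((-1) ^ m * w) * (((Real.cosh (π * y))⁻¹ : ℝ) : ℂ) := by
    intro y
    rw [sin_pi_mul_half_integer_line, div_eq_mul_inv, mul_inv, ← inv_pow, inv_neg_one,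
      Complex.ofReal_inv]
    ring
  simp_rw [h]
  rw [integral_const_mul, integral_complex_ofReal, integral_inv_cosh_pi_mul.2]
  simp

/-- The residue of `g / sin πz` at an integer, as a difference of vertical line integrals. -/
theorem integral_div_sin_sub {g : ℂ → ℂ} (hg : ∀ z : ℂ, 0 < z.re → DifferentiableAt ℂ g z) {K : ℝ}
    (hK : ∀ z : ℂ, 1 / 2 ≤ z.re → ‖g z‖ ≤ K * Real.exp |z.im|) (m : ℕ) :
    (∫ y : ℝ, g (((m + 1 : ℕ) + 1 / 2 : ℝ) + y * Complex.I) /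
        Complex.sin (π * (((m + 1 : ℕ) + 1 / 2 : ℝ) + y * Complex.I)))
      - ∫ y : ℝ, g (((m : ℝ) + 1 / 2 : ℝ) + y * Complex.I) /
        Complex.sin (π * (((m : ℝ) + 1 / 2 : ℝ) + y * Complex.I))
      = 2 * (-1) ^ (m + 1) * g (m + 1 : ℕ) := by
  set n : ℂ := ((m + 1 : ℕ) : ℂ) with hn
  set s : ℂ → ℂ := fun z => Complex.sin (π * z) with hs
  have hsd : Differentiable ℂ s := by fun_prop
  have hsn : s n = 0 := by
    simp only [hs, hn, mul_comm (π : ℂ)]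
    exact Complex.sin_nat_mul_pi _
  have hnre : n.re = m + 1 := by simp [hn]
  have hnpos : 0 < n.re := by rw [hnre]; positivity
  have hgcont : ContinuousOn g {z : ℂ | 0 < z.re} := fun z hz =>
    (hg z hz).continuousAt.continuousWithinAt
  -- Subtracting `g n` removes the pole at `n`, so the two line integrals of the difference agree by
  -- Cauchy. The subtracted constant contributes exactly `(-1)^k g n` on the `k`-th line, and the
  -- jump `(-1)^(m+1) - (-1)^m` is the factor `2 (-1)^(m+1)`.
  have hcont' : ContinuousOn (fun z => g z - g n) {z : ℂ | 0 < z.re} := hgcont.sub continuousOn_const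
  have hK' : ∀ z : ℂ, 1 / 2 ≤ z.re → ‖g z - g n‖ ≤ (K + ‖g n‖) * Real.exp |z.im| := by
    intro z hz
    refine (norm_sub_le _ _).trans ?_
    have : (1 : ℝ) ≤ Real.exp |z.im| := Real.one_le_exp (abs_nonneg _)
    nlinarith [hK z hz, norm_nonneg (g n)]
  have hline : ∀ (k : ℕ) (y : ℝ), 1 / 2 ≤ ((((k : ℝ) + 1 / 2 : ℝ) : ℂ) + y * Complex.I).re := by
    intro k y
    have : (0 : ℝ) ≤ k := k.cast_nonneg
    simp
  have him : ∀ (k : ℕ) (y : ℝ), ((((k : ℝ) + 1 / 2 : ℝ) : ℂ) + y * Complex.I).im = y := by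
    intro k y; simp
  have hi1 : ∀ k : ℕ, Integrable (fun y : ℝ => g (((k : ℝ) + 1 / 2 : ℝ) + y * Complex.I) /
      Complex.sin (π * (((k : ℝ) + 1 / 2 : ℝ) + y * Complex.I))) := fun k =>
    (integrable_div_sin_half_integer_line hgcont k fun y => by
      have := hK _ (hline k y); rwa [him] at this).1
  have hi2 : ∀ k : ℕ, Integrable (fun y : ℝ => (g (((k : ℝ) + 1 / 2 : ℝ) + y * Complex.I) - g n) /
      Complex.sin (π * (((k : ℝ) + 1 / 2 : ℝ) + y * Complex.I))) := fun k =>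
    (integrable_div_sin_half_integer_line hcont' k fun y => by
      have := hK' _ (hline k y); rwa [him] at this).1
  have hi3 : ∀ k : ℕ, Integrable (fun y : ℝ => g n /
      Complex.sin (π * (((k : ℝ) + 1 / 2 : ℝ) + y * Complex.I))) := fun k => by
    have := (hi1 k).sub (hi2 k)
    refine this.congr (Eventually.of_forall fun y => ?_)
    simp only [Pi.sub_apply]
    ring
  have hsplit : ∀ k : ℕ, ∫ y : ℝ, (g (((k : ℝ) + 1 / 2 : ℝ) + y * Complex.I) - g n) /
      Complex.sin (π * (((k : ℝ) + 1 / 2 : ℝ) + y * Complex.I))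
      = (∫ y : ℝ, g (((k : ℝ) + 1 / 2 : ℝ) + y * Complex.I) /
        Complex.sin (π * (((k : ℝ) + 1 / 2 : ℝ) + y * Complex.I))) - (-1) ^ k * g n := by
    intro k
    rw [← integral_const_div_sin_half_integer_line, ← integral_sub (hi1 k) (hi3 k)]
    simp only [sub_div]
  have hne : ∀ (k : ℕ) (_ : k = m ∨ k = m + 1) (y : ℝ),
      (((k : ℝ) + 1 / 2 : ℝ) : ℂ) + y * Complex.I ≠ n := by
    intro k hk y h
    have h1 := congrArg Complex.re h
    rw [hnre] at h1
    simp at h1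
    rcases hk with rfl | rfl
    · norm_num at h1
    · push_cast at h1; linarith
  -- The quotient of divided differences is `(g z - g n) / sin πz` off `n` and continuous at `n`.
  set f : ℂ → ℂ := fun z => dslope g n z / dslope s n z with hf
  have hfne : ∀ z, z ≠ n → f z = (g z - g n) / Complex.sin (π * z) := by
    intro z hz
    have h0 : z - n ≠ 0 := sub_ne_zero.2 hz
    simp only [hf]
    rw [dslope_of_ne _ hz, dslope_of_ne _ hz, slope_def_module, slope_def_module, hsn, sub_zero,
      smul_eq_mul, smul_eq_mul, mul_div_mul_left _ _ (inv_ne_zero h0)]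
  -- In the closed strip `n` is the only zero of `sin πz`, and it is simple.
  have hs0 : ∀ z : ℂ, (m : ℝ) + 1 / 2 ≤ z.re → z.re ≤ (m + 1 : ℕ) + 1 / 2 → dslope s n z ≠ 0 := by
    intro z h1 h2
    by_cases hz : z = n
    · have hder : HasDerivAt s (Complex.cos (π * n) * (π * 1)) n :=
        ((hasDerivAt_id n).const_mul (π : ℂ)).csin
      rw [hz, dslope_same, hder.deriv]
      refine mul_ne_zero ?_ (by simp [pi_ne_zero])
      intro h
      have := Complex.sin_sq_add_cos_sq (π * n)
      rw [h, show Complex.sin (π * n) = 0 from hsn] at this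
      simp at this
    · rw [dslope_of_ne _ hz, slope_def_module, hsn, sub_zero]
      refine smul_ne_zero (inv_ne_zero (sub_ne_zero.2 hz)) fun h => hz ?_
      obtain ⟨k, rfl⟩ := sin_pi_mul_eq_zero h
      have h3 : (k : ℝ) < m + 2 := by push_cast at h2; simp at h2; linarith
      have h4 : (m : ℝ) < k := by simp at h1; linarith
      have h5 : k = m + 1 := by
        have h3' : k < m + 2 := by exact_mod_cast h3
        have h4' : (m : ℤ) < k := by exact_mod_cast h4
        omega
      rw [h5, hn]; push_cast; rfl
  have hpos : ∀ z : ℂ, (m : ℝ) + 1 / 2 ≤ z.re → 0 < z.re := fun z hz =>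
    lt_of_lt_of_le (by positivity) hz
  have hkey := integral_vertical_line_eq (f := f) (a := (m : ℝ) + 1 / 2) (b := (m + 1 : ℕ) + 1 / 2)
    (c := 2) (C := 4 * (K + ‖g n‖)) (by push_cast; linarith) two_pos (Set.countable_singleton n)
    (fun z hz => by
      refine ContinuousAt.continuousWithinAt (ContinuousAt.div ?_ ?_ (hs0 z hz.1 hz.2))
      · by_cases h : z = n
        · rw [h]; exact continuousAt_dslope_same.2 (hg n hnpos)
        · exact (continuousAt_dslope_of_ne h).2 (hg z (hpos z hz.1)).continuousAt
      · by_cases h : z = n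
        · rw [h]; exact continuousAt_dslope_same.2 (hsd n)
        · exact (continuousAt_dslope_of_ne h).2 (hsd z).continuousAt)
    (fun z h1 h2 h3 => by
      have h : z ≠ n := h3
      exact ((differentiableAt_dslope_of_ne h).2 (hg z (hpos z h1.le))).div
        ((differentiableAt_dslope_of_ne h).2 (hsd z)) (hs0 z h1.le h2.le))
    (fun z h1 h2 h3 => by
      have h : z ≠ n := by
        rintro rfl
        simp [hn] at h3
        linarith
      have hm0 : (0 : ℝ) ≤ m := m.cast_nonneg
      have hsin := exp_abs_le_norm_sin_pi_mul h3
      have hKz := hK' z (by linarith)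
      have hKn : 0 ≤ K + ‖g n‖ :=
        nonneg_of_mul_nonneg_left ((norm_nonneg _).trans hKz) (Real.exp_pos _)
      rw [hfne z h, norm_div, div_le_iff₀ (lt_of_lt_of_le (by positivity) hsin)]
      refine hKz.trans ?_
      have h4 : Real.exp |z.im| = Real.exp (-2 * |z.im|) * Real.exp (3 * |z.im|) := by
        rw [← Real.exp_add]; ring_nf
      have h5 : Real.exp (3 * |z.im|) ≤ Real.exp (π * |z.im|) :=
        Real.exp_le_exp.2 (mul_le_mul_of_nonneg_right pi_gt_three.le (abs_nonneg _))
      calc (K + ‖g n‖) * Real.exp |z.im|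
          = 4 * (K + ‖g n‖) * Real.exp (-2 * |z.im|) * (Real.exp (3 * |z.im|) / 4) := by
            rw [h4]; ring
        _ ≤ _ := by
            refine mul_le_mul_of_nonneg_left ?_ (by positivity)
            linarith)
    ((hi2 m).congr (Eventually.of_forall fun y => (hfne _ (hne m (Or.inl rfl) y)).symm))
    ((hi2 (m + 1)).congr (Eventually.of_forall fun y => (hfne _ (hne _ (Or.inr rfl) y)).symm))
  rw [integral_congr_ae (Eventually.of_forall fun y => hfne _ (hne m (Or.inl rfl) y)),
    integral_congr_ae (Eventually.of_forall fun y => hfne _ (hne (m + 1) (Or.inr rfl) y)),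
    hsplit m, hsplit (m + 1)] at hkey
  linear_combination -hkey

/-- The alternating Abel–Plana formula. -/
theorem alternating_abelPlana {g : ℂ → ℂ} {G : ℝ → ℂ} {g₀ : ℂ} {c : ℝ} (hc : 0 < c)
    (hg : ∀ z : ℂ, 0 < z.re → DifferentiableAt ℂ g z)
    (hbd : ∀ δ > 0, ∃ C : ℝ, ∀ z : ℂ, δ ≤ z.re →
      ‖g z‖ ≤ C * Real.exp (-c * z.re) * Real.exp |z.im|)
    {b : ℝ → ℝ} (hb : Integrable b)
    (hdom : ∀ᵐ y : ℝ, ∀ x : ℝ, 0 < x → x ≤ 1 / 4 →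
      ‖g (x + y * Complex.I) - g₀‖ ≤ b y * ‖Complex.sin (π * (x + y * Complex.I))‖)
    (hlim : ∀ᵐ y : ℝ, Tendsto (fun x : ℝ => g (x + y * Complex.I)) (𝓝[>] 0) (𝓝 (G y))) :
    Integrable (fun y : ℝ => (G y - g₀) / (Real.sinh (π * y) * Complex.I)) ∧
    Tendsto (fun N : ℕ => ∑ n ∈ Finset.range N, (-1) ^ (n + 1) * g (n + 1 : ℕ)) atTop
      (𝓝 (-(g₀ + ∫ y : ℝ, (G y - g₀) / (Real.sinh (π * y) * Complex.I)) / 2)) := by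
  have hgcont : ContinuousOn g {z : ℂ | 0 < z.re} := fun z hz =>
    (hg z hz).continuousAt.continuousWithinAt
  have hcont' : ContinuousOn (fun z => g z - g₀) {z : ℂ | 0 < z.re} :=
    hgcont.sub continuousOn_const
  have hK : ∀ δ > 0, ∃ K : ℝ, 0 ≤ K ∧ ∀ z : ℂ, δ ≤ z.re → ‖g z‖ ≤ K * Real.exp |z.im| := by
    intro δ hδ
    obtain ⟨C, hC⟩ := hbd δ hδ
    refine ⟨|C|, abs_nonneg _, fun z hz => (hC z hz).trans ?_⟩
    refine mul_le_mul_of_nonneg_right ?_ (Real.exp_pos _).le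
    have h1 : Real.exp (-c * z.re) ≤ 1 := Real.exp_le_one_iff.2 (by nlinarith)
    calc C * Real.exp (-c * z.re) ≤ |C| * Real.exp (-c * z.re) :=
          mul_le_mul_of_nonneg_right (le_abs_self C) (Real.exp_pos _).le
      _ ≤ |C| * 1 := mul_le_mul_of_nonneg_left h1 (abs_nonneg _)
      _ = |C| := mul_one _
  set L : ℕ → ℂ := fun m => ∫ y : ℝ, g (((m : ℝ) + 1 / 2 : ℝ) + y * Complex.I) /
        Complex.sin (π * (((m : ℝ) + 1 / 2 : ℝ) + y * Complex.I)) with hL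
  have him : ∀ (x y : ℝ), ((x : ℂ) + y * Complex.I).im = y := fun x y => by simp
  have hre : ∀ (x y : ℝ), ((x : ℂ) + y * Complex.I).re = x := fun x y => by simp
  -- Each term is half a difference of consecutive line integrals, so the sum telescopes; `L N → 0`
  -- by the decay `e^{-c Re z}`.
  have hsum : ∀ N : ℕ, ∑ n ∈ Finset.range N, (-1) ^ (n + 1) * g (n + 1 : ℕ) = (L N - L 0) / 2 := by
    intro N
    obtain ⟨K, -, hK⟩ := hK (1 / 2) (by norm_num)
    rw [← Finset.sum_range_sub, Finset.sum_div]
    refine Finset.sum_congr rfl fun m _ => ?_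
    simp only [hL]
    rw [integral_div_sin_sub hg hK m]
    ring
  have hLlim : Tendsto L atTop (𝓝 0) := by
    obtain ⟨C, hC⟩ := hbd (1 / 2) (by norm_num)
    have h1 : Tendsto (fun m : ℕ => C * Real.exp (-c * ((m : ℝ) + 1 / 2)) *
        ∫ y : ℝ, 2 * Real.exp (-2 * |y|)) atTop (𝓝 (C * 0 * ∫ y : ℝ, 2 * Real.exp (-2 * |y|))) := by
      refine (Tendsto.const_mul _ (Real.tendsto_exp_atBot.comp ?_)).mul_const _
      exact (tendsto_atTop_add_const_right _ _ tendsto_natCast_atTop_atTop).const_mul_atTop_of_neg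
        (neg_lt_zero.2 hc)
    rw [mul_zero, zero_mul] at h1
    refine squeeze_zero_norm (fun m => ?_) h1
    refine (integrable_div_sin_half_integer_line hgcont m fun y => ?_).2
    have := hC (((m : ℝ) + 1 / 2 : ℝ) + y * Complex.I) (by rw [hre]; simp)
    rwa [hre, him] at this
  have hsinne : ∀ z : ℂ, 0 < z.re → z.re < 1 → Complex.sin (π * z) ≠ 0 := by
    intro z h1 h2 h
    obtain ⟨k, rfl⟩ := sin_pi_mul_eq_zero h
    rw [Complex.intCast_re] at h1 h2
    have h1' : 0 < k := by exact_mod_cast h1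
    have h2' : k < 1 := by exact_mod_cast h2
    omega
  have hdiv : ContinuousOn (fun z => (g z - g₀) / Complex.sin (π * z)) {z : ℂ | 0 < z.re ∧ z.re < 1} :=
    (hcont'.mono fun z hz => hz.1).div (by fun_prop) fun z hz => hsinne z hz.1 hz.2
  have hmeas : ∀ x : ℝ, 0 < x → x ≤ 1 / 4 → AEStronglyMeasurable (fun y : ℝ =>
      (g (x + y * Complex.I) - g₀) / Complex.sin (π * (x + y * Complex.I))) volume := by
    intro x hx hx'
    exact (hdiv.comp_continuous (by fun_prop) fun y =>
      ⟨by rw [hre]; exact hx, by rw [hre]; linarith⟩).aestronglyMeasurable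
  have hdom' : ∀ x : ℝ, 0 < x → x ≤ 1 / 4 → ∀ᵐ y : ℝ,
      ‖(g (x + y * Complex.I) - g₀) / Complex.sin (π * (x + y * Complex.I))‖ ≤ b y := by
    intro x hx hx'
    filter_upwards [hdom] with y hy
    rw [norm_div]
    refine div_le_of_le_mul₀ (norm_nonneg _) ?_ (hy x hx hx')
    have h1 := (norm_nonneg _).trans (hy x hx hx')
    exact nonneg_of_mul_nonneg_left h1
      (norm_pos_iff.2 (hsinne _ (by rw [hre]; exact hx) (by rw [hre]; linarith)))
  have hint : ∀ x : ℝ, 0 < x → x ≤ 1 / 4 → Integrable (fun y : ℝ =>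
      (g (x + y * Complex.I) - g₀) / Complex.sin (π * (x + y * Complex.I))) := fun x hx hx' =>
    hb.mono' (hmeas x hx hx') (hdom' x hx hx')
  -- There is no zero of `sin πz` between `Re z = x` and `Re z = 1/2`. On the latter line the
  -- constant `g₀` integrates to `g₀` itself.
  have hshift : ∀ x : ℝ, 0 < x → x ≤ 1 / 4 → ∫ y : ℝ,
      (g (x + y * Complex.I) - g₀) / Complex.sin (π * (x + y * Complex.I)) = L 0 - g₀ := by
    intro x hx hx'
    obtain ⟨K, hK0, hK⟩ := hK x hx
    have hK' : ∀ z : ℂ, x ≤ z.re → ‖g z - g₀‖ ≤ (K + ‖g₀‖) * Real.exp |z.im| := by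
      intro z hz
      refine (norm_sub_le _ _).trans ?_
      have : (1 : ℝ) ≤ Real.exp |z.im| := Real.one_le_exp (abs_nonneg _)
      nlinarith [hK z hz, norm_nonneg g₀]
    have hle : x ≤ (((0 : ℕ) : ℝ) + 1 / 2 : ℝ) := by push_cast; linarith
    have hi1 := (integrable_div_sin_half_integer_line hgcont 0 fun y => by
      have := hK (((0 : ℕ) + 1 / 2 : ℝ) + y * Complex.I) (by rw [hre]; exact hle)
      rwa [him] at this).1
    have hi2 := (integrable_div_sin_half_integer_line hcont' 0 fun y => by
      have := hK' (((0 : ℕ) + 1 / 2 : ℝ) + y * Complex.I) (by rw [hre]; exact hle)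
      rwa [him] at this).1
    have hi3 : Integrable (fun y : ℝ => g₀ /
        Complex.sin (π * ((((0 : ℕ) : ℝ) + 1 / 2 : ℝ) + y * Complex.I))) := by
      refine (hi1.sub hi2).congr (Eventually.of_forall fun y => ?_)
      simp only [Pi.sub_apply]
      ring
    have h0 := integral_const_div_sin_half_integer_line g₀ 0
    rw [pow_zero, one_mul] at h0
    have h1 := integral_sub hi1 hi3
    rw [h0] at h1
    refine Eq.trans ?_ h1
    simp only [← sub_div]
    refine integral_vertical_line_eq (f := fun z => (g z - g₀) / Complex.sin (π * z))
      (a := x) (c := 2) (C := 4 * (K + ‖g₀‖)) (by push_cast; linarith) two_pos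
      Set.countable_empty ?_ ?_ ?_ (hint x hx hx') hi2
    · refine hdiv.mono fun z hz => ⟨lt_of_lt_of_le hx hz.1, lt_of_le_of_lt hz.2 (by norm_num)⟩
    · intro z h1 h2 _
      have h3 : 0 < z.re := hx.trans h1
      have h4 : z.re < 1 := h2.trans (by norm_num)
      exact ((hg z h3).sub_const _).div (by fun_prop) (hsinne z h3 h4)
    · intro z h1 _ h3
      have hsin := exp_abs_le_norm_sin_pi_mul h3
      rw [norm_div, div_le_iff₀ (lt_of_lt_of_le (by positivity) hsin)]
      refine (hK' z h1).trans ?_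
      have h4 : Real.exp |z.im| = Real.exp (-2 * |z.im|) * Real.exp (3 * |z.im|) := by
        rw [← Real.exp_add]; ring_nf
      have h5 : Real.exp (3 * |z.im|) ≤ Real.exp (π * |z.im|) :=
        Real.exp_le_exp.2 (mul_le_mul_of_nonneg_right pi_gt_three.le (abs_nonneg _))
      calc (K + ‖g₀‖) * Real.exp |z.im|
          = 4 * (K + ‖g₀‖) * Real.exp (-2 * |z.im|) * (Real.exp (3 * |z.im|) / 4) := by
            rw [h4]; ring
        _ ≤ _ := by
            refine mul_le_mul_of_nonneg_left ?_ (by positivity)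
            linarith
  have hev : ∀ᶠ x : ℝ in 𝓝[>] 0, 0 < x ∧ x ≤ 1 / 4 := by
    filter_upwards [Ioc_mem_nhdsGT (show (0 : ℝ) < 1 / 4 by norm_num)] with x hx using hx
  have hpt : ∀ᵐ y : ℝ, Tendsto (fun x : ℝ =>
      (g (x + y * Complex.I) - g₀) / Complex.sin (π * (x + y * Complex.I))) (𝓝[>] 0)
      (𝓝 ((G y - g₀) / (Real.sinh (π * y) * Complex.I))) := by
    filter_upwards [hlim, Measure.ae_ne volume (0 : ℝ)] with y hy hy0
    have hsin0 : Complex.sin (π * ((0 : ℝ) + y * Complex.I)) = Real.sinh (π * y) * Complex.I := by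
      rw [Complex.ofReal_zero, zero_add, ← mul_assoc, Complex.sin_mul_I]
      push_cast; rfl
    refine (hy.sub_const _).div ?_ ?_
    · rw [← hsin0]
      have : Continuous fun x : ℝ => Complex.sin (π * (x + y * Complex.I)) := by fun_prop
      exact (this.tendsto 0).mono_left nhdsWithin_le_nhds
    · refine mul_ne_zero (Complex.ofReal_ne_zero.2 fun h => ?_) Complex.I_ne_zero
      exact mul_ne_zero pi_ne_zero hy0 (Real.sinh_eq_zero.1 h)
  -- The line is pushed onto the imaginary axis; subtracting `g₀` is what lets `hdom` hold uniformly
  -- across the zero of the sine at the origin.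
  have hlimit := tendsto_integral_filter_of_dominated_convergence b
    (hev.mono fun x hx => hmeas x hx.1 hx.2) (hev.mono fun x hx => hdom' x hx.1 hx.2) hb hpt
  have hval : ∫ y : ℝ, (G y - g₀) / (Real.sinh (π * y) * Complex.I) = L 0 - g₀ := by
    refine tendsto_nhds_unique hlimit (tendsto_const_nhds.congr' ?_)
    exact hev.mono fun x hx => (hshift x hx.1 hx.2).symm
  refine ⟨?_, ?_⟩
  -- Measurability of the limit integrand comes from a sequence of abscissae; `1/(n+4)` stays in
  -- `(0, 1/4]`.
  · have hseq : Tendsto (fun n : ℕ => (1 / ((n : ℝ) + 4))) atTop (𝓝[>] 0) := by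
      refine tendsto_nhdsWithin_iff.2 ⟨?_, Eventually.of_forall fun n => ?_⟩
      · exact tendsto_const_nhds.div_atTop
          (tendsto_atTop_add_const_right _ _ tendsto_natCast_atTop_atTop)
      · exact Set.mem_Ioi.2 (by positivity)
    have hn : ∀ n : ℕ, 0 < 1 / ((n : ℝ) + 4) ∧ 1 / ((n : ℝ) + 4) ≤ 1 / 4 := fun n =>
      ⟨by positivity, one_div_le_one_div_of_le (by norm_num) (by
        have : (0 : ℝ) ≤ n := n.cast_nonneg
        linarith)⟩
    refine hb.mono' (aestronglyMeasurable_of_tendsto_ae atTop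
      (fun n => hmeas _ (hn n).1 (hn n).2) (hpt.mono fun y hy => hy.comp hseq)) ?_
    filter_upwards [hpt, ae_all_iff.2 fun n => hdom' _ (hn n).1 (hn n).2] with y hy hd
    exact le_of_tendsto (hy.comp hseq).norm (Eventually.of_forall hd)
  · simp_rw [hsum]
    rw [hval, show -(g₀ + (L 0 - g₀)) / 2 = (0 - L 0) / 2 by ring]
    exact (hLlim.sub_const _).div_const _

/-- Since `sinh` is odd, folding the line integral onto the half-line cancels `g 0` from the
integrand. Adding the term `n = 0` turns `-g 0 / 2` into `g 0 / 2`. -/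
theorem tsum_alternating_eq {g : ℂ → ℂ} {G : ℝ → ℂ} {c : ℝ} (hc : 0 < c)
    (hg : ∀ z : ℂ, 0 < z.re → DifferentiableAt ℂ g z)
    (hbd : ∀ δ > 0, ∃ C : ℝ, ∀ z : ℂ, δ ≤ z.re →
      ‖g z‖ ≤ C * Real.exp (-c * z.re) * Real.exp |z.im|)
    {b : ℝ → ℝ} (hb : Integrable b)
    (hdom : ∀ᵐ y : ℝ, ∀ x : ℝ, 0 < x → x ≤ 1 / 4 →
      ‖g (x + y * Complex.I) - g 0‖ ≤ b y * ‖Complex.sin (π * (x + y * Complex.I))‖)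
    (hlim : ∀ᵐ y : ℝ, Tendsto (fun x : ℝ => g (x + y * Complex.I)) (𝓝[>] 0) (𝓝 (G y)))
    (hsum : Summable fun n : ℕ => (-1) ^ n * g n) :
    IntegrableOn (fun y : ℝ => (G y - G (-y)) / (Real.sinh (π * y) : ℂ)) (Set.Ioi 0) ∧
    ∑' n : ℕ, (-1) ^ n * g n = g 0 / 2 + Complex.I / 2 *
      ∫ y in Set.Ioi (0 : ℝ), (G y - G (-y)) / (Real.sinh (π * y) : ℂ) := by
  obtain ⟨hi, ht⟩ := alternating_abelPlana hc hg hbd hb hdom hlim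
  set F : ℝ → ℂ := fun y => (G y - g 0) / (Real.sinh (π * y) * Complex.I) with hF
  have hneg : Integrable fun y => F (-y) := hi.comp_neg
  have hfold : ∀ y : ℝ, (F y + F (-y)) * Complex.I = (G y - G (-y)) / (Real.sinh (π * y) : ℂ) := by
    intro y
    simp only [hF, mul_neg, Real.sinh_neg, Complex.ofReal_neg]
    by_cases h : (Real.sinh (π * y) : ℂ) = 0
    · simp [h]
    · field_simp
      ring
  have hint : ∫ y : ℝ, F y = -Complex.I *
      ∫ y in Set.Ioi (0 : ℝ), (G y - G (-y)) / (Real.sinh (π * y) : ℂ) := by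
    simp_rw [← hfold]
    rw [integral_mul_const, integral_add hi.integrableOn hneg.integrableOn,
      integral_comp_neg_Ioi, neg_zero, ← intervalIntegral.integral_Iic_add_Ioi hi.integrableOn hi.integrableOn]
    linear_combination ((∫ y in Set.Iic (0 : ℝ), F y) + ∫ y in Set.Ioi (0 : ℝ), F y) * Complex.I_mul_I
  refine ⟨?_, ?_⟩
  · refine ((hi.integrableOn.add hneg.integrableOn).mul_const Complex.I).congr
      (Eventually.of_forall fun y => ?_)
    simpa using hfold y
  · rw [hsum.tsum_eq_zero_add]
    have h1 := ((summable_nat_add_iff 1).2 hsum).hasSum.tendsto_sum_nat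
    have h2 := tendsto_nhds_unique h1 ht
    rw [h2, hint]
    simp
    ring

/-! ### Convergence of `S`, its derivative in `a` and its continuity in `μ`. -/

theorem isOpen_re_pos : IsOpen {a : ℂ | 0 < a.re} := isOpen_lt continuous_const Complex.continuous_re

/-- The imaginary part `2 Re a Im a` vanishes only for real `a`, and then the number is positive. -/
theorem sq_add_sq_mem_slitPlane (t : ℝ) {a : ℂ} (ha : 0 < a.re) :
    (t : ℂ) ^ 2 + a ^ 2 ∈ Complex.slitPlane := by
  rw [Complex.mem_slitPlane_iff]
  by_cases h : a.im = 0
  · left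
    simp only [pow_two, Complex.add_re, Complex.mul_re, Complex.ofReal_re, Complex.ofReal_im, h]
    nlinarith [sq_nonneg t]
  · right
    simp only [pow_two, Complex.add_im, Complex.mul_im, Complex.ofReal_re, Complex.ofReal_im]
    have : a.re * a.im ≠ 0 := mul_ne_zero ha.ne' h
    intro h'
    apply this
    linarith

/-- Factor as `(t + ia)(t - ia)`: both factors have imaginary part `±Re a`. -/
theorem re_sq_le_norm_sq_add_sq (t : ℝ) {a : ℂ} (ha : 0 < a.re) :
    a.re ^ 2 ≤ ‖(t : ℂ) ^ 2 + a ^ 2‖ := by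
  have h1 : (t : ℂ) ^ 2 + a ^ 2 = (t + Complex.I * a) * (t - Complex.I * a) := by
    linear_combination a ^ 2 * Complex.I_sq
  have h2 : a.re ≤ ‖(t : ℂ) + Complex.I * a‖ := by
    have := Complex.abs_im_le_norm ((t : ℂ) + Complex.I * a)
    simp at this
    exact (le_abs_self _).trans this
  have h3 : a.re ≤ ‖(t : ℂ) - Complex.I * a‖ := by
    have := Complex.abs_im_le_norm ((t : ℂ) - Complex.I * a)
    simp at this
    exact (le_abs_self _).trans this
  rw [h1, norm_mul, pow_two]
  exact mul_le_mul h2 h3 ha.le (norm_nonneg _)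

theorem ne_zero_of_re_pos {a : ℂ} (ha : 0 < a.re) : a ≠ 0 := by
  rintro rfl
  simp at ha

theorem mem_slitPlane_of_re_pos {a : ℂ} (ha : 0 < a.re) : a ∈ Complex.slitPlane := Or.inl ha

theorem norm_mathieuTerm (lam mu : ℝ) (a : ℂ) (n : ℕ) :
    ‖mathieuTerm lam mu a n‖ = Real.exp (-lam * n) / ‖(n : ℂ) ^ 2 + a ^ 2‖ ^ mu := by
  rw [mathieuTerm, norm_div, norm_mul, norm_pow, norm_neg, norm_one, one_pow, one_mul,
    Complex.norm_exp, Complex.norm_cpow_real]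
  simp

theorem summable_exp_neg_mul_nat {lam : ℝ} (hlam : 0 < lam) :
    Summable fun n : ℕ => Real.exp (-lam * n) := by
  simpa using Real.summable_pow_mul_exp_neg_nat_mul 0 hlam

theorem norm_mathieuTerm_le (lam : ℝ) {mu : ℝ} (hmu : 0 ≤ mu) {r : ℝ} (hr : 0 < r) {a : ℂ}
    (ha : r ≤ a.re) (n : ℕ) : ‖mathieuTerm lam mu a n‖ ≤ Real.exp (-lam * n) / (r ^ 2) ^ mu := by
  rw [norm_mathieuTerm]
  have h := re_sq_le_norm_sq_add_sq n (hr.trans_le ha)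
  rw [Complex.ofReal_natCast] at h
  have h2 : r ^ 2 ≤ a.re ^ 2 := by gcongr
  have h3 : (r ^ 2) ^ mu ≤ ‖(n : ℂ) ^ 2 + a ^ 2‖ ^ mu :=
    Real.rpow_le_rpow (by positivity) (h2.trans h) hmu
  exact div_le_div_of_nonneg_left (Real.exp_pos _).le (by positivity) h3

theorem summable_mathieuTerm {lam : ℝ} (hlam : 0 < lam) {mu : ℝ} (hmu : 0 ≤ mu) {a : ℂ}
    (ha : 0 < a.re) : Summable (mathieuTerm lam mu a) :=
  Summable.of_norm_bounded ((summable_exp_neg_mul_nat hlam).div_const _)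
    fun n => norm_mathieuTerm_le lam hmu ha le_rfl n

theorem hasDerivAt_mathieuTerm (lam mu : ℝ) (n : ℕ) {a : ℂ} (ha : 0 < a.re) :
    HasDerivAt (fun a => mathieuTerm lam mu a n) (-2 * mu * a * mathieuTerm lam (mu + 1) a n) a := by
  have hs := sq_add_sq_mem_slitPlane n ha
  rw [Complex.ofReal_natCast] at hs
  have h0 := Complex.slitPlane_ne_zero hs
  have h := ((((hasDerivAt_id a).pow 2).const_add ((n : ℂ) ^ 2)).cpow_const (c := -(mu : ℂ)) hs).const_mul
    ((-1) ^ n * Complex.exp (-(lam * n)))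
  have hfun : (fun a : ℂ => mathieuTerm lam mu a n) = fun y => (-1) ^ n * Complex.exp (-(lam * n)) *
      ((n : ℂ) ^ 2 + (id ^ 2) y) ^ (-(mu : ℂ)) := by
    funext y
    simp only [mathieuTerm, Complex.cpow_neg, Pi.pow_apply, id, div_eq_mul_inv]
  rw [hfun]
  refine h.congr_deriv ?_
  simp only [Pi.pow_apply, id, mathieuTerm, div_eq_mul_inv, ← Complex.cpow_neg]
  push_cast
  rw [show -(mu : ℂ) - 1 = -(mu + 1) by ring]
  ring

/-- The ladder for `S`, by termwise differentiation; the terms have a summable majorant on the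
half-plane `Re w > Re a / 2`. -/
theorem mathieuS_hasDerivAt {lam : ℝ} (hlam : 0 < lam) {mu : ℝ} (hmu : 0 ≤ mu) {a : ℂ}
    (ha : 0 < a.re) :
    HasDerivAt (mathieuS lam mu) (-2 * mu * a * mathieuS lam (mu + 1) a) a := by
  have hU : IsOpen {w : ℂ | a.re / 2 < w.re} := isOpen_lt continuous_const Complex.continuous_re
  have haU : a ∈ {w : ℂ | a.re / 2 < w.re} := half_lt_self ha
  have hd : ∀ n, DifferentiableOn ℂ (fun w => mathieuTerm lam mu w n) {w : ℂ | a.re / 2 < w.re} :=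
    fun n w hw => (hasDerivAt_mathieuTerm lam mu n
      ((half_pos ha).trans hw)).differentiableAt.differentiableWithinAt
  have hsum : Summable fun n : ℕ => Real.exp (-lam * n) / ((a.re / 2) ^ 2) ^ mu :=
    (summable_exp_neg_mul_nat hlam).div_const _
  have hle : ∀ n w, w ∈ {w : ℂ | a.re / 2 < w.re} →
      ‖mathieuTerm lam mu w n‖ ≤ Real.exp (-lam * n) / ((a.re / 2) ^ 2) ^ mu := fun n w hw =>
    norm_mathieuTerm_le lam hmu (half_pos ha) (le_of_lt hw) n
  have h1 := Complex.hasSum_deriv_of_summable_norm hsum hd hU hle haU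
  have h2 := (Complex.differentiableOn_tsum_of_summable_norm hsum hd hU hle).differentiableAt
    (hU.mem_nhds haU)
  have h3 : HasSum (fun n => deriv (fun w => mathieuTerm lam mu w n) a)
      (-2 * mu * a * mathieuS lam (mu + 1) a) := by
    have := (summable_mathieuTerm hlam (add_nonneg hmu zero_le_one) ha).hasSum.mul_left (-2 * mu * a)
    refine this.congr_fun ?_
    intro n
    exact (hasDerivAt_mathieuTerm lam mu n ha).deriv
  rw [← h1.unique h3]
  exact h2.hasDerivAt

theorem mathieuS_differentiableOn {lam : ℝ} (hlam : 0 < lam) {mu : ℝ} (hmu : 0 ≤ mu) :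
    DifferentiableOn ℂ (mathieuS lam mu) {a : ℂ | 0 < a.re} := fun _ ha =>
  (mathieuS_hasDerivAt hlam hmu ha).differentiableAt.differentiableWithinAt

theorem mathieuS_add_one {lam : ℝ} (hlam : 0 < lam) {mu : ℝ} (hmu : 0 < mu) {a : ℂ}
    (ha : 0 < a.re) : mathieuS lam (mu + 1) a = -(1 / (2 * mu * a)) * deriv (mathieuS lam mu) a := by
  rw [(mathieuS_hasDerivAt hlam hmu.le ha).deriv]
  have h1 := ne_zero_of_re_pos ha
  have h2 : (mu : ℂ) ≠ 0 := Complex.ofReal_ne_zero.2 hmu.ne'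
  field_simp

theorem mathieuS_tendsto {lam : ℝ} (hlam : 0 < lam) {m : ℝ} (hm : 0 < m) {a : ℂ} (ha : 0 < a.re) :
    Tendsto (fun mu : ℝ => mathieuS lam mu a) (𝓝 m) (𝓝 (mathieuS lam m a)) := by
  -- The added `1` makes the base at least `1`, hence its powers monotone in the exponent, so one
  -- majorant serves all `μ` in `(0, m+1)`.
  have hR : 0 < 1 + (a.re ^ 2)⁻¹ := by positivity
  refine tendsto_tsum_of_dominated_convergence
    (bound := fun n : ℕ => Real.exp (-lam * n) * (1 + (a.re ^ 2)⁻¹) ^ (m + 1))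
    ((summable_exp_neg_mul_nat hlam).mul_right _) (fun n => ?_) ?_
  · have h0 := Complex.slitPlane_ne_zero (sq_add_sq_mem_slitPlane n ha)
    rw [Complex.ofReal_natCast] at h0
    have hc : ContinuousAt (fun mu : ℝ => ((n : ℂ) ^ 2 + a ^ 2) ^ (mu : ℂ)) m :=
      ContinuousAt.comp (g := fun s : ℂ => ((n : ℂ) ^ 2 + a ^ 2) ^ s)
        (continuousAt_const_cpow h0) Complex.continuous_ofReal.continuousAt
    exact (tendsto_const_nhds.div hc (by simp [Complex.cpow_eq_zero_iff, h0]))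
  · filter_upwards [Ioo_mem_nhds hm (lt_add_one m)] with mu hmu n
    refine (norm_mathieuTerm_le lam hmu.1.le ha le_rfl n).trans ?_
    rw [div_eq_mul_inv, ← Real.inv_rpow (by positivity)]
    refine mul_le_mul_of_nonneg_left ?_ (Real.exp_pos _).le
    calc ((a.re ^ 2)⁻¹) ^ mu ≤ (1 + (a.re ^ 2)⁻¹) ^ mu :=
          Real.rpow_le_rpow (by positivity) (by linarith) hmu.1.le
      _ ≤ (1 + (a.re ^ 2)⁻¹) ^ (m + 1) :=
          Real.rpow_le_rpow_of_exponent_le (by have : 0 < (a.re ^ 2)⁻¹ := by positivity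
                                               linarith) hmu.2.le

/-! ### Alternating power sums, the moments `B_k`, and the case `μ = 0`. -/

theorem abs_mul_exp_le_norm_sin_pi_mul (z : ℂ) :
    |z.im| * Real.exp (2 * |z.im|) ≤ 2 * ‖Complex.sin (π * z)‖ := by
  have h := abs_sinh_im_le_norm_sin (π * z)
  have him : (π * z : ℂ).im = π * z.im := by simp
  rw [him, Real.abs_sinh, abs_mul, abs_of_pos pi_pos, Real.sinh_eq] at h
  set u := |z.im| with hu
  have hu0 : 0 ≤ u := abs_nonneg _
  have h1 : Real.exp (π * u) = Real.exp (2 * u) * Real.exp ((π - 2) * u) := by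
    rw [← Real.exp_add]; ring_nf
  have h2 : Real.exp (-(π * u)) ≤ Real.exp (2 * u) := Real.exp_le_exp.2 (by nlinarith [pi_pos])
  have h3 : 1 + u ≤ Real.exp ((π - 2) * u) := by
    have := Real.add_one_le_exp ((π - 2) * u)
    nlinarith [pi_gt_three]
  have h4 : 0 < Real.exp (2 * u) := Real.exp_pos _
  nlinarith

/-- Used to divide by the sine a function of size `|z| e^{|Im z|}` near the imaginary axis: the
quotient is `O(e^{-|Im z|})`. Jordan's inequality handles `Re z`, growth of `sinh` handles `Im z`.
-/
theorem norm_mul_exp_le_norm_sin_pi_mul {z : ℂ} (h0 : 0 ≤ z.re) (h1 : z.re ≤ 1 / 2) :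
    ‖z‖ * Real.exp (2 * |z.im|) ≤ 4 * ‖Complex.sin (π * z)‖ := by
  have hA := abs_mul_exp_le_norm_sin_pi_mul z
  have hB : z.re * Real.exp (2 * |z.im|) ≤ 2 * ‖Complex.sin (π * z)‖ := by
    have hre : (π * z : ℂ).re = π * z.re := by simp
    have him : (π * z : ℂ).im = π * z.im := by simp
    have hsq := normSq_sin (π * z)
    rw [hre, him] at hsq
    have hcosh := Real.cosh_sq (π * z.im)
    have hsin1 := Real.sin_sq_le_one (π * z.re)
    have h2 : (Real.sin (π * z.re) * Real.cosh (π * z.im)) ^ 2 ≤ ‖Complex.sin (π * z)‖ ^ 2 := by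
      rw [hsq, mul_pow, hcosh]
      nlinarith [sq_nonneg (Real.sinh (π * z.im))]
    have h3 := abs_le_of_sq_le_sq h2 (norm_nonneg _)
    have h4 : 2 * z.re ≤ Real.sin (π * z.re) := by
      have := Real.mul_le_sin (x := π * z.re) (by positivity) (by nlinarith [pi_pos])
      rwa [← mul_assoc, div_mul_cancel₀ _ pi_ne_zero] at this
    have h5 : Real.exp (2 * |z.im|) / 2 ≤ Real.cosh (π * z.im) := by
      rw [← Real.cosh_abs, abs_mul, abs_of_pos pi_pos, Real.cosh_eq]
      have : Real.exp (2 * |z.im|) ≤ Real.exp (π * |z.im|) :=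
        Real.exp_le_exp.2 (by nlinarith [pi_gt_three, abs_nonneg z.im])
      linarith [Real.exp_pos (-(π * |z.im|))]
    have h6 := (le_abs_self _).trans h3
    have h7 : 2 * z.re * (Real.exp (2 * |z.im|) / 2) ≤ Real.sin (π * z.re) * Real.cosh (π * z.im) :=
      mul_le_mul h4 h5 (by positivity) (le_trans (by positivity) h4)
    nlinarith [norm_nonneg (Complex.sin (π * z))]
  have h := Complex.norm_le_abs_re_add_abs_im z
  rw [abs_of_nonneg h0] at h
  nlinarith [Real.exp_pos (2 * |z.im|)]

theorem norm_exp_neg_mul_sub_one_le {lam : ℝ} (hlam : 0 < lam) {z : ℂ} (hz : 0 ≤ z.re) :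
    ‖Complex.exp (-(lam * z)) - 1‖ ≤ lam * ‖z‖ := by
  have hconv : Convex ℝ {w : ℂ | 0 ≤ w.re} := convex_halfSpace_re_ge 0
  have h := hconv.norm_image_sub_le_of_norm_hasDerivWithin_le (𝕜 := ℂ)
    (f := fun w => Complex.exp (-(lam * w))) (f' := fun w => Complex.exp (-(lam * w)) * -(lam * 1))
    (C := lam) (x := 0) (y := z)
    (fun w _ => ((((hasDerivAt_id w).const_mul (lam : ℂ)).neg).cexp).hasDerivWithinAt)
    (fun w hw => by
      rw [norm_mul, Complex.norm_exp, norm_neg, mul_one, Complex.norm_real,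
        Real.norm_of_nonneg hlam.le]
      have : Real.exp (-(lam * w)).re ≤ 1 := Real.exp_le_one_iff.2 (by
        have : 0 ≤ lam * w.re := mul_nonneg hlam.le hw
        simpa using this)
      nlinarith) (by simp) hz
  simpa using h

theorem pow_le_factorial_mul_exp (j : ℕ) {u : ℝ} (hu : 0 ≤ u) :
    u ^ j ≤ (Nat.factorial j : ℝ) * Real.exp u := by
  have := Real.pow_div_factorial_le_exp u hu j
  rwa [div_le_iff₀' (by positivity)] at this

theorem summable_alternating_pow_mul_exp {lam : ℝ} (hlam : 0 < lam) (k : ℕ) :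
    Summable fun n : ℕ => (-1 : ℂ) ^ n * ((n : ℂ) ^ k * Complex.exp (-(lam * n))) := by
  refine Summable.of_norm_bounded (Real.summable_pow_mul_exp_neg_nat_mul k hlam) fun n => ?_
  rw [norm_mul, norm_mul, norm_pow, norm_neg, norm_one, one_pow, one_mul, norm_pow,
    Complex.norm_natCast, Complex.norm_exp]
  simp

/-- Abel–Plana for `z^{2k} e^{-λz}`. On the imaginary axis the even power becomes `(-1)^k y^{2k}`,
and the difference of the exponentials at `±iy` is `-2i sin λy`. The value at `0` is nonzero only
for `k = 0`. -/
theorem tsum_alternating_pow_mul_exp {lam : ℝ} (hlam : 0 < lam) (k : ℕ) :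
    ∑' n : ℕ, (-1 : ℂ) ^ n * ((n : ℂ) ^ (2 * k) * Complex.exp (-(lam * n)))
      = (if k = 0 then 1 / 2 else 0) + (-1) ^ k * (coeffB lam k : ℂ) := by
  set g : ℂ → ℂ := fun z => z ^ (2 * k) * Complex.exp (-(lam * z)) with hg
  have hre : ∀ (x y : ℝ), ((x : ℂ) + y * Complex.I).re = x := fun x y => by simp
  have him : ∀ (x y : ℝ), ((x : ℂ) + y * Complex.I).im = y := fun x y => by simp
  have hexp : ∀ z : ℂ, ‖Complex.exp (-(lam * z))‖ = Real.exp (-lam * z.re) := by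
    intro z; rw [Complex.norm_exp]; simp
  -- For `k = 0` this is the mean value inequality for the exponential; for `k ≥ 1` one factor `z`
  -- is split off and `u^j ≤ j! e^u` bounds the rest.
  have hdom : ∃ M : ℝ, ∀ x y : ℝ, 0 < x → x ≤ 1 / 4 →
      ‖g (x + y * Complex.I) - g 0‖ ≤ M * ‖(x : ℂ) + y * Complex.I‖ * Real.exp |y| := by
    rcases Nat.eq_zero_or_pos k with rfl | hk
    · refine ⟨lam, fun x y hx _ => ?_⟩
      have h1 := norm_exp_neg_mul_sub_one_le hlam (z := x + y * Complex.I) (by rw [hre]; exact hx.le)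
      have h2 : (1 : ℝ) ≤ Real.exp |y| := Real.one_le_exp (abs_nonneg _)
      simp only [hg, mul_zero, pow_zero, one_mul, neg_zero, Complex.exp_zero]
      refine h1.trans ?_
      have : 0 ≤ lam * ‖(x : ℂ) + y * Complex.I‖ := by positivity
      nlinarith
    · refine ⟨(Nat.factorial (2 * k - 1) : ℝ) * Real.exp 1, fun x y hx hx' => ?_⟩
      set z : ℂ := x + y * Complex.I with hz
      have h0 : g 0 = 0 := by simp [hg, hk.ne']
      have h1 : ‖z‖ ≤ 1 + |y| := by
        have := Complex.norm_le_abs_re_add_abs_im z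
        rw [hz, hre, him, abs_of_pos hx] at this
        rw [hz]; linarith
      have h2 : ‖z‖ ^ (2 * k - 1) ≤ (Nat.factorial (2 * k - 1) : ℝ) * (Real.exp 1 * Real.exp |y|) := by
        refine (pow_le_factorial_mul_exp _ (norm_nonneg z)).trans ?_
        rw [← Real.exp_add]
        gcongr
      have h3 : Real.exp (-lam * z.re) ≤ 1 := Real.exp_le_one_iff.2 (by rw [hz, hre]; nlinarith)
      rw [h0, sub_zero]
      simp only [hg]
      rw [norm_mul, hexp, norm_pow, show 2 * k = (2 * k - 1) + 1 by omega, pow_succ]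
      calc ‖z‖ ^ (2 * k - 1) * ‖z‖ * Real.exp (-lam * z.re)
          ≤ ‖z‖ ^ (2 * k - 1) * ‖z‖ * 1 := by gcongr
        _ ≤ (Nat.factorial (2 * k - 1) : ℝ) * (Real.exp 1 * Real.exp |y|) * ‖z‖ * 1 := by gcongr
        _ = _ := by simp; ring
  obtain ⟨M, hM⟩ := hdom
  have hM0 : 0 ≤ M := by
    have h := (norm_nonneg _).trans (hM (1 / 4) 0 (by norm_num) le_rfl)
    simp at h
    linarith
  have key := tsum_alternating_eq (g := g)
    (G := fun y => (y * Complex.I) ^ (2 * k) * Complex.exp (-(lam * (y * Complex.I))))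
    (half_pos hlam) (fun z _ => by simp only [hg]; fun_prop) (fun δ _ => by
      -- With this `θ` one has `θ|z| ≤ (λ/2) Re z + |Im z|`, so half of the decay `e^{-λ Re z}` pays
      -- for the polynomial factor; hence the rate `λ/2`.
      set θ := min 1 (lam / 2) with hθ
      have hθ0 : 0 < θ := lt_min one_pos (half_pos hlam)
      refine ⟨(Nat.factorial (2 * k) : ℝ) / θ ^ (2 * k), fun z hz => ?_⟩
      have hzre : 0 ≤ z.re := by linarith
      have h1 : θ * ‖z‖ ≤ lam / 2 * z.re + |z.im| := by
        have h := Complex.norm_le_abs_re_add_abs_im z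
        rw [abs_of_nonneg hzre] at h
        have h2 := min_le_left 1 (lam / 2)
        have h3 := min_le_right 1 (lam / 2)
        rw [← hθ] at h2 h3
        nlinarith [abs_nonneg z.im]
      have h2 := pow_le_factorial_mul_exp (2 * k) (u := θ * ‖z‖) (by positivity)
      have h3 : Real.exp (θ * ‖z‖) ≤ Real.exp (lam / 2 * z.re) * Real.exp |z.im| := by
        rw [← Real.exp_add]; exact Real.exp_le_exp.2 h1
      have h4 : ‖z‖ ^ (2 * k) ≤ (Nat.factorial (2 * k) : ℝ) / θ ^ (2 * k) *
          (Real.exp (lam / 2 * z.re) * Real.exp |z.im|) := by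
        rw [div_mul_eq_mul_div, le_div_iff₀ (by positivity), mul_comm, ← mul_pow]
        exact h2.trans (by gcongr)
      simp only [hg]
      rw [norm_mul, norm_pow, hexp]
      refine (mul_le_mul_of_nonneg_right h4 (Real.exp_pos _).le).trans (le_of_eq ?_)
      rw [show -(lam / 2) * z.re = lam / 2 * z.re + -lam * z.re by ring, Real.exp_add]
      ring)
    (b := fun y => 4 * M * Real.exp (-1 * |y|)) ((integrable_exp_neg_mul_abs one_pos).const_mul _)
    (Eventually.of_forall fun y x hx hx' => by
      refine (hM x y hx hx').trans ?_
      have h := norm_mul_exp_le_norm_sin_pi_mul (z := x + y * Complex.I) (by rw [hre]; exact hx.le)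
        (by rw [hre]; linarith)
      rw [him] at h
      have h2 : Real.exp |y| = Real.exp (-1 * |y|) * Real.exp (2 * |y|) := by
        rw [← Real.exp_add]; ring_nf
      rw [h2]
      have h3 : 0 ≤ M * Real.exp (-1 * |y|) := by positivity
      nlinarith)
    (Eventually.of_forall fun y => by
      have : Continuous fun x : ℝ => g (x + y * Complex.I) := by simp only [hg]; fun_prop
      have h := (this.tendsto 0).mono_left (nhdsWithin_le_nhds (s := Set.Ioi 0))
      simpa [hg] using h)
    (summable_alternating_pow_mul_exp hlam (2 * k))
  have hfold : ∀ y : ℝ, (((y : ℂ) * Complex.I) ^ (2 * k) * Complex.exp (-(lam * (y * Complex.I)))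
      - (((-y : ℝ) : ℂ) * Complex.I) ^ (2 * k) * Complex.exp (-(lam * (((-y : ℝ) : ℂ) * Complex.I))))
      / (Real.sinh (π * y) : ℂ)
      = (-2 * Complex.I * (-1) ^ k) *
        ((y ^ (2 * k) * (Real.sin (lam * y) / Real.sinh (π * y)) : ℝ) : ℂ) := by
    intro y
    have h1 : ((y : ℂ) * Complex.I) ^ (2 * k) = (-1) ^ k * y ^ (2 * k) := by
      rw [mul_pow, pow_mul Complex.I, Complex.I_sq]; ring
    have h2 : (((-y : ℝ) : ℂ) * Complex.I) ^ (2 * k) = (-1) ^ k * y ^ (2 * k) := by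
      rw [mul_pow, pow_mul Complex.I, Complex.I_sq, Complex.ofReal_neg, Even.neg_pow (even_two_mul k)]
      ring
    have h3 : ((Real.sin (lam * y) : ℝ) : ℂ) = (Complex.exp (-(lam * (y * Complex.I)))
        - Complex.exp (-(lam * (((-y : ℝ) : ℂ) * Complex.I)))) * Complex.I / 2 := by
      rw [Complex.ofReal_sin, Complex.sin]
      push_cast
      ring_nf
    rw [h1, h2]
    push_cast [h3]
    have := Complex.I_sq
    linear_combination ((-1) ^ k * y ^ (2 * k) * (Complex.exp (-(lam * (y * Complex.I)))
        - Complex.exp (-(lam * (-y * Complex.I)))) / Complex.sinh (π * y)) * this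
  have h2 := key.2
  simp only [hfold] at h2
  rw [h2, integral_const_mul, integral_complex_ofReal, ← coeffB]
  have hg0 : g 0 = if k = 0 then 1 else 0 := by
    by_cases h : k = 0 <;> simp [hg, h]
  rw [hg0]
  have hI := Complex.I_sq
  split_ifs with h
  · linear_combination (-(-1) ^ k * (coeffB lam k : ℂ)) * hI
  · linear_combination (-(-1) ^ k * (coeffB lam k : ℂ)) * hI

theorem tsum_geometric_alternating {lam : ℝ} (hlam : 0 < lam) :
    ∑' n : ℕ, (-1 : ℂ) ^ n * Complex.exp (-(lam * n)) = Complex.exp lam / (1 + Complex.exp lam) := by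
  have h1 : ∀ n : ℕ, (-1 : ℂ) ^ n * Complex.exp (-(lam * n)) = (-Complex.exp (-lam)) ^ n := by
    intro n
    rw [neg_pow (Complex.exp (-lam)), ← Complex.exp_nat_mul]
    ring_nf
  have h2 : ‖-Complex.exp (-(lam : ℂ))‖ < 1 := by
    rw [norm_neg, Complex.norm_exp]
    simpa using hlam
  simp_rw [h1]
  rw [tsum_geometric_of_norm_lt_one h2, sub_neg_eq_add, Complex.exp_neg]
  have h3 := Complex.exp_ne_zero lam
  field_simp
  rw [add_comm]

theorem coeffB_zero {lam : ℝ} (hlam : 0 < lam) :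
    1 / 2 + (coeffB lam 0 : ℂ) = Complex.exp lam / (1 + Complex.exp lam) := by
  rw [← tsum_geometric_alternating hlam]
  have := tsum_alternating_pow_mul_exp hlam 0
  simp only [mul_zero, pow_zero, one_mul, if_true] at this
  exact this.symm

theorem mathieuS_zero {lam : ℝ} (hlam : 0 < lam) (a : ℂ) :
    mathieuS lam 0 a = Complex.exp lam / (1 + Complex.exp lam) := by
  rw [← tsum_geometric_alternating hlam, mathieuS]
  simp [mathieuTerm]

/-- Only `k = 0` survives, because `(0)_k = 0` for `k ≥ 1`. -/
theorem algebraicSum_zero_order {lam : ℝ} (hlam : 0 < lam) (a : ℂ) {N : ℕ} (hN : 1 ≤ N) :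
    1 / (2 * a ^ ((2 * (0 : ℝ) : ℝ) : ℂ)) + algebraicSum lam 0 N a
      = Complex.exp lam / (1 + Complex.exp lam) := by
  rw [← coeffB_zero hlam, algebraicSum]
  obtain ⟨n, rfl⟩ : ∃ n, N = n + 1 := ⟨N - 1, by omega⟩
  rw [Finset.sum_range_succ']
  have : ∀ k : ℕ, (ascPochhammer ℝ (k + 1)).eval 0 = 0 := fun k => by
    simp [ascPochhammer_succ_eval, ascPochhammer_eval_zero]
  simp [this]

/-! ### The asymptotic expansion of `S`. -/

/-- The binomial expansion of `(1 + w)^{-μ}` with remainder, on sets star-shaped about `0` that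
stay off the branch point. -/
theorem norm_one_add_cpow_sub_le (N : ℕ) {δ : ℝ} (hδ : 0 < δ) : ∀ mu : ℝ, 0 ≤ mu → ∃ C : ℝ, 0 ≤ C ∧
    ∀ w : ℂ, (∀ s : ℝ, 0 ≤ s → s ≤ 1 → 1 + s * w ∈ Complex.slitPlane ∧ δ ≤ ‖1 + s * w‖) →
    ‖(1 + w) ^ (-(mu : ℂ)) - ∑ k ∈ Finset.range N,
      (-1) ^ k * (((ascPochhammer ℝ k).eval mu : ℝ) : ℂ) / (Nat.factorial k : ℂ) * w ^ k‖
      ≤ C * ‖w‖ ^ N := by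
  induction N with
  | zero =>
    intro mu hmu
    refine ⟨δ ^ (-mu), by positivity, fun w hw => ?_⟩
    obtain ⟨-, h⟩ := hw 1 zero_le_one le_rfl
    rw [Complex.ofReal_one, one_mul] at h
    rw [Finset.sum_range_zero, sub_zero, pow_zero, mul_one, ← Complex.ofReal_neg,
      Complex.norm_cpow_real]
    exact Real.rpow_le_rpow_of_nonpos hδ h (neg_nonpos.2 hmu)
  | succ N ih =>
    intro mu hmu
    obtain ⟨C, hC0, hC⟩ := ih (mu + 1) (by positivity)
    refine ⟨mu * C, by positivity, fun w hw => ?_⟩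
    set R : ℝ → ℂ := fun s => (1 + s * w) ^ (-(mu : ℂ)) - ∑ k ∈ Finset.range (N + 1),
      (-1) ^ k * (((ascPochhammer ℝ k).eval mu : ℝ) : ℂ) / (Nat.factorial k : ℂ) * (s * w) ^ k with hR
    -- Along the segment from `1` to `1 + w` the derivative of the remainder of order `N + 1` for
    -- `μ` is `-μw` times the remainder of order `N` for `μ + 1`, because `(μ)_{k+1} = μ (μ+1)_k`.
    -- Hence the induction must run over all `μ` at once.
    set R' : ℝ → ℂ := fun s => -(mu * w) * ((1 + s * w) ^ (-((mu + 1 : ℝ) : ℂ)) -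
      ∑ k ∈ Finset.range N, (-1) ^ k * (((ascPochhammer ℝ k).eval (mu + 1) : ℝ) : ℂ) /
        (Nat.factorial k : ℂ) * (s * w) ^ k) with hR'
    have hder : ∀ s ∈ Set.Icc (0 : ℝ) 1, HasDerivAt R (R' s) s := by
      intro s hs
      have hlin : HasDerivAt (fun s : ℝ => (s : ℂ) * w) w s := by
        simpa using (Complex.ofRealCLM.hasDerivAt (x := s)).mul_const w
      have h0 : HasDerivAt (fun z : ℂ => z ^ (-(mu : ℂ))) (-(mu : ℂ) * (1 + s * w) ^ (-(mu : ℂ) - 1))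
          (1 + s * w) := by
        simpa using (hasDerivAt_id (1 + (s : ℂ) * w)).cpow_const (c := -(mu : ℂ)) (hw s hs.1 hs.2).1
      have h1 : HasDerivAt (fun s : ℝ => (1 + (s : ℂ) * w) ^ (-(mu : ℂ)))
          (-(mu : ℂ) * (1 + s * w) ^ (-(mu : ℂ) - 1) * w) s :=
        HasDerivAt.comp (h₂ := fun z : ℂ => z ^ (-(mu : ℂ))) s h0 (hlin.const_add 1)
      have h2 : HasDerivAt (fun s : ℝ => ∑ k ∈ Finset.range (N + 1),
          (-1) ^ k * (((ascPochhammer ℝ k).eval mu : ℝ) : ℂ) / (Nat.factorial k : ℂ) * ((s : ℂ) * w) ^ k)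
          (∑ k ∈ Finset.range (N + 1), (-1) ^ k * (((ascPochhammer ℝ k).eval mu : ℝ) : ℂ) /
            (Nat.factorial k : ℂ) * (k * ((s : ℂ) * w) ^ (k - 1) * w)) s :=
        HasDerivAt.fun_sum fun k _ => (hlin.pow k).const_mul _
      refine (h1.sub h2).congr_deriv ?_
      have hA : -(mu : ℂ) * (1 + s * w) ^ (-(mu : ℂ) - 1) * w
          = -(mu * w) * (1 + s * w) ^ (-((mu + 1 : ℝ) : ℂ)) := by
        push_cast
        rw [show -(mu : ℂ) - 1 = -(mu + 1) by ring]
        ring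
      rw [Finset.sum_range_succ', hA]
      simp only [hR', mul_sub, Finset.mul_sum]
      rw [sub_eq_add_neg, sub_eq_add_neg]
      congr 1
      · simp only [Nat.cast_zero, zero_mul, mul_zero, add_zero, ← Finset.sum_neg_distrib]
        refine Finset.sum_congr rfl fun k _ => ?_
        have h3 : (ascPochhammer ℝ (k + 1)).eval mu = mu * (ascPochhammer ℝ k).eval (mu + 1) := by
          rw [ascPochhammer_succ_left, Polynomial.eval_mul, Polynomial.eval_X, Polynomial.eval_comp]
          simp
        have h4 : ((k : ℂ) + 1) ≠ 0 := Nat.cast_add_one_ne_zero k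
        have h5 : (Nat.factorial k : ℂ) ≠ 0 := Nat.cast_ne_zero.2 (Nat.factorial_ne_zero k)
        rw [h3, Nat.factorial_succ, Nat.add_sub_cancel]
        push_cast
        field_simp
        ring
    have hbound : ∀ s ∈ Set.Ico (0 : ℝ) 1, ‖R' s‖ ≤ mu * C * ‖w‖ ^ (N + 1) := by
      intro s hs
      have h := hC (s * w) fun u hu0 hu1 => by
        have := hw (u * s) (mul_nonneg hu0 hs.1) (mul_le_one₀ hu1 hs.1 hs.2.le)
        rw [Complex.ofReal_mul, mul_assoc] at this
        exact this
      simp only [hR']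
      rw [norm_mul, norm_neg, norm_mul, Complex.norm_real, Real.norm_of_nonneg hmu]
      have h2 : ‖(s : ℂ) * w‖ ≤ ‖w‖ := by
        rw [norm_mul, Complex.norm_real, Real.norm_of_nonneg hs.1]
        exact mul_le_of_le_one_left (norm_nonneg _) hs.2.le
      calc mu * ‖w‖ * _ ≤ mu * ‖w‖ * (C * ‖(s : ℂ) * w‖ ^ N) := by gcongr
        _ ≤ mu * ‖w‖ * (C * ‖w‖ ^ N) := by gcongr
        _ = _ := by ring
    have h := norm_image_sub_le_of_norm_deriv_le_segment_01'
      (fun s hs => (hder s hs).hasDerivWithinAt) hbound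
    have hR0 : R 0 = 0 := by
      simp [hR, Finset.sum_range_succ']
    have hR1 : R 1 = (1 + w) ^ (-(mu : ℂ)) - ∑ k ∈ Finset.range (N + 1),
      (-1) ^ k * (((ascPochhammer ℝ k).eval mu : ℝ) : ℂ) / (Nat.factorial k : ℂ) * w ^ k := by
      simp [hR]
    rwa [hR0, sub_zero, hR1] at h

/-- Multiplicativity of principal powers can fail in general; here both sides are analytic on the
half-plane and agree for `a > 0`. -/
theorem sq_add_sq_cpow_eq (t mu : ℝ) {a : ℂ} (ha : 0 < a.re) :
    1 + ((t : ℂ) / a) ^ 2 ∈ Complex.slitPlane ∧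
    ((t : ℂ) ^ 2 + a ^ 2) ^ (mu : ℂ)
      = a ^ ((2 * mu : ℝ) : ℂ) * (1 + ((t : ℂ) / a) ^ 2) ^ (mu : ℂ) := by
  -- For `t ≠ 0` the number is `t² (t⁻² + a⁻²)`, and `a⁻¹` again has positive real part.
  have hslit : ∀ a : ℂ, 0 < a.re → 1 + ((t : ℂ) / a) ^ 2 ∈ Complex.slitPlane := by
    intro a ha
    have hinv : 0 < (a⁻¹).re := by
      rw [Complex.inv_re]
      exact div_pos ha (Complex.normSq_pos.2 (ne_zero_of_re_pos ha))
    by_cases ht : t = 0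
    · simp [ht]
    · have ht2 : 0 < t ^ 2 := by positivity
      have h := sq_add_sq_mem_slitPlane (1 / |t|) hinv
      rw [Complex.mem_slitPlane_iff] at h ⊢
      have h2 : (1 : ℂ) + ((t : ℂ) / a) ^ 2 = ((t ^ 2 : ℝ) : ℂ) * (((1 / |t| : ℝ) : ℂ) ^ 2 + a⁻¹ ^ 2) := by
        have h3 : (((1 / |t| : ℝ) : ℂ)) ^ 2 = (((t ^ 2)⁻¹ : ℝ) : ℂ) := by
          rw [← Complex.ofReal_pow, div_pow, sq_abs, one_pow, one_div]
        have h4 : (t : ℂ) ≠ 0 := Complex.ofReal_ne_zero.2 ht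
        rw [h3]
        push_cast
        rw [mul_add, mul_inv_cancel₀ (pow_ne_zero 2 h4)]
        ring
      rw [h2, Complex.re_ofReal_mul, Complex.im_ofReal_mul]
      exact h.imp (mul_pos ht2) fun h => mul_ne_zero ht2.ne' h
  refine ⟨hslit a ha, ?_⟩
  refine eqOn_re_pos_of_eq_on_pos_reals
    (f := fun a => ((t : ℂ) ^ 2 + a ^ 2) ^ (mu : ℂ))
    (g := fun a => a ^ ((2 * mu : ℝ) : ℂ) * (1 + ((t : ℂ) / a) ^ 2) ^ (mu : ℂ))
    (fun a ha => ?_) (fun a ha => ?_) (fun x hx => ?_) a ha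
  · have h : DifferentiableAt ℂ (fun a : ℂ => (t : ℂ) ^ 2 + a ^ 2) a := by fun_prop
    exact (h.cpow_const (sq_add_sq_mem_slitPlane t ha)).differentiableWithinAt
  · have h0 := ne_zero_of_re_pos ha
    refine (DifferentiableAt.mul (DifferentiableAt.cpow_const differentiableAt_id
      (mem_slitPlane_of_re_pos ha)) (DifferentiableAt.cpow_const ?_ (hslit a ha))).differentiableWithinAt
    exact ((differentiableAt_const _).div differentiableAt_id h0).pow 2 |>.const_add 1
  · have h1 : ((t : ℂ) ^ 2 + (x : ℂ) ^ 2) = ((t ^ 2 + x ^ 2 : ℝ) : ℂ) := by push_cast; rfl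
    have h2 : (1 + ((t : ℂ) / x) ^ 2) = ((1 + (t / x) ^ 2 : ℝ) : ℂ) := by push_cast; rfl
    rw [h1, h2, ← Complex.ofReal_cpow (by positivity), ← Complex.ofReal_cpow hx.le,
      ← Complex.ofReal_cpow (by positivity), ← Complex.ofReal_mul, Real.rpow_mul hx.le,
      ← Real.mul_rpow (by positivity) (by positivity), Real.rpow_two]
    congr 2
    field_simp
    ring

theorem isBigO_inftyInSector {φ C : ℝ} {f : ℂ → ℂ} {g : ℂ → ℝ}
    (h : ∀ a : ℂ, 1 ≤ ‖a‖ → |Complex.arg a| ≤ φ → ‖f a‖ ≤ C * g a) : f =O[inftyInSector φ] g := by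
  refine IsBigO.of_bound |C| ?_
  rw [inftyInSector, eventually_inf_principal]
  filter_upwards [tendsto_norm_cobounded_atTop.eventually_ge_atTop (1 : ℝ)] with a ha hφ
  refine (h a ha hφ).trans ((le_abs_self _).trans ?_)
  rw [abs_mul, Real.norm_eq_abs]

theorem norm_mul_cos_le_re {φ : ℝ} (hφ : φ < π / 2) {a : ℂ} (ha : |Complex.arg a| ≤ φ) :
    ‖a‖ * Real.cos φ ≤ a.re := by
  rw [← Complex.norm_mul_cos_arg a, ← Real.cos_abs (Complex.arg a)]
  exact mul_le_mul_of_nonneg_left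
    (Real.cos_le_cos_of_nonneg_of_le_pi (abs_nonneg _) (by linarith [pi_pos]) ha) (norm_nonneg _)

/-- Binomial expansion in `(n/a)²` under the sum: the remainder is at most a constant times `n^{2N}
|a|^{-2N}`, which is summable against `e^{-λn}`. The `1/2` comes from the power sum with `k = 0`, so
it is absent when `N = 0`. -/
theorem mathieuS_asymptotic {lam : ℝ} (hlam : 0 < lam) {mu : ℝ} (hmu : 0 ≤ mu) {φ : ℝ}
    (hφ0 : 0 ≤ φ) (hφ : φ < π / 2) (N : ℕ) : ∃ C : ℝ, ∀ a : ℂ, 1 ≤ ‖a‖ → |Complex.arg a| ≤ φ →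
      ‖mathieuS lam mu a - ((if N = 0 then 0 else 1 / 2) / a ^ ((2 * mu : ℝ) : ℂ)
        + algebraicSum lam mu N a)‖ ≤ C * ‖a‖ ^ (-(2 * mu + 2 * N)) := by
  have hcos : 0 < Real.cos φ := Real.cos_pos_of_mem_Ioo ⟨by linarith, hφ⟩
  obtain ⟨C, hC0, hC⟩ := norm_one_add_cpow_sub_le N (δ := Real.cos φ ^ 2) (by positivity) mu hmu
  have hmaj := Real.summable_pow_mul_exp_neg_nat_mul (2 * N) hlam
  refine ⟨C * ∑' n : ℕ, (n : ℝ) ^ (2 * N) * Real.exp (-lam * n), fun a ha hφa => ?_⟩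
  have hre0 := norm_mul_cos_le_re hφ hφa
  have hnpos : 0 < ‖a‖ := by linarith
  have hre : 0 < a.re := lt_of_lt_of_le (by positivity) hre0
  have ha0 := ne_zero_of_re_pos hre
  set c : ℕ → ℂ := fun k =>
    (-1) ^ k * (((ascPochhammer ℝ k).eval mu : ℝ) : ℂ) / (Nat.factorial k : ℂ) with hc
  set r : ℕ → ℂ := fun n => (1 + ((n : ℂ) / a) ^ 2) ^ (-(mu : ℂ)) -
    ∑ k ∈ Finset.range N, c k * (((n : ℂ) / a) ^ 2) ^ k with hr
  have hrb : ∀ n : ℕ, ‖r n‖ ≤ C * ((n : ℝ) ^ (2 * N) / ‖a‖ ^ (2 * N)) := by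
    intro n
    have h := hC (((n : ℂ) / a) ^ 2) fun s hs0 _ => by
      -- Writing `s = (√s)²` makes `s n²` the square of a real number, so the estimates for `t² +
      -- a²` apply along the whole segment; dividing by `|a|²` leaves the lower bound `cos² φ`.
      have h1 : (1 : ℂ) + s * ((n : ℂ) / a) ^ 2 = 1 + (((Real.sqrt s * n : ℝ) : ℂ) / a) ^ 2 := by
        have : (s : ℂ) = ((Real.sqrt s : ℝ) : ℂ) ^ 2 := by
          rw [← Complex.ofReal_pow, Real.sq_sqrt hs0]
        rw [this]; push_cast; ring
      rw [h1]
      refine ⟨(sq_add_sq_cpow_eq _ 0 hre).1, ?_⟩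
      have h2 := re_sq_le_norm_sq_add_sq (Real.sqrt s * n) hre
      have h3 : (1 : ℂ) + (((Real.sqrt s * n : ℝ) : ℂ) / a) ^ 2
          = (((Real.sqrt s * n : ℝ) : ℂ) ^ 2 + a ^ 2) / a ^ 2 := by
        field_simp
        ring
      rw [h3, norm_div, norm_pow, le_div_iff₀ (by positivity), ← mul_pow]
      refine le_trans ?_ h2
      rw [mul_comm]
      gcongr
    refine h.trans (le_of_eq ?_)
    rw [norm_pow, norm_div, Complex.norm_natCast, ← pow_mul, div_pow]
  have hnorm1 : ∀ n : ℕ, ‖(-1 : ℂ) ^ n * Complex.exp (-(lam * n))‖ = Real.exp (-lam * n) := by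
    intro n
    rw [norm_mul, norm_pow, norm_neg, norm_one, one_pow, one_mul, Complex.norm_exp]
    simp
  have hrem : ∀ n : ℕ, ‖(-1 : ℂ) ^ n * Complex.exp (-(lam * n)) * r n‖ ≤
      C / ‖a‖ ^ (2 * N) * ((n : ℝ) ^ (2 * N) * Real.exp (-lam * n)) := by
    intro n
    rw [norm_mul, hnorm1]
    calc Real.exp (-lam * n) * ‖r n‖
        ≤ Real.exp (-lam * n) * (C * ((n : ℝ) ^ (2 * N) / ‖a‖ ^ (2 * N))) := by
          gcongr; exact hrb n
      _ = _ := by ring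
  have hremsum := Summable.of_norm_bounded (hmaj.mul_left _) hrem
  have hremnorm := tsum_of_norm_bounded (hmaj.mul_left (C / ‖a‖ ^ (2 * N))).hasSum hrem
  rw [tsum_mul_left] at hremnorm
  have hE : ∀ k : ℕ, HasSum (fun n : ℕ => c k / a ^ (2 * k) *
      ((-1 : ℂ) ^ n * ((n : ℂ) ^ (2 * k) * Complex.exp (-(lam * n)))))
      (c k / a ^ (2 * k) * ((if k = 0 then 1 / 2 else 0) + (-1) ^ k * (coeffB lam k : ℂ))) := by
    intro k
    rw [← tsum_alternating_pow_mul_exp hlam k]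
    exact (summable_alternating_pow_mul_exp hlam (2 * k)).hasSum.mul_left _
  have hS := (((hasSum_sum (s := Finset.range N) fun k _ => hE k).add hremsum.hasSum).mul_left
    (a ^ ((-2 * mu : ℝ) : ℂ)))
  have hterm : mathieuTerm lam mu a = fun n : ℕ => a ^ ((-2 * mu : ℝ) : ℂ) *
      (∑ k ∈ Finset.range N, c k / a ^ (2 * k) *
        ((-1 : ℂ) ^ n * ((n : ℂ) ^ (2 * k) * Complex.exp (-(lam * n))))
        + (-1 : ℂ) ^ n * Complex.exp (-(lam * n)) * r n) := by
    funext n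
    have h1 := (sq_add_sq_cpow_eq n mu hre).2
    rw [Complex.ofReal_natCast] at h1
    have h2 : ∀ k : ℕ, c k / a ^ (2 * k) *
        ((-1 : ℂ) ^ n * ((n : ℂ) ^ (2 * k) * Complex.exp (-(lam * n))))
        = (-1 : ℂ) ^ n * Complex.exp (-(lam * n)) * (c k * (((n : ℂ) / a) ^ 2) ^ k) := by
      intro k
      rw [← pow_mul, div_pow]
      ring
    simp_rw [h2]
    rw [← Finset.mul_sum, ← mul_add, hr]
    simp only [add_sub_cancel]
    rw [mathieuTerm, h1, Complex.cpow_neg, show (-2 * mu : ℝ) = -(2 * mu) by ring,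
      Complex.ofReal_neg, Complex.cpow_neg, div_eq_mul_inv, mul_inv]
    ring
  rw [← hterm] at hS
  have halg : a ^ ((-2 * mu : ℝ) : ℂ) * ∑ k ∈ Finset.range N,
      c k / a ^ (2 * k) * ((if k = 0 then 1 / 2 else 0) + (-1) ^ k * (coeffB lam k : ℂ))
      = (if N = 0 then 0 else 1 / 2) / a ^ ((2 * mu : ℝ) : ℂ) + algebraicSum lam mu N a := by
    have h1 : ∀ k : ℕ, c k / a ^ (2 * k) *
        ((if k = 0 then 1 / 2 else 0) + (-1) ^ k * (coeffB lam k : ℂ))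
        = (if k = 0 then 1 / 2 else 0) + (((ascPochhammer ℝ k).eval mu * coeffB lam k : ℝ) : ℂ) /
          ((Nat.factorial k : ℂ) * a ^ (2 * k)) := by
      intro k
      rw [mul_add]
      congr 1
      · split_ifs with h
        · subst h; simp [hc]
        · simp
      · simp only [hc]
        have h2 : ((-1 : ℂ) ^ k) * (-1) ^ k = 1 := by rw [← mul_pow]; simp
        push_cast
        rw [← div_div]
        linear_combination ((((ascPochhammer ℝ k).eval mu : ℝ) : ℂ) / (Nat.factorial k : ℂ) / a ^ (2 * k) *
          (coeffB lam k : ℂ)) * h2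
    simp_rw [h1]
    rw [Finset.sum_add_distrib, mul_add, ← algebraicSum]
    congr 1
    rw [Finset.sum_ite_eq' (Finset.range N) 0, show (-2 * mu : ℝ) = -(2 * mu) by ring,
      Complex.ofReal_neg, Complex.cpow_neg, mul_comm, div_eq_mul_inv]
    congr 1
    rcases Nat.eq_zero_or_pos N with rfl | h
    · simp
    · simp [h, h.ne']
  rw [mathieuS, hS.tsum_eq, mul_add, halg, add_sub_cancel_left, norm_mul, Complex.norm_cpow_real]
  calc ‖a‖ ^ (-2 * mu) * _ ≤ ‖a‖ ^ (-2 * mu) * (C / ‖a‖ ^ (2 * N) *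
        ∑' n : ℕ, (n : ℝ) ^ (2 * N) * Real.exp (-lam * n)) := by gcongr
    _ = _ := by
      rw [neg_add, Real.rpow_add hnpos, show -(2 * (N : ℝ)) = -((2 * N : ℕ) : ℝ) by push_cast; ring,
        Real.rpow_neg hnpos.le ((2 * N : ℕ) : ℝ), Real.rpow_natCast, neg_mul]
      ring

/-- For `φ < 0` the sector is empty. For `N = 0` the term `1/(2a^{2μ})` is itself of the order of
the error, which accounts for the extra `1/2` in the constant. -/
theorem mathieuS_sub_isBigO {lam : ℝ} (hlam : 0 < lam) {mu : ℝ} (hmu : 0 ≤ mu) {φ : ℝ}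
    (hφ : φ < π / 2) (N : ℕ) :
    (fun a : ℂ => mathieuS lam mu a - (1 / (2 * a ^ ((2 * mu : ℝ) : ℂ)) + algebraicSum lam mu N a))
      =O[inftyInSector φ] fun a : ℂ => ‖a‖ ^ (-(2 * mu + 2 * N)) := by
  rcases lt_or_ge φ 0 with h0 | h0
  · exact isBigO_inftyInSector (C := 0) fun a _ h => absurd ((abs_nonneg _).trans h) (not_le.2 h0)
  obtain ⟨C, hC⟩ := mathieuS_asymptotic hlam hmu h0 hφ N
  refine isBigO_inftyInSector (C := C + 1 / 2) fun a ha1 ha2 => ?_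
  have h := hC a ha1 ha2
  by_cases hN : N = 0
  · subst hN
    simp only [if_true, zero_div, zero_add] at h
    have h2 : ‖1 / (2 * a ^ ((2 * mu : ℝ) : ℂ))‖ = 1 / 2 * ‖a‖ ^ (-(2 * mu + 2 * ((0 : ℕ) : ℝ))) := by
      rw [norm_div, norm_mul, Complex.norm_cpow_real]
      simp only [Nat.cast_zero, mul_zero, add_zero]
      rw [Real.rpow_neg (norm_nonneg a)]
      simp [mul_comm]
    have h3 : mathieuS lam mu a - (1 / (2 * a ^ ((2 * mu : ℝ) : ℂ)) + algebraicSum lam mu 0 a)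
        = (mathieuS lam mu a - algebraicSum lam mu 0 a) - 1 / (2 * a ^ ((2 * mu : ℝ) : ℂ)) := by ring
    rw [h3]
    refine (norm_sub_le _ _).trans ?_
    rw [h2, add_mul]
    exact add_le_add_left h _
  · rw [if_neg hN, div_div] at h
    refine h.trans ?_
    have : 0 ≤ ‖a‖ ^ (-(2 * mu + 2 * (N : ℝ))) := by positivity
    linarith

/-! ### Principal powers of products and quotients of numbers with positive real part. -/

/-- Both arguments lie in `(-π/2, π/2)`, so their difference does not leave `(-π, π)`. -/
theorem log_div_of_re_pos {u v : ℂ} (hu : 0 < u.re) (hv : 0 < v.re) :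
    Complex.log (u / v) = Complex.log u - Complex.log v ∧ u / v ∈ Complex.slitPlane := by
  have hu' := abs_lt.1 (Complex.abs_arg_lt_pi_div_two_iff.2 (Or.inl hu))
  have hv' := abs_lt.1 (Complex.abs_arg_lt_pi_div_two_iff.2 (Or.inl hv))
  have hexp : u / v = Complex.exp (Complex.log u - Complex.log v) := by
    rw [Complex.exp_sub, Complex.exp_log (ne_zero_of_re_pos hu), Complex.exp_log (ne_zero_of_re_pos hv)]
  have h1 : Complex.log (u / v) = Complex.log u - Complex.log v := by
    rw [hexp, Complex.log_exp]
    · rw [Complex.sub_im, Complex.log_im, Complex.log_im]; linarith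
    · rw [Complex.sub_im, Complex.log_im, Complex.log_im]; linarith
  refine ⟨h1, Complex.mem_slitPlane_iff_arg.2 ⟨?_, div_ne_zero (ne_zero_of_re_pos hu) (ne_zero_of_re_pos hv)⟩⟩
  rw [← Complex.log_im, h1, Complex.sub_im, Complex.log_im, Complex.log_im]
  linarith

theorem log_mul_of_re_pos {u v : ℂ} (hu : 0 < u.re) (hv : 0 < v.re) :
    Complex.log (u * v) = Complex.log u + Complex.log v ∧ u * v ∈ Complex.slitPlane := by
  have hu' := abs_lt.1 (Complex.abs_arg_lt_pi_div_two_iff.2 (Or.inl hu))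
  have hv' := abs_lt.1 (Complex.abs_arg_lt_pi_div_two_iff.2 (Or.inl hv))
  have hexp : u * v = Complex.exp (Complex.log u + Complex.log v) := by
    rw [Complex.exp_add, Complex.exp_log (ne_zero_of_re_pos hu), Complex.exp_log (ne_zero_of_re_pos hv)]
  have h1 : Complex.log (u * v) = Complex.log u + Complex.log v := by
    rw [hexp, Complex.log_exp]
    · rw [Complex.add_im, Complex.log_im, Complex.log_im]; linarith
    · rw [Complex.add_im, Complex.log_im, Complex.log_im]; linarith
  refine ⟨h1, Complex.mem_slitPlane_iff_arg.2 ⟨?_, mul_ne_zero (ne_zero_of_re_pos hu) (ne_zero_of_re_pos hv)⟩⟩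
  rw [← Complex.log_im, h1, Complex.add_im, Complex.log_im, Complex.log_im]
  linarith

theorem div_cpow_of_re_pos {u v : ℂ} (hu : 0 < u.re) (hv : 0 < v.re) (s : ℂ) :
    (u / v) ^ s = u ^ s / v ^ s := by
  have hu0 := ne_zero_of_re_pos hu
  have hv0 := ne_zero_of_re_pos hv
  rw [Complex.cpow_def_of_ne_zero (div_ne_zero hu0 hv0), Complex.cpow_def_of_ne_zero hu0,
    Complex.cpow_def_of_ne_zero hv0, (log_div_of_re_pos hu hv).1, sub_mul, Complex.exp_sub]

theorem mul_cpow_of_re_pos {u v : ℂ} (hu : 0 < u.re) (hv : 0 < v.re) (s : ℂ) :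
    (u * v) ^ s = u ^ s * v ^ s := by
  have hu0 := ne_zero_of_re_pos hu
  have hv0 := ne_zero_of_re_pos hv
  rw [Complex.cpow_def_of_ne_zero (mul_ne_zero hu0 hv0), Complex.cpow_def_of_ne_zero hu0,
    Complex.cpow_def_of_ne_zero hv0, (log_mul_of_re_pos hu hv).1, add_mul, Complex.exp_add]

/-! ### Integral forms of the Bessel function and its recurrence. -/

theorem norm_cpow_le_of_re_ge {δ M : ℝ} (hδ : 0 < δ) (hδ1 : δ ≤ 1) {w : ℂ} (hw : δ ≤ w.re)
    (hM : 1 ≤ M) (hwM : ‖w‖ ≤ M) (p : ℝ) : ‖w ^ (p : ℂ)‖ ≤ (δ⁻¹ * M) ^ |p| := by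
  rw [Complex.norm_cpow_real]
  have hδw : δ ≤ ‖w‖ := hw.trans ((le_abs_self _).trans (Complex.abs_re_le_norm w))
  have hδ' : 1 ≤ δ⁻¹ := (one_le_inv₀ hδ).2 hδ1
  rcases le_total 0 p with hp | hp
  · rw [abs_of_nonneg hp]
    exact Real.rpow_le_rpow (norm_nonneg _) (by nlinarith) hp
  · rw [abs_of_nonpos hp]
    calc ‖w‖ ^ p ≤ δ ^ p := Real.rpow_le_rpow_of_nonpos hδ hδw hp
      _ = (δ⁻¹) ^ (-p) := by rw [Real.inv_rpow hδ.le, Real.rpow_neg hδ.le, inv_inv]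
      _ ≤ _ := Real.rpow_le_rpow (by positivity) (by nlinarith) (neg_nonneg.2 hp)

/-- Algebraic growth is absorbed by half of the weight `e^{-t}`. The constant `1 + 2qB` is chosen so
that `tBq/(1 + 2qB) ≤ t/2`; it does not depend on `t`. -/
theorem one_add_mul_rpow_le {q B t : ℝ} (hq : 0 ≤ q) (hB : 0 ≤ B) (ht : 0 ≤ t) :
    (1 + t * B) ^ q ≤ (1 + 2 * q * B) ^ q * Real.exp (t / 2) := by
  have hD : 0 < 1 + 2 * q * B := by positivity
  have h1 : 1 + t * B ≤ (1 + 2 * q * B) * Real.exp (t * B / (1 + 2 * q * B)) := by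
    have h2 := Real.add_one_le_exp (t * B / (1 + 2 * q * B))
    calc 1 + t * B ≤ (1 + 2 * q * B) * (t * B / (1 + 2 * q * B) + 1) := by
          rw [mul_add, mul_div_cancel₀ _ hD.ne']
          have : 0 ≤ 2 * q * B := by positivity
          linarith
      _ ≤ _ := by gcongr
  calc (1 + t * B) ^ q ≤ ((1 + 2 * q * B) * Real.exp (t * B / (1 + 2 * q * B))) ^ q :=
        Real.rpow_le_rpow (by positivity) h1 hq
    _ = (1 + 2 * q * B) ^ q * Real.exp (t * B / (1 + 2 * q * B) * q) := by
        rw [Real.mul_rpow hD.le (Real.exp_pos _).le, ← Real.exp_mul]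
    _ ≤ _ := by
        gcongr
        rw [div_mul_eq_mul_div, div_le_div_iff₀ hD two_pos]
        have : 0 ≤ t := ht
        nlinarith [mul_nonneg (mul_nonneg ht hB) hq]

theorem integrableOn_rpow_mul_exp_neg_mul {p r : ℝ} (hp : -1 < p) (hr : 0 < r) :
    IntegrableOn (fun t : ℝ => t ^ p * Real.exp (-r * t)) (Set.Ioi 0) := by
  simpa using integrableOn_rpow_mul_exp_neg_mul_rpow hp one_pos hr

/-- `∫ e^{-t} t^p (c + tb/2)^p dt`. -/
noncomputable def besselPhi (p : ℝ) (c b : ℂ) : ℂ :=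
  ∫ t in Set.Ioi (0 : ℝ), ((Real.exp (-t) * t ^ p : ℝ) : ℂ) * (c + t * b / 2) ^ (p : ℂ)

/-- `∫ r^p e^{-rc} (1 + rb/2)^p dr`. -/
noncomputable def besselPsi (p : ℝ) (c b : ℂ) : ℂ :=
  ∫ r in Set.Ioi (0 : ℝ), ((r ^ p : ℝ) : ℂ) * Complex.exp (-(r * c)) * (1 + r * b / 2) ^ (p : ℂ)

theorem re_add_mul_div_two {c b : ℂ} {t : ℝ} (hb : 0 ≤ b.re) (ht : 0 ≤ t) :
    c.re ≤ (c + t * b / 2).re := by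
  have h : (c + t * b / 2 : ℂ).re = c.re + t * b.re / 2 := by
    simp
  rw [h]
  have := mul_nonneg ht hb
  linarith

theorem norm_add_mul_div_two_le {c b : ℂ} {t M B : ℝ} (hM : 1 ≤ M) (hcM : ‖c‖ ≤ M) (hB : ‖b‖ ≤ B)
    (ht : 0 ≤ t) : ‖c + t * b / 2‖ ≤ M * (1 + t * B) := by
  have h1 : ‖(t : ℂ) * b / 2‖ ≤ t * B := by
    rw [norm_div, norm_mul, Complex.norm_real, Real.norm_of_nonneg ht]
    have := mul_le_mul_of_nonneg_left hB ht
    have h0 := mul_nonneg ht (norm_nonneg b)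
    simp
    linarith
  have h2 := norm_add_le c (t * b / 2)
  have h3 : 0 ≤ t * B := (norm_nonneg _).trans h1
  nlinarith

theorem norm_besselPhi_integrand_le {δ M B : ℝ} (hδ : 0 < δ) (hδ1 : δ ≤ 1) (hM : 1 ≤ M)
    {c b : ℂ} (hc : δ ≤ c.re) (hcM : ‖c‖ ≤ M) (hb : 0 ≤ b.re) (hB : ‖b‖ ≤ B) (p q : ℝ) {t : ℝ}
    (ht : 0 < t) : ‖((Real.exp (-t) * t ^ p : ℝ) : ℂ) * (c + t * b / 2) ^ (q : ℂ)‖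
      ≤ (δ⁻¹ * M) ^ |q| * (1 + 2 * |q| * B) ^ |q| * (t ^ p * Real.exp (-(1 / 2) * t)) := by
  have hB0 : 0 ≤ B := (norm_nonneg b).trans hB
  have h1 := norm_cpow_le_of_re_ge hδ hδ1 (hc.trans (re_add_mul_div_two hb ht.le))
    (M := M * (1 + t * B)) (by nlinarith [mul_nonneg ht.le hB0])
    (norm_add_mul_div_two_le hM hcM hB ht.le) q
  have h2 := one_add_mul_rpow_le (abs_nonneg q) hB0 ht.le
  rw [norm_mul, Complex.norm_real, Real.norm_of_nonneg (by positivity)]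
  calc Real.exp (-t) * t ^ p * ‖(c + t * b / 2) ^ (q : ℂ)‖
      ≤ Real.exp (-t) * t ^ p * (δ⁻¹ * (M * (1 + t * B))) ^ |q| := by gcongr
    _ = Real.exp (-t) * t ^ p * ((δ⁻¹ * M) ^ |q| * (1 + t * B) ^ |q|) := by
        rw [← mul_assoc δ⁻¹, Real.mul_rpow (by positivity) (by positivity)]
    _ ≤ Real.exp (-t) * t ^ p * ((δ⁻¹ * M) ^ |q| * ((1 + 2 * |q| * B) ^ |q| * Real.exp (t / 2))) := by
        gcongr
    _ = _ := by
        rw [show -(1 / 2) * t = -t + t / 2 by ring, Real.exp_add]; ring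

theorem aestronglyMeasurable_besselPhi_integrand (p q : ℝ) {c b : ℂ} (hc : 0 < c.re) (hb : 0 ≤ b.re) :
    AEStronglyMeasurable (fun t : ℝ => ((Real.exp (-t) * t ^ p : ℝ) : ℂ) * (c + t * b / 2) ^ (q : ℂ))
      (volume.restrict (Set.Ioi 0)) := by
  refine ContinuousOn.aestronglyMeasurable (fun t ht => ?_) measurableSet_Ioi
  have ht0 : (0 : ℝ) < t := ht
  refine ContinuousAt.continuousWithinAt (ContinuousAt.mul ?_ ?_)
  · refine Complex.continuous_ofReal.continuousAt.comp ?_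
    exact (by fun_prop : ContinuousAt (fun t : ℝ => Real.exp (-t)) t).mul
      (Real.continuousAt_rpow_const _ _ (Or.inl ht0.ne'))
  · refine ContinuousAt.cpow (by fun_prop) continuousAt_const ?_
    exact mem_slitPlane_of_re_pos (hc.trans_le (re_add_mul_div_two hb ht0.le))

theorem integrableOn_besselPhi {p : ℝ} (hp : -1 < p) (q : ℝ) {c b : ℂ} (hc : 0 < c.re) (hb : 0 ≤ b.re) :
    IntegrableOn (fun t : ℝ => ((Real.exp (-t) * t ^ p : ℝ) : ℂ) * (c + t * b / 2) ^ (q : ℂ))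
      (Set.Ioi 0) := by
  refine Integrable.mono' ((integrableOn_rpow_mul_exp_neg_mul hp (half_pos one_pos)).const_mul
    (((min 1 c.re)⁻¹ * max 1 ‖c‖) ^ |q| * (1 + 2 * |q| * ‖b‖) ^ |q|))
    (aestronglyMeasurable_besselPhi_integrand p q hc hb) ?_
  filter_upwards [ae_restrict_mem measurableSet_Ioi] with t ht
  exact norm_besselPhi_integrand_le (lt_min one_pos hc) (min_le_left _ _) (le_max_left _ _)
    (min_le_right _ _) (le_max_right _ _) hb le_rfl p q ht

theorem norm_besselPhi_le {p : ℝ} (hp : -1 < p) {c b : ℂ} {B : ℝ} (hc : 1 ≤ c.re) (hb : 0 ≤ b.re)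
    (hB : ‖b‖ ≤ B) : ‖besselPhi p c b‖ ≤ ‖c‖ ^ |p| * (1 + 2 * |p| * B) ^ |p| *
      ∫ t in Set.Ioi (0 : ℝ), t ^ p * Real.exp (-(1 / 2) * t) := by
  rw [besselPhi, ← integral_const_mul]
  refine norm_integral_le_of_norm_le
    ((integrableOn_rpow_mul_exp_neg_mul hp (half_pos one_pos)).const_mul _) ?_
  filter_upwards [ae_restrict_mem measurableSet_Ioi] with t ht
  have h := norm_besselPhi_integrand_le one_pos le_rfl
    (hc.trans ((le_abs_self _).trans (Complex.abs_re_le_norm c))) hc le_rfl hb hB p p ht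
  rwa [inv_one, one_mul] at h

theorem ball_subset_re_pos {c : ℂ} : ∀ z ∈ Metric.ball c (c.re / 2), c.re / 2 < z.re := by
  intro z hz
  rw [Metric.mem_ball, dist_eq_norm] at hz
  have := (abs_le.1 (Complex.abs_re_le_norm (z - c))).1
  rw [Complex.sub_re] at this
  linarith

theorem norm_le_of_mem_ball {c : ℂ} {r : ℝ} : ∀ z ∈ Metric.ball c r, ‖z‖ ≤ ‖c‖ + r := by
  intro z hz
  rw [Metric.mem_ball, dist_eq_norm] at hz
  have := norm_sub_norm_le z c
  linarith

theorem besselPhi_hasDerivAt_right {p : ℝ} (hp : -1 < p) {c b : ℂ} (hc : 0 < c.re) (hb : 0 < b.re) :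
    HasDerivAt (besselPhi p c) (∫ t in Set.Ioi (0 : ℝ), ((Real.exp (-t) * t ^ p : ℝ) : ℂ) *
      (p * (c + t * b / 2) ^ ((p : ℂ) - 1) * (t / 2))) b := by
  have hder : ∀ t ∈ Set.Ioi (0 : ℝ), ∀ z : ℂ, 0 < z.re → HasDerivAt (fun z : ℂ =>
      ((Real.exp (-t) * t ^ p : ℝ) : ℂ) * (c + t * z / 2) ^ (p : ℂ))
      (((Real.exp (-t) * t ^ p : ℝ) : ℂ) * (p * (c + t * z / 2) ^ ((p : ℂ) - 1) * (t / 2))) z := by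
    intro t ht z hz
    have h1 : HasDerivAt (fun z : ℂ => c + t * z / 2) (t / 2) z := by
      simpa using (((hasDerivAt_id z).const_mul (t : ℂ)).div_const 2).const_add c
    exact (h1.cpow_const (mem_slitPlane_of_re_pos
      (hc.trans_le (re_add_mul_div_two hz.le (le_of_lt ht))))).const_mul _
  have hpos : ∀ z ∈ Metric.ball b (b.re / 2), 0 < z.re := fun z hz =>
    (half_pos hb).trans (ball_subset_re_pos z hz)
  have h := hasDerivAt_integral_of_holomorphic (μ := volume.restrict (Set.Ioi (0 : ℝ)))
    (F := fun z t => ((Real.exp (-t) * t ^ p : ℝ) : ℂ) * (c + t * z / 2) ^ (p : ℂ)) (half_pos hb)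
    ((integrableOn_rpow_mul_exp_neg_mul hp (half_pos one_pos)).const_mul
    (((min 1 c.re)⁻¹ * max 1 ‖c‖) ^ |p| * (1 + 2 * |p| * (‖b‖ + b.re / 2)) ^ |p|))
    (fun z hz => aestronglyMeasurable_besselPhi_integrand p p hc (hpos z hz).le)
    (by
      filter_upwards [ae_restrict_mem measurableSet_Ioi] with t ht z hz
      exact (hder t ht z (hpos z hz)).differentiableAt.differentiableWithinAt)
    (by
      filter_upwards [ae_restrict_mem measurableSet_Ioi] with t ht z hz
      exact norm_besselPhi_integrand_le (lt_min one_pos hc) (min_le_left _ _) (le_max_left _ _)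
        (min_le_right _ _) (le_max_right _ _) (hpos z hz).le (norm_le_of_mem_ball z hz) p p ht)
  refine h.2.congr_deriv ?_
  refine setIntegral_congr_fun measurableSet_Ioi fun t ht => ?_
  exact (hder t ht b hb).deriv

theorem besselPhi_differentiableOn_left {p : ℝ} (hp : -1 < p) {b : ℂ} (hb : 0 ≤ b.re) :
    DifferentiableOn ℂ (fun c => besselPhi p c b) {c : ℂ | 0 < c.re} := by
  intro c hc
  have hc' : 0 < c.re := hc
  have hpos : ∀ z ∈ Metric.ball c (c.re / 2), 0 < z.re := fun z hz =>
    (half_pos hc').trans (ball_subset_re_pos z hz)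
  have h := hasDerivAt_integral_of_holomorphic (μ := volume.restrict (Set.Ioi (0 : ℝ)))
    (F := fun z t => ((Real.exp (-t) * t ^ p : ℝ) : ℂ) * (z + t * b / 2) ^ (p : ℂ)) (half_pos hc')
    ((integrableOn_rpow_mul_exp_neg_mul hp (half_pos one_pos)).const_mul
    (((min 1 (c.re / 2))⁻¹ * max 1 (‖c‖ + c.re / 2)) ^ |p| * (1 + 2 * |p| * ‖b‖) ^ |p|))
    (fun z hz => aestronglyMeasurable_besselPhi_integrand p p (hpos z hz) hb)
    (by
      filter_upwards [ae_restrict_mem measurableSet_Ioi] with t ht z hz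
      have h1 : DifferentiableAt ℂ (fun z : ℂ => z + t * b / 2) z := by fun_prop
      exact ((h1.cpow_const (mem_slitPlane_of_re_pos ((hpos z hz).trans_le
        (re_add_mul_div_two hb (le_of_lt ht))))).const_mul _).differentiableWithinAt)
    (by
      filter_upwards [ae_restrict_mem measurableSet_Ioi] with t ht z hz
      exact norm_besselPhi_integrand_le (lt_min one_pos (half_pos hc')) (min_le_left _ _)
        (le_max_left _ _) ((min_le_right _ _).trans (ball_subset_re_pos z hz).le)
        ((norm_le_of_mem_ball z hz).trans (le_max_right _ _)) hb le_rfl p p ht)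
  exact h.2.differentiableAt.differentiableWithinAt

theorem norm_besselPsi_integrand_le {δ B : ℝ} (hδ : 0 < δ) {c b : ℂ} (hc : δ ≤ c.re)
    (hb : 0 ≤ b.re) (hB : ‖b‖ ≤ B) (p : ℝ) {r : ℝ} (hr : 0 < r) :
    ‖((r ^ p : ℝ) : ℂ) * Complex.exp (-(r * c)) * (1 + r * b / 2) ^ (p : ℂ)‖
      ≤ (1 + 2 * |p| * (B / δ)) ^ |p| * (r ^ p * Real.exp (-(δ / 2) * r)) := by
  have hB0 : 0 ≤ B := (norm_nonneg b).trans hB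
  have h1 := norm_cpow_le_of_re_ge one_pos le_rfl (w := 1 + r * b / 2) (M := 1 + r * B)
    (by simpa using re_add_mul_div_two (c := 1) hb hr.le)
    (by nlinarith [mul_nonneg hr.le hB0])
    (by simpa using norm_add_mul_div_two_le (c := 1) le_rfl (by simp) hB hr.le) p
  rw [inv_one, one_mul] at h1
  have h2 := one_add_mul_rpow_le (abs_nonneg p) (div_nonneg hB0 hδ.le) (mul_nonneg hδ.le hr.le)
  have h3 : δ * r * (B / δ) = r * B := by field_simp
  rw [h3] at h2
  have h4 : ‖Complex.exp (-(r * c))‖ ≤ Real.exp (-(δ * r)) := by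
    rw [Complex.norm_exp]
    refine Real.exp_le_exp.2 ?_
    simp only [Complex.neg_re, Complex.re_ofReal_mul]
    nlinarith
  rw [norm_mul, norm_mul, Complex.norm_real, Real.norm_of_nonneg (by positivity)]
  calc r ^ p * ‖Complex.exp (-(r * c))‖ * ‖(1 + r * b / 2) ^ (p : ℂ)‖
      ≤ r ^ p * Real.exp (-(δ * r)) * ((1 + 2 * |p| * (B / δ)) ^ |p| * Real.exp (δ * r / 2)) := by
        gcongr
        exact h1.trans h2
    _ = _ := by
        rw [show -(δ / 2) * r = -(δ * r) + δ * r / 2 by ring, Real.exp_add]; ring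

theorem aestronglyMeasurable_besselPsi_integrand (p : ℝ) {c b : ℂ} (hb : 0 ≤ b.re) :
    AEStronglyMeasurable (fun r : ℝ => ((r ^ p : ℝ) : ℂ) * Complex.exp (-(r * c)) *
      (1 + r * b / 2) ^ (p : ℂ)) (volume.restrict (Set.Ioi 0)) := by
  refine ContinuousOn.aestronglyMeasurable (fun t ht => ?_) measurableSet_Ioi
  have ht0 : (0 : ℝ) < t := ht
  refine ContinuousAt.continuousWithinAt (ContinuousAt.mul (ContinuousAt.mul ?_ (by fun_prop)) ?_)
  · exact Complex.continuous_ofReal.continuousAt.comp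
      (Real.continuousAt_rpow_const _ _ (Or.inl ht0.ne'))
  · refine ContinuousAt.cpow (by fun_prop) continuousAt_const ?_
    exact mem_slitPlane_of_re_pos (lt_of_lt_of_le (by simp) (re_add_mul_div_two (c := 1) hb ht0.le))

theorem integrableOn_besselPsi {p : ℝ} (hp : -1 < p) {c b : ℂ} (hc : 0 < c.re) (hb : 0 ≤ b.re) :
    IntegrableOn (fun r : ℝ => ((r ^ p : ℝ) : ℂ) * Complex.exp (-(r * c)) *
      (1 + r * b / 2) ^ (p : ℂ)) (Set.Ioi 0) := by
  refine Integrable.mono' ((integrableOn_rpow_mul_exp_neg_mul hp (half_pos hc)).const_mul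
    ((1 + 2 * |p| * (‖b‖ / c.re)) ^ |p|)) (aestronglyMeasurable_besselPsi_integrand p hb) ?_
  filter_upwards [ae_restrict_mem measurableSet_Ioi] with t ht
  exact norm_besselPsi_integrand_le hc le_rfl hb le_rfl p ht

theorem besselPsi_differentiableOn {p : ℝ} (hp : -1 < p) {b : ℂ} (hb : 0 ≤ b.re) :
    DifferentiableOn ℂ (fun c => besselPsi p c b) {c : ℂ | 0 < c.re} := by
  intro c hc
  have hc' : 0 < c.re := hc
  have h := hasDerivAt_integral_of_holomorphic (μ := volume.restrict (Set.Ioi (0 : ℝ)))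
    (F := fun z r => ((r ^ p : ℝ) : ℂ) * Complex.exp (-(r * z)) * (1 + r * b / 2) ^ (p : ℂ))
    (half_pos hc')
    ((integrableOn_rpow_mul_exp_neg_mul hp (half_pos (half_pos hc'))).const_mul
      ((1 + 2 * |p| * (‖b‖ / (c.re / 2))) ^ |p|))
    (fun z hz => aestronglyMeasurable_besselPsi_integrand p hb)
    (Eventually.of_forall fun t => by fun_prop)
    (by
      filter_upwards [ae_restrict_mem measurableSet_Ioi] with t ht z hz
      exact norm_besselPsi_integrand_le (half_pos hc') (ball_subset_re_pos z hz).le hb le_rfl p ht)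
  exact h.2.differentiableAt.differentiableWithinAt

/-- Rotation of the ray of integration. -/
theorem besselPsi_eq {p : ℝ} (hp : -1 < p) {c b : ℂ} (hc : 0 < c.re) (hb : 0 ≤ b.re) :
    besselPsi p c b = c ^ ((-(2 * p + 1) : ℝ) : ℂ) * besselPhi p c b := by
  -- No contour is moved: for `c = x > 0` the substitution `t = xr` is real, and both sides are
  -- analytic in `c`.
  refine eqOn_re_pos_of_eq_on_pos_reals (f := fun c => besselPsi p c b)
    (g := fun c => c ^ ((-(2 * p + 1) : ℝ) : ℂ) * besselPhi p c b)
    (besselPsi_differentiableOn hp hb) (DifferentiableOn.mul (fun c hc => ?_)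
      (besselPhi_differentiableOn_left hp hb)) (fun x hx => ?_) c hc
  · exact (differentiableAt_id.cpow_const (mem_slitPlane_of_re_pos hc)).differentiableWithinAt
  · set g : ℝ → ℂ := fun t => ((Real.exp (-t) * t ^ p : ℝ) : ℂ) * ((x : ℂ) + t * b / 2) ^ (p : ℂ) with hg
    have h1 := integral_comp_mul_left_Ioi g 0 hx
    rw [mul_zero] at h1
    have h2 : ∀ r ∈ Set.Ioi (0 : ℝ), ((r ^ p : ℝ) : ℂ) * Complex.exp (-(r * x)) *
        (1 + r * b / 2) ^ (p : ℂ) = ((x ^ (-(2 * p)) : ℝ) : ℂ) * g (x * r) := by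
      intro r hr
      have hr0 : (0 : ℝ) < r := hr
      have h3 : ((x : ℂ) + ((x * r : ℝ) : ℂ) * b / 2) = x * (1 + r * b / 2) := by push_cast; ring
      have h4 : 0 < (1 + r * b / 2 : ℂ).re :=
        lt_of_lt_of_le (by simp) (re_add_mul_div_two (c := 1) hb hr0.le)
      simp only [hg]
      rw [h3, mul_cpow_of_re_pos (by simpa using hx) h4, ← Complex.ofReal_cpow hx.le,
        Real.mul_rpow hx.le hr0.le, show -(2 * p) = -p + -p by ring, Real.rpow_add hx,
        Real.rpow_neg hx.le]
      have h5 : ((x ^ p : ℝ) : ℂ) ≠ 0 := Complex.ofReal_ne_zero.2 (Real.rpow_pos_of_pos hx p).ne'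
      push_cast
      rw [show -((r : ℂ) * x) = -(x * r) by ring]
      field_simp
    simp only [besselPsi]
    rw [setIntegral_congr_fun measurableSet_Ioi h2, integral_const_mul, h1, besselPhi,
      Complex.real_smul, ← mul_assoc, ← Complex.ofReal_mul, ← Complex.ofReal_cpow hx.le]
    congr 2
    rw [← Real.rpow_neg_one, ← Real.rpow_add hx]
    ring_nf

theorem integral_rpow_mul_cexp_neg_mul {q : ℝ} (hq : 0 < q) {z : ℂ} (hz : 0 < z.re) :
    ∫ r in Set.Ioi (0 : ℝ), ((r ^ (q - 1) : ℝ) : ℂ) * Complex.exp (-(r * z))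
      = Real.Gamma q * z ^ ((-q : ℝ) : ℂ) := by
  have h1 := besselPsi_eq (p := q - 1) (by linarith) hz (b := 0) (by simp)
  have h2 : besselPsi (q - 1) z 0 = ∫ r in Set.Ioi (0 : ℝ), ((r ^ (q - 1) : ℝ) : ℂ) * Complex.exp (-(r * z)) := by
    simp [besselPsi]
  have h3 : besselPhi (q - 1) z 0 = Real.Gamma q * z ^ ((q - 1 : ℝ) : ℂ) := by
    simp only [besselPhi, mul_zero, zero_div, add_zero]
    rw [integral_mul_const, integral_complex_ofReal, Real.Gamma_eq_integral hq]
  rw [← h2, h1, h3, mul_left_comm, ← Complex.cpow_add _ _ (ne_zero_of_re_pos hz), ← Complex.ofReal_add]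
  ring_nf

/-- This carries the symmetry `K_{-ν} = K_ν`. Write `Γ(μ) (c + tb/2)^{-μ}` as an Euler integral in
`r` and interchange; the integral over `t` is then Euler's integral for `1 - μ`. -/
theorem gamma_mul_besselPhi {mu : ℝ} (h0 : 0 < mu) (h1 : mu < 1) {c b : ℂ} (hc : 0 < c.re)
    (hb : 0 ≤ b.re) :
    Real.Gamma mu * besselPhi (-mu) c b = Real.Gamma (1 - mu) * besselPsi (mu - 1) c b := by
  set f : ℝ → ℝ → ℂ := fun t r => ((Real.exp (-t) * t ^ (-mu) : ℝ) : ℂ) *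
    (((r ^ (mu - 1) : ℝ) : ℂ) * Complex.exp (-(r * (c + t * b / 2)))) with hf
  have hint : Integrable (Function.uncurry f)
      ((volume.restrict (Set.Ioi (0 : ℝ))).prod (volume.restrict (Set.Ioi (0 : ℝ)))) := by
    have hA := integrableOn_rpow_mul_exp_neg_mul (p := -mu) (r := 1) (by linarith) one_pos
    have hB := integrableOn_rpow_mul_exp_neg_mul (p := mu - 1) (by linarith) hc
    refine (Integrable.mul_prod hA hB).mono' ?_ ?_
    · refine Measurable.aestronglyMeasurable ?_
      simp only [hf, Function.uncurry_def]
      fun_prop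
    · rw [Measure.prod_restrict]
      filter_upwards [ae_restrict_mem (measurableSet_Ioi.prod measurableSet_Ioi)] with z hz
      have ht : (0 : ℝ) < z.1 := hz.1
      have hr : (0 : ℝ) < z.2 := hz.2
      simp only [hf, Function.uncurry_def]
      rw [norm_mul, norm_mul, Complex.norm_real, Complex.norm_real, Real.norm_of_nonneg (by positivity),
        Real.norm_of_nonneg (by positivity), Complex.norm_exp, mul_comm (Real.exp _)]
      have h2 := re_add_mul_div_two (c := c) hb ht.le
      have h3 : Real.exp (-(z.2 * (c + z.1 * b / 2)) : ℂ).re ≤ Real.exp (-c.re * z.2) := by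
        refine Real.exp_le_exp.2 ?_
        simp only [Complex.neg_re, Complex.re_ofReal_mul]
        nlinarith
      rw [neg_one_mul]
      gcongr
  have hswap := integral_integral_swap hint
  have hL : ∀ t ∈ Set.Ioi (0 : ℝ), ∫ r in Set.Ioi (0 : ℝ), f t r
      = Real.Gamma mu * (((Real.exp (-t) * t ^ (-mu) : ℝ) : ℂ) * (c + t * b / 2) ^ ((-mu : ℝ) : ℂ)) := by
    intro t ht
    simp only [hf]
    rw [integral_const_mul, integral_rpow_mul_cexp_neg_mul h0
      (hc.trans_le (re_add_mul_div_two hb (le_of_lt ht)))]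
    ring
  have hR : ∀ r ∈ Set.Ioi (0 : ℝ), ∫ t in Set.Ioi (0 : ℝ), f t r
      = Real.Gamma (1 - mu) * (((r ^ (mu - 1) : ℝ) : ℂ) * Complex.exp (-(r * c)) *
        (1 + r * b / 2) ^ ((mu - 1 : ℝ) : ℂ)) := by
    intro r hr
    have h2 : ∀ t : ℝ, f t r = (((r ^ (mu - 1) : ℝ) : ℂ) * Complex.exp (-(r * c))) *
        (((t ^ ((1 - mu) - 1) : ℝ) : ℂ) * Complex.exp (-(t * (1 + r * b / 2)))) := by
      intro t
      simp only [hf]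
      have h3 : Complex.exp (-(r * (c + t * b / 2))) * Complex.exp (-t)
          = Complex.exp (-(r * c)) * Complex.exp (-(t * (1 + r * b / 2))) := by
        rw [← Complex.exp_add, ← Complex.exp_add]; ring_nf
      rw [show 1 - mu - 1 = -mu by ring]
      push_cast
      linear_combination (((t ^ (-mu) : ℝ) : ℂ) * ((r ^ (mu - 1) : ℝ) : ℂ)) * h3
    simp_rw [h2]
    rw [integral_const_mul, integral_rpow_mul_cexp_neg_mul (by linarith)
      (lt_of_lt_of_le (by simp) (re_add_mul_div_two (c := 1) hb (le_of_lt hr)))]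
    rw [show -(1 - mu) = mu - 1 by ring]
    ring
  rw [setIntegral_congr_fun measurableSet_Ioi hL, setIntegral_congr_fun measurableSet_Ioi hR,
    integral_const_mul, integral_const_mul] at hswap
  exact hswap

/-- The function `a^{1-2μ} K_{1/2-μ}(ca) / (ca)^{1/2-μ}`. -/
noncomputable def besselV (mu : ℝ) (c a : ℂ) : ℂ :=
  a ^ ((1 - 2 * mu : ℝ) : ℂ) * besselQuot mu (c * a)

theorem inv_re_pos {a : ℂ} (ha : 0 < a.re) : 0 < (a⁻¹).re := by
  rw [Complex.inv_re]
  exact div_pos ha (Complex.normSq_pos.2 (ne_zero_of_re_pos ha))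

/-- The product `ca` need not have positive real part, but `c`, `a` and `c + t/(2a)` do, so every
principal power splits. The exponent `p` is `-μ` for `μ ≤ 1/2` and `μ - 1` for `μ ≥ 1/2`; the two
lemmas that follow remove this distinction. -/
theorem besselV_eq_besselPhi_aux (mu : ℝ) {c a : ℂ} (hc : 0 < c.re) (ha : 0 < a.re) {p : ℝ}
    (hp : p = |1 / 2 - mu| - 1 / 2) :
    besselV mu c a = Real.sqrt (π / 2) / Real.Gamma (p + 1) * c ^ ((mu - 1 - p : ℝ) : ℂ) *
      (a ^ ((-mu : ℝ) : ℂ) * Complex.exp (-(c * a)) * besselPhi p c a⁻¹) := by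
  have hc0 := ne_zero_of_re_pos hc
  have ha0 := ne_zero_of_re_pos ha
  have hint : ∫ t in Set.Ioi (0 : ℝ), ((Real.exp (-t) * t ^ (|1 / 2 - mu| - 1 / 2) : ℝ) : ℂ) *
      (1 + t / (2 * (c * a))) ^ ((|1 / 2 - mu| - 1 / 2 : ℝ) : ℂ)
      = besselPhi p c a⁻¹ * c ^ ((-p : ℝ) : ℂ) := by
    rw [← hp, besselPhi, ← integral_mul_const]
    refine setIntegral_congr_fun measurableSet_Ioi fun t ht => ?_
    have h1 : (1 : ℂ) + t / (2 * (c * a)) = (c + t * a⁻¹ / 2) / c := by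
      field_simp
    rw [h1, div_cpow_of_re_pos (hc.trans_le (re_add_mul_div_two (inv_re_pos ha).le (le_of_lt ht))) hc,
      Complex.ofReal_neg, Complex.cpow_neg]
    ring
  have hroot : (π / (2 * (c * a)) : ℂ) ^ (1 / 2 : ℂ)
      = Real.sqrt (π / 2) * (c ^ ((-(1 / 2) : ℝ) : ℂ) * a ^ ((-(1 / 2) : ℝ) : ℂ)) := by
    have h1 : (π / (2 * (c * a)) : ℂ) = ((π / 2 : ℝ) : ℂ) / c / a := by
      push_cast; field_simp
    have h2 : 0 < (((π / 2 : ℝ) : ℂ)).re := by rw [Complex.ofReal_re]; positivity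
    have h3 : 0 < (((π / 2 : ℝ) : ℂ) / c).re := by
      rw [div_eq_mul_inv, Complex.re_ofReal_mul]
      exact mul_pos (by positivity) (inv_re_pos hc)
    rw [h1, div_cpow_of_re_pos h3 ha, div_cpow_of_re_pos h2 hc, Real.sqrt_eq_rpow,
      Complex.ofReal_cpow (by positivity)]
    push_cast
    rw [Complex.cpow_neg, Complex.cpow_neg]
    ring
  rw [besselV, besselQuot, besselK, hint, hroot, mul_cpow_of_re_pos hc ha,
    show |1 / 2 - mu| + 1 / 2 = p + 1 by rw [hp]; ring]
  have hcexp : c ^ ((mu - 1 - p : ℝ) : ℂ) = c ^ ((-(1 / 2) : ℝ) : ℂ) * c ^ ((-p : ℝ) : ℂ)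
      / c ^ ((1 / 2 - mu : ℝ) : ℂ) := by
    rw [← Complex.cpow_add _ _ hc0, ← Complex.cpow_sub _ _ hc0]
    congr 1
    push_cast
    ring
  have haexp : a ^ ((-mu : ℝ) : ℂ) = a ^ ((1 - 2 * mu : ℝ) : ℂ) * a ^ ((-(1 / 2) : ℝ) : ℂ)
      / a ^ ((1 / 2 - mu : ℝ) : ℂ) := by
    rw [← Complex.cpow_add _ _ ha0, ← Complex.cpow_sub _ _ ha0]
    congr 1
    push_cast
    ring
  rw [hcexp, haexp]
  ring

/-- The form that meets the integrals over the cut. For `μ ≤ 1/2` it is a rotation of the ray, for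
`μ ≥ 1/2` the symmetry of `K`. -/
theorem besselV_eq_besselPsi {mu : ℝ} (h1 : mu < 1) {c a : ℂ} (hc : 0 < c.re)
    (ha : 0 < a.re) : besselV mu c a = Real.sqrt (π / 2) / Real.Gamma (1 - mu) *
      (a ^ ((-mu : ℝ) : ℂ) * Complex.exp (-(c * a)) * besselPsi (-mu) c a⁻¹) := by
  have hb := (inv_re_pos ha).le
  rcases le_total mu (1 / 2) with h | h
  · rw [besselV_eq_besselPhi_aux mu hc ha (p := -mu) (by rw [abs_of_nonneg (by linarith)]; ring),
      besselPsi_eq (by linarith) hc hb, show -mu + 1 = 1 - mu by ring,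
      show mu - 1 - -mu = -(2 * -mu + 1) by ring]
    ring
  · have hG1 : (Real.Gamma mu : ℂ) ≠ 0 :=
      Complex.ofReal_ne_zero.2 (Real.Gamma_pos_of_pos (by linarith)).ne'
    have hG2 : (Real.Gamma (1 - mu) : ℂ) ≠ 0 :=
      Complex.ofReal_ne_zero.2 (Real.Gamma_pos_of_pos (by linarith)).ne'
    have hsym := gamma_mul_besselPhi (mu := 1 - mu) (by linarith) (by linarith) hc hb
    rw [show -(1 - mu) = mu - 1 by ring, show 1 - (1 - mu) = mu by ring,
      show 1 - mu - 1 = -mu by ring] at hsym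
    rw [besselV_eq_besselPhi_aux mu hc ha (p := mu - 1) (by rw [abs_of_nonpos (by linarith)]; ring),
      sub_self, Complex.ofReal_zero, Complex.cpow_zero, sub_add_cancel]
    generalize a⁻¹ = b at hsym ⊢
    field_simp
    linear_combination a ^ ((-mu : ℝ) : ℂ) * hsym

/-- The form that holds for all `μ > 0` and can therefore be differentiated along the ladder. -/
theorem besselV_eq_besselPhi {mu : ℝ} (h0 : 0 < mu) {c a : ℂ} (hc : 0 < c.re)
    (ha : 0 < a.re) : besselV mu c a = Real.sqrt (π / 2) / Real.Gamma mu *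
      (a ^ ((-mu : ℝ) : ℂ) * Complex.exp (-(c * a)) * besselPhi (mu - 1) c a⁻¹) := by
  have hb := (inv_re_pos ha).le
  rcases le_total mu (1 / 2) with h | h
  · have hG1 : (Real.Gamma mu : ℂ) ≠ 0 :=
      Complex.ofReal_ne_zero.2 (Real.Gamma_pos_of_pos (by linarith)).ne'
    have hG2 : (Real.Gamma (1 - mu) : ℂ) ≠ 0 :=
      Complex.ofReal_ne_zero.2 (Real.Gamma_pos_of_pos (by linarith)).ne'
    have hsym := gamma_mul_besselPhi (mu := 1 - mu) (by linarith) (by linarith) hc hb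
    rw [show -(1 - mu) = mu - 1 by ring, show 1 - (1 - mu) = mu by ring,
      show 1 - mu - 1 = -mu by ring] at hsym
    rw [besselV_eq_besselPsi (by linarith) hc ha]
    generalize a⁻¹ = b at hsym ⊢
    field_simp
    linear_combination (-a ^ ((-mu : ℝ) : ℂ)) * hsym
  · rw [besselV_eq_besselPhi_aux mu hc ha (p := mu - 1) (by rw [abs_of_nonpos (by linarith)]; ring),
      sub_self, Complex.ofReal_zero, Complex.cpow_zero, sub_add_cancel]
    ring

/-- An integration by parts. It expresses the integral at `p + 1` by the integral at `p` and its
derivative in `b`, which appears as the last integral. -/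
theorem besselPhi_recurrence {p : ℝ} (hp : -1 < p) {c b : ℂ} (hc : 0 < c.re) (hb : 0 < b.re) :
    besselPhi (p + 1) c b / (p + 1) = ((p + 1) * b + c) * besselPhi p c b
      + b ^ 2 * ∫ t in Set.Ioi (0 : ℝ), ((Real.exp (-t) * t ^ p : ℝ) : ℂ) *
        (p * (c + t * b / 2) ^ ((p : ℂ) - 1) * (t / 2)) := by
  have hp1 : (p : ℂ) + 1 ≠ 0 := by
    rw [← Complex.ofReal_one, ← Complex.ofReal_add]
    exact Complex.ofReal_ne_zero.2 (by linarith)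
  set E : ℝ → ℝ → ℂ := fun s t => ((Real.exp (-t) * t ^ s : ℝ) : ℂ) with hE
  set w : ℝ → ℂ := fun t => c + t * b / 2 with hw
  have hslit : ∀ t : ℝ, 0 ≤ t → w t ∈ Complex.slitPlane := fun t ht =>
    mem_slitPlane_of_re_pos (hc.trans_le (re_add_mul_div_two hb.le ht))
  -- The derivative of `G` is the difference of the integrands of the two sides; `G` vanishes at `0`
  -- by the factor `t^(p+1)` and at infinity by `e^{-t}`.
  set G : ℝ → ℂ := fun t => -(E (p + 1) t * w t ^ ((p + 1 : ℝ) : ℂ) / (p + 1)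
    + b * (E (p + 1) t * w t ^ (p : ℂ))) with hG
  have hi1 : IntegrableOn (fun t => E (p + 1) t * w t ^ ((p + 1 : ℝ) : ℂ)) (Set.Ioi 0) :=
    integrableOn_besselPhi (by linarith) _ hc hb.le
  have hi2 : IntegrableOn (fun t => E p t * w t ^ (p : ℂ)) (Set.Ioi 0) :=
    integrableOn_besselPhi hp _ hc hb.le
  have hEt : ∀ t ∈ Set.Ioi (0 : ℝ), E (p + 1) t = E p t * t := by
    intro t ht
    simp only [hE]
    rw [Real.rpow_add_one (ne_of_gt ht)]
    push_cast; ring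
  have hi3 : IntegrableOn (fun t : ℝ => E p t * (p * w t ^ ((p : ℂ) - 1) * (t / 2))) (Set.Ioi 0) := by
    have h := (integrableOn_besselPhi (p := p + 1) (by linarith) (p - 1) hc hb.le).const_mul (p / 2 : ℂ)
    refine IntegrableOn.congr_fun h (fun t ht => ?_) measurableSet_Ioi
    have := hEt t ht
    simp only [hE] at this
    rw [this]
    push_cast
    simp only [hE, hw]
    push_cast
    ring
  have hder : ∀ t ∈ Set.Ioi (0 : ℝ), HasDerivAt G (E (p + 1) t * w t ^ ((p + 1 : ℝ) : ℂ) / (p + 1)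
      - ((p + 1) * b + c) * (E p t * w t ^ (p : ℂ))
      - b ^ 2 * (E p t * (p * w t ^ ((p : ℂ) - 1) * (t / 2)))) t := by
    intro t ht
    have ht0 : (0 : ℝ) < t := ht
    have hE' : HasDerivAt (E (p + 1)) (-E (p + 1) t + (p + 1) * E p t) t := by
      have h1 : HasDerivAt (fun t : ℝ => Real.exp (-t) * t ^ (p + 1))
          (Real.exp (-t) * -1 * t ^ (p + 1) + Real.exp (-t) * ((p + 1) * t ^ (p + 1 - 1))) t :=
        ((hasDerivAt_neg t).exp).mul (Real.hasDerivAt_rpow_const (Or.inl ht0.ne'))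
      refine h1.ofReal_comp.congr_deriv ?_
      rw [add_sub_cancel_right]
      simp only [hE]
      push_cast; ring
    have hw' : HasDerivAt w (b / 2) t := by
      have h1 : HasDerivAt (fun t : ℝ => (t : ℂ) * b / 2) (1 * b / 2) t :=
        ((hasDerivAt_id t).ofReal_comp.mul_const b).div_const 2
      have h2 := h1.const_add c
      rw [one_mul] at h2
      exact h2
    have hpow : ∀ s : ℂ, HasDerivAt (fun t => w t ^ s) (s * w t ^ (s - 1) * (b / 2)) t := by
      intro s
      have h0 : HasDerivAt (fun z : ℂ => z ^ s) (s * w t ^ (s - 1)) (w t) := by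
        simpa using (hasDerivAt_id (w t)).cpow_const (c := s) (hslit t ht0.le)
      exact HasDerivAt.comp (h₂ := fun z : ℂ => z ^ s) t h0 hw'
    have h := (((hE'.mul (hpow ((p + 1 : ℝ) : ℂ))).div_const ((p : ℂ) + 1)).add
      ((hE'.mul (hpow (p : ℂ))).const_mul b)).neg
    refine h.congr_deriv ?_
    have hw0 := Complex.slitPlane_ne_zero (hslit t ht0.le)
    have e1 : w t ^ ((p + 1 : ℝ) : ℂ) = w t ^ ((p : ℂ) - 1) * w t * w t := by
      rw [show ((p + 1 : ℝ) : ℂ) = (p : ℂ) - 1 + 1 + 1 by push_cast; ring, Complex.cpow_add _ _ hw0,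
        Complex.cpow_add _ _ hw0, Complex.cpow_one]
    have e2 : w t ^ (p : ℂ) = w t ^ ((p : ℂ) - 1) * w t := by
      nth_rewrite 1 [show (p : ℂ) = (p : ℂ) - 1 + 1 by ring]
      rw [Complex.cpow_add _ _ hw0, Complex.cpow_one]
    have e3 : w t ^ (((p + 1 : ℝ) : ℂ) - 1) = w t ^ ((p : ℂ) - 1) * w t := by
      rw [← e2]; push_cast; ring_nf
    rw [e1, e2, e3, hEt t ht]
    generalize w t ^ ((p : ℂ) - 1) = W
    simp only [hw]
    push_cast
    field_simp
    ring
  have h00 : ∀ s t : ℝ, ContinuousAt (fun t => w t ^ (s : ℂ)) 0 := fun s _ =>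
    ContinuousAt.cpow (by fun_prop) continuousAt_const (hslit 0 le_rfl)
  have hEc : ContinuousAt (E (p + 1)) 0 := by
    refine Complex.continuous_ofReal.continuousAt.comp ?_
    exact (by fun_prop : ContinuousAt (fun t : ℝ => Real.exp (-t)) 0).mul
      (Real.continuousAt_rpow_const _ _ (Or.inr (by linarith)))
  have hGc : ContinuousAt G 0 :=
    (((hEc.mul (h00 (p + 1) 0)).div_const _).add (continuousAt_const.mul (hEc.mul (h00 p 0)))).neg
  have hG0 : G 0 = 0 := by
    have : E (p + 1) 0 = 0 := by
      simp only [hE]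
      rw [Real.zero_rpow (by linarith)]; simp
    simp [hG, this]
  have hlim : ∀ q : ℝ, Tendsto (fun t => E (p + 1) t * w t ^ (q : ℂ)) atTop (𝓝 0) := by
    intro q
    have h1 := (tendsto_rpow_mul_exp_neg_mul_atTop_nhds_zero (p + 1) (1 / 2) (by norm_num)).const_mul
      (((min 1 c.re)⁻¹ * max 1 ‖c‖) ^ |q| * (1 + 2 * |q| * ‖b‖) ^ |q|)
    rw [mul_zero] at h1
    refine squeeze_zero_norm' ?_ h1
    filter_upwards [eventually_gt_atTop 0] with t ht
    exact norm_besselPhi_integrand_le (lt_min one_pos hc) (min_le_left _ _) (le_max_left _ _)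
      (min_le_right _ _) (le_max_right _ _) hb.le le_rfl (p + 1) q ht
  have hGlim : Tendsto G atTop (𝓝 0) := by
    have := (((hlim (p + 1)).div_const ((p : ℂ) + 1)).add ((hlim p).const_mul b)).neg
    rw [zero_div, mul_zero, add_zero, neg_zero] at this
    exact this
  have hA : IntegrableOn (fun t => E (p + 1) t * w t ^ ((p + 1 : ℝ) : ℂ) / (p + 1)
      - ((p + 1) * b + c) * (E p t * w t ^ (p : ℂ))) (Set.Ioi 0) :=
    (hi1.div_const ((p : ℂ) + 1)).sub (hi2.const_mul ((p + 1) * b + c))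
  have hfin := integral_Ioi_of_hasDerivAt_of_tendsto hGc.continuousWithinAt hder
    (hA.sub (hi3.const_mul (b ^ 2))) hGlim
  rw [hG0, sub_zero, integral_sub hA (hi3.const_mul (b ^ 2)),
    integral_sub (hi1.div_const ((p : ℂ) + 1)) (hi2.const_mul ((p + 1) * b + c)),
    integral_div, integral_const_mul, integral_const_mul] at hfin
  rw [besselPhi, besselPhi]
  linear_combination hfin

/-- The classical relation `(z^{-ν} K_ν)' = -z^{-ν} K_{ν+1}` with `ν = μ - 1/2`. -/
theorem besselV_hasDerivAt {mu : ℝ} (hmu : 0 < mu) {c a : ℂ} (hc : 0 < c.re) (ha : 0 < a.re) :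
    HasDerivAt (besselV mu c) (-a * besselV (mu + 1) c a) a := by
  have ha0 := ne_zero_of_re_pos ha
  have hinv : HasDerivAt (fun a : ℂ => a⁻¹) (-(a ^ 2)⁻¹) a := hasDerivAt_inv ha0
  have hPhi := (besselPhi_hasDerivAt_right (p := mu - 1) (by linarith) hc (inv_re_pos ha)).comp a hinv
  have hrec := besselPhi_recurrence (p := mu - 1) (by linarith) hc (inv_re_pos ha)
  set D := ∫ t in Set.Ioi (0 : ℝ), ((Real.exp (-t) * t ^ (mu - 1) : ℝ) : ℂ) *
      (((mu - 1 : ℝ) : ℂ) * (c + t * a⁻¹ / 2) ^ (((mu - 1 : ℝ) : ℂ) - 1) * (t / 2)) with hD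
  have hpow : HasDerivAt (fun a : ℂ => a ^ ((-mu : ℝ) : ℂ))
      (((-mu : ℝ) : ℂ) * a ^ (((-mu : ℝ) : ℂ) - 1)) a := by
    simpa using (hasDerivAt_id a).cpow_const (c := ((-mu : ℝ) : ℂ)) (mem_slitPlane_of_re_pos ha)
  have hexp : HasDerivAt (fun a : ℂ => Complex.exp (-(c * a))) (Complex.exp (-(c * a)) * -(c * 1)) a :=
    (((hasDerivAt_id a).const_mul c).neg).cexp
  have h := ((hpow.mul hexp).mul hPhi).const_mul (Real.sqrt (π / 2) / Real.Gamma mu : ℂ)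
  have hev : besselV mu c =ᶠ[𝓝 a] fun a => (Real.sqrt (π / 2) / Real.Gamma mu : ℂ) *
      (a ^ ((-mu : ℝ) : ℂ) * Complex.exp (-(c * a)) * besselPhi (mu - 1) c a⁻¹) := by
    filter_upwards [isOpen_re_pos.mem_nhds ha] with z hz
    exact besselV_eq_besselPhi hmu hc hz
  refine (h.congr_of_eventuallyEq hev).congr_deriv ?_
  have hG : (Real.Gamma mu : ℂ) ≠ 0 := Complex.ofReal_ne_zero.2 (Real.Gamma_pos_of_pos hmu).ne'
  have hm : (mu : ℂ) ≠ 0 := Complex.ofReal_ne_zero.2 hmu.ne'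
  have e1 : a ^ (((-mu : ℝ) : ℂ) - 1) = a ^ ((-mu : ℝ) : ℂ) * a⁻¹ := by
    rw [Complex.cpow_sub _ _ ha0, Complex.cpow_one, div_eq_mul_inv]
  have e2 : a ^ ((-(mu + 1) : ℝ) : ℂ) = a ^ ((-mu : ℝ) : ℂ) * a⁻¹ := by
    rw [← e1]; push_cast; ring_nf
  have e3 : a * a⁻¹ = 1 := mul_inv_cancel₀ ha0
  have e4 : (a ^ 2)⁻¹ = a⁻¹ ^ 2 := (inv_pow a 2).symm
  rw [besselV_eq_besselPhi (mu := mu + 1) (by linarith) hc ha, Real.Gamma_add_one hmu.ne', e2,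
    show mu + 1 - 1 = mu - 1 + 1 by ring]
  simp only [Pi.mul_apply, Function.comp_apply]
  rw [e1, e4]
  have hrec' : besselPhi (mu - 1 + 1) c a⁻¹
      = mu * ((mu * a⁻¹ + c) * besselPhi (mu - 1) c a⁻¹ + a⁻¹ ^ 2 * D) := by
    have hcast : ((mu - 1 : ℝ) : ℂ) + 1 = mu := by push_cast; ring
    rw [hcast] at hrec
    rw [← hrec, mul_div_cancel₀ _ hm]
  rw [hrec']
  push_cast
  generalize besselPhi (mu - 1) c a⁻¹ = P
  generalize a⁻¹ = b at e3 ⊢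
  field_simp
  linear_combination (a ^ (-(mu : ℂ)) * ((mu * b + c) * P + b ^ 2 * D)) * e3

/-- `K_{1/2}` is elementary; this covers the value `μ = 0` excluded from the form by `besselPhi`. -/
theorem besselV_zero {c a : ℂ} (hc : 0 < c.re) (ha : 0 < a.re) :
    besselV 0 c a = Real.sqrt (π / 2) * Complex.exp (-(c * a)) * c⁻¹ := by
  rw [besselV_eq_besselPsi zero_lt_one hc ha]
  have h1 : besselPsi (-0) c a⁻¹ = c⁻¹ := by
    have h := integral_rpow_mul_cexp_neg_mul one_pos hc
    rw [Real.Gamma_one, Complex.ofReal_one, one_mul, Complex.ofReal_neg, Complex.ofReal_one,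
      Complex.cpow_neg_one] at h
    rw [← h]
    simp [besselPsi]
  rw [h1]
  simp
  ring

theorem besselV_differentiableOn {mu : ℝ} (hmu : 0 ≤ mu) {c : ℂ} (hc : 0 < c.re) :
    DifferentiableOn ℂ (besselV mu c) {a : ℂ | 0 < a.re} := by
  rcases hmu.eq_or_lt with rfl | h
  · have h1 : DifferentiableOn ℂ (fun a => (Real.sqrt (π / 2) : ℂ) * Complex.exp (-(c * a)) * c⁻¹)
      {a : ℂ | 0 < a.re} := by fun_prop
    exact h1.congr fun a ha => besselV_zero hc ha
  · exact fun a ha => (besselV_hasDerivAt h hc ha).differentiableAt.differentiableWithinAt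

theorem norm_besselV_le {mu : ℝ} (hmu : 0 ≤ mu) {r : ℝ} (hr : 0 < r) : ∃ (K : ℝ) (q : ℕ), 0 ≤ K ∧
    ∀ c a : ℂ, 1 ≤ c.re → 0 < a.re → r ≤ ‖a‖ →
      ‖besselV mu c a‖ ≤ K * ‖c‖ ^ q * Real.exp (-(c * a).re) := by
  rcases hmu.eq_or_lt with rfl | h
  · refine ⟨Real.sqrt (π / 2), 0, by positivity, fun c a hc ha _ => ?_⟩
    rw [besselV_zero (by linarith) ha, norm_mul, norm_mul, Complex.norm_real,
      Real.norm_of_nonneg (by positivity), Complex.norm_exp, norm_inv, pow_zero, mul_one, Complex.neg_re]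
    have h1 : 1 ≤ ‖c‖ := hc.trans ((le_abs_self _).trans (Complex.abs_re_le_norm c))
    exact mul_le_of_le_one_right (by positivity) (inv_le_one_of_one_le₀ h1)
  · set J := ∫ t in Set.Ioi (0 : ℝ), t ^ (mu - 1) * Real.exp (-(1 / 2) * t) with hJ
    have hJ0 : 0 ≤ J := setIntegral_nonneg measurableSet_Ioi fun t ht => by
      have : (0 : ℝ) < t := ht
      positivity
    have hG := Real.Gamma_pos_of_pos h
    set p := |mu - 1| with hp
    refine ⟨Real.sqrt (π / 2) / Real.Gamma mu * r ^ (-mu) * (1 + 2 * p * r⁻¹) ^ p * J, ⌈p⌉₊,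
      by positivity, fun c a hc ha hra => ?_⟩
    have ha0 := ne_zero_of_re_pos ha
    have h1 : 1 ≤ ‖c‖ := hc.trans ((le_abs_self _).trans (Complex.abs_re_le_norm c))
    have h2 := norm_besselPhi_le (p := mu - 1) (by linarith) hc (inv_re_pos ha).le (B := r⁻¹)
      (by rw [norm_inv]; exact inv_anti₀ hr hra)
    have h3 : ‖c‖ ^ p ≤ ‖c‖ ^ ⌈p⌉₊ := by
      rw [← Real.rpow_natCast]
      exact Real.rpow_le_rpow_of_exponent_le h1 (Nat.le_ceil p)
    have h4 : ‖a‖ ^ (-mu) ≤ r ^ (-mu) := Real.rpow_le_rpow_of_nonpos hr hra (by linarith)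
    rw [besselV_eq_besselPhi h (by linarith) ha, norm_mul, norm_mul, norm_mul, norm_div,
      Complex.norm_real, Complex.norm_real, Real.norm_of_nonneg hG.le,
      Real.norm_of_nonneg (by positivity), Complex.norm_cpow_real, Complex.norm_exp, Complex.neg_re]
    calc Real.sqrt (π / 2) / Real.Gamma mu * (‖a‖ ^ (-mu) * Real.exp (-(c * a).re) *
          ‖besselPhi (mu - 1) c a⁻¹‖)
        ≤ Real.sqrt (π / 2) / Real.Gamma mu * (r ^ (-mu) * Real.exp (-(c * a).re) *
          (‖c‖ ^ ⌈p⌉₊ * (1 + 2 * p * r⁻¹) ^ p * J)) := by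
          gcongr
          exact h2.trans (by gcongr)
      _ = _ := by ring

/-- Put `y = a + r`: then `y² - a² = 2ar (1 + r/(2a))`, and the integral becomes `besselPsi` with
exponent `-μ` and `b = a⁻¹`. -/
theorem integral_sq_sub_sq_mul_exp {mu : ℝ} (hmu : mu < 1) {a : ℝ} (ha : 0 < a) {c : ℂ}
    (hc : 0 < c.re) :
    IntegrableOn (fun y : ℝ => (((y ^ 2 - a ^ 2) ^ (-mu) : ℝ) : ℂ) * Complex.exp (-(c * y)))
      (Set.Ioi a) ∧
    ∫ y in Set.Ioi a, (((y ^ 2 - a ^ 2) ^ (-mu) : ℝ) : ℂ) * Complex.exp (-(c * y))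
      = (Real.sqrt π * 2 ^ (1 / 2 - mu) * (Real.Gamma (1 - mu) / π) : ℝ) * besselV mu c a := by
  set f : ℝ → ℂ := fun y => (((y ^ 2 - a ^ 2) ^ (-mu) : ℝ) : ℂ) * Complex.exp (-(c * y)) with hf
  have hare : 0 < (a : ℂ).re := by simpa using ha
  have hb : 0 ≤ ((a : ℂ)⁻¹).re := (inv_re_pos hare).le
  have hpre : (fun x : ℝ => x + a) ⁻¹' Set.Ioi a = Set.Ioi 0 := by
    rw [Set.preimage_add_const_Ioi, sub_self]
  have hmp := measurePreserving_add_right (volume : Measure ℝ) a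
  have hemb := measurableEmbedding_addRight a
  have hcongr : ∀ r ∈ Set.Ioi (0 : ℝ), f (r + a) = (((2 * a) ^ (-mu) : ℝ) : ℂ) * Complex.exp (-(c * a)) *
      (((r ^ (-mu) : ℝ) : ℂ) * Complex.exp (-(r * c)) * (1 + r * (a : ℂ)⁻¹ / 2) ^ ((-mu : ℝ) : ℂ)) := by
    intro r hr
    have hr0 : (0 : ℝ) < r := hr
    have h1 : (1 + r * (a : ℂ)⁻¹ / 2) = ((1 + r * a⁻¹ / 2 : ℝ) : ℂ) := by push_cast; rfl
    have h2 : (r + a) ^ 2 - a ^ 2 = (2 * a) * (r * (1 + r * a⁻¹ / 2)) := by field_simp; ring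
    have h3 : Complex.exp (-(c * ((r + a : ℝ) : ℂ))) = Complex.exp (-(c * a)) * Complex.exp (-(r * c)) := by
      rw [← Complex.exp_add]; push_cast; ring_nf
    simp only [hf]
    rw [h1, h2, h3, ← Complex.ofReal_cpow (by positivity), Real.mul_rpow (by positivity) (by positivity),
      Real.mul_rpow hr0.le (by positivity)]
    push_cast
    ring
  have hint := (integrableOn_besselPsi (p := -mu) (by linarith) hc hb).const_mul
    ((((2 * a) ^ (-mu) : ℝ) : ℂ) * Complex.exp (-(c * a)))
  constructor
  · rw [← hmp.integrableOn_comp_preimage hemb, hpre]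
    exact IntegrableOn.congr_fun hint (fun r hr => (hcongr r hr).symm) measurableSet_Ioi
  · rw [← hmp.setIntegral_preimage_emb hemb f, hpre, setIntegral_congr_fun measurableSet_Ioi hcongr,
      integral_const_mul, ← besselPsi, besselV_eq_besselPsi hmu hc hare, ← Complex.ofReal_cpow ha.le]
    have hG : (Real.Gamma (1 - mu) : ℂ) ≠ 0 :=
      Complex.ofReal_ne_zero.2 (Real.Gamma_pos_of_pos (by linarith)).ne'
    have hconst : Real.sqrt π * 2 ^ (1 / 2 - mu) * (Real.Gamma (1 - mu) / π) *
        (Real.sqrt (π / 2) / Real.Gamma (1 - mu)) * a ^ (-mu) = (2 * a) ^ (-mu) := by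
      have hG' := (Real.Gamma_pos_of_pos (show 0 < 1 - mu by linarith)).ne'
      rw [Real.mul_rpow two_pos.le ha.le, show (1 / 2 - mu) = 1 / 2 + -mu by ring,
        Real.rpow_add two_pos, ← Real.sqrt_eq_rpow, Real.sqrt_div pi_pos.le]
      have h2 : Real.sqrt 2 ≠ 0 := by positivity
      have h3 : Real.sqrt π * Real.sqrt π = π := Real.mul_self_sqrt pi_pos.le
      field_simp
      linear_combination h3
    rw [← hconst]
    push_cast
    ring

/-! ### The Bessel series `T`: convergence, analyticity, ladder and exponential smallness. -/

/-- The number `(2k+1)π + isλ`. -/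
noncomputable def besselC (lam s : ℝ) (k : ℕ) : ℂ := (2 * k + 1) * π + s * lam * Complex.I

theorem besselX_eq (lam s : ℝ) (a : ℂ) (k : ℕ) : besselX lam s a k = besselC lam s k * a := by
  rw [besselX, besselC]; ring

theorem besselC_re (lam s : ℝ) (k : ℕ) : (besselC lam s k).re = (2 * k + 1) * π := by
  simp [besselC]

theorem besselC_im (lam s : ℝ) (k : ℕ) : (besselC lam s k).im = s * lam := by
  simp [besselC]

theorem one_le_besselC_re (lam s : ℝ) (k : ℕ) : 1 ≤ (besselC lam s k).re := by
  rw [besselC_re]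
  have : (0 : ℝ) ≤ k := k.cast_nonneg
  nlinarith [pi_gt_three]

theorem besselC_re_pos (lam s : ℝ) (k : ℕ) : 0 < (besselC lam s k).re :=
  zero_lt_one.trans_le (one_le_besselC_re lam s k)

theorem norm_besselC_le {lam : ℝ} (hlam : 0 < lam) {s : ℝ} (hs : |s| = 1) (k : ℕ) :
    ‖besselC lam s k‖ ≤ (2 * π + lam) * (k + 1) := by
  have h := Complex.norm_le_abs_re_add_abs_im (besselC lam s k)
  have hk : (0 : ℝ) ≤ k := k.cast_nonneg
  have h1 : |(2 * (k : ℝ) + 1) * π| = (2 * k + 1) * π := abs_of_nonneg (by positivity)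
  have h2 : |s * lam| = lam := by rw [abs_mul, hs, one_mul, abs_of_pos hlam]
  rw [besselC_re, besselC_im, h1, h2] at h
  nlinarith [pi_pos]

theorem besselC_mul_re_ge {lam : ℝ} (hlam : 0 < lam) {s : ℝ} (hs : |s| = 1) (k : ℕ) (a : ℂ) :
    (2 * k + 1) * π * a.re - lam * |a.im| ≤ (besselC lam s k * a).re := by
  rw [Complex.mul_re, besselC_re, besselC_im]
  have h : s * lam * a.im ≤ lam * |a.im| := by
    refine (le_abs_self _).trans ?_
    rw [abs_mul, abs_mul, hs, one_mul, abs_of_pos hlam]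
  linarith

/-- The factor `√π 2^{1/2-μ} Γ(1-μ)/π` of the series of Bessel functions. -/
noncomputable def besselConst (mu : ℝ) : ℝ := Real.sqrt π * 2 ^ (1 / 2 - mu) * (Real.Gamma (1 - mu) / π)

theorem besselTerm_eq (lam mu : ℝ) (a : ℂ) (k : ℕ) : besselTerm lam mu a k = besselConst mu *
    (Complex.I * Complex.exp (-(π * mu * Complex.I)) * besselV mu (besselC lam 1 k) a
      - Complex.I * Complex.exp (π * mu * Complex.I) * besselV mu (besselC lam (-1) k) a) := by
  rw [besselTerm, besselX_eq, besselX_eq, besselV, besselV, besselConst]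
  ring

theorem norm_exp_mul_I_eq_one (x : ℝ) : ‖Complex.exp (x * Complex.I)‖ = 1 :=
  Complex.norm_exp_ofReal_mul_I x

theorem norm_besselTerm_le {lam : ℝ} (hlam : 0 < lam) {mu : ℝ} (hmu : 0 ≤ mu) {r : ℝ} (hr : 0 < r) :
    ∃ (K : ℝ) (q : ℕ), 0 ≤ K ∧ ∀ (a : ℂ) (k : ℕ), 0 < a.re → r ≤ ‖a‖ →
      ‖besselTerm lam mu a k‖ ≤ K * (k + 1) ^ q *
        Real.exp (-((2 * k + 1) * π * a.re - lam * |a.im|)) := by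
  obtain ⟨K, q, hK, hV⟩ := norm_besselV_le hmu hr
  refine ⟨|besselConst mu| * (2 * (K * (2 * π + lam) ^ q)), q, by positivity, fun a k ha hra => ?_⟩
  have hone : ∀ s : ℝ, |s| = 1 → ‖besselV mu (besselC lam s k) a‖ ≤ K * (2 * π + lam) ^ q *
      ((k + 1) ^ q * Real.exp (-((2 * k + 1) * π * a.re - lam * |a.im|))) := by
    intro s hs
    refine (hV _ a (one_le_besselC_re lam s k) ha hra).trans ?_
    have h1 : ‖besselC lam s k‖ ^ q ≤ ((2 * π + lam) * (k + 1)) ^ q :=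
      pow_le_pow_left₀ (norm_nonneg _) (norm_besselC_le hlam hs k) q
    have h2 : Real.exp (-(besselC lam s k * a).re) ≤
        Real.exp (-((2 * k + 1) * π * a.re - lam * |a.im|)) :=
      Real.exp_le_exp.2 (neg_le_neg (besselC_mul_re_ge hlam hs k a))
    rw [mul_pow] at h1
    calc K * ‖besselC lam s k‖ ^ q * Real.exp (-(besselC lam s k * a).re)
        ≤ K * ((2 * π + lam) ^ q * (k + 1) ^ q) *
          Real.exp (-((2 * k + 1) * π * a.re - lam * |a.im|)) := by gcongr
      _ = _ := by ring
  have e1 : ‖Complex.exp (-(π * mu * Complex.I))‖ = 1 := by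
    have := norm_exp_mul_I_eq_one (-(π * mu))
    rwa [show ((-(π * mu) : ℝ) : ℂ) * Complex.I = -(π * mu * Complex.I) by push_cast; ring] at this
  have e2 : ‖Complex.exp (π * mu * Complex.I)‖ = 1 := by
    have := norm_exp_mul_I_eq_one (π * mu)
    rwa [show ((π * mu : ℝ) : ℂ) * Complex.I = (π * mu * Complex.I) by push_cast; ring] at this
  rw [besselTerm_eq, norm_mul, Complex.norm_real, Real.norm_eq_abs]
  have h3 := norm_sub_le (Complex.I * Complex.exp (-(π * mu * Complex.I)) * besselV mu (besselC lam 1 k) a)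
    (Complex.I * Complex.exp (π * mu * Complex.I) * besselV mu (besselC lam (-1) k) a)
  rw [norm_mul, norm_mul, norm_mul, norm_mul, e1, e2, Complex.norm_I, one_mul, one_mul, one_mul] at h3
  have h4 := hone 1 (by simp)
  have h5 := hone (-1) (by simp)
  calc |besselConst mu| * _ ≤ |besselConst mu| * (2 * (K * (2 * π + lam) ^ q *
      ((k + 1) ^ q * Real.exp (-((2 * k + 1) * π * a.re - lam * |a.im|))))) := by
        gcongr
        linarith
    _ = _ := by ring

theorem summable_add_one_pow_mul_exp (q : ℕ) {d : ℝ} (hd : 0 < d) :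
    Summable fun k : ℕ => ((k : ℝ) + 1) ^ q * Real.exp (-d * k) := by
  have h := ((summable_nat_add_iff 1).2 (Real.summable_pow_mul_exp_neg_nat_mul q hd)).mul_left
    (Real.exp d)
  refine h.congr fun k => ?_
  push_cast
  rw [show -d * ((k : ℝ) + 1) = -d * k + -d by ring, Real.exp_add]
  have : Real.exp d * Real.exp (-d) = 1 := by rw [← Real.exp_add]; simp
  linear_combination (((k : ℝ) + 1) ^ q * Real.exp (-d * k)) * this

/-- The neighbourhood bounds `Re w` below, for geometric decay in `k`, and `|Im w|` above, to
control `e^{λ|Im w|}`. -/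
theorem besselTerm_locally_bounded {lam : ℝ} (hlam : 0 < lam) {mu : ℝ} (hmu : 0 ≤ mu) {a : ℂ}
    (ha : 0 < a.re) : ∃ (U : Set ℂ) (u : ℕ → ℝ), IsOpen U ∧ a ∈ U ∧ (∀ w ∈ U, 0 < w.re) ∧
      Summable u ∧ ∀ k, ∀ w ∈ U, ‖besselTerm lam mu w k‖ ≤ u k := by
  obtain ⟨K, q, hK, hb⟩ := norm_besselTerm_le hlam hmu (half_pos ha)
  refine ⟨{w : ℂ | a.re / 2 < w.re} ∩ {w : ℂ | |w.im| < |a.im| + 1},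
    fun k => K * Real.exp (lam * (|a.im| + 1)) * (((k : ℝ) + 1) ^ q * Real.exp (-(π * a.re) * k)),
    ?_, ⟨half_lt_self ha, show |a.im| < |a.im| + 1 from lt_add_one _⟩, fun w hw => (half_pos ha).trans hw.1,
    (summable_add_one_pow_mul_exp q (by positivity)).mul_left _, fun k w hw => ?_⟩
  · exact (isOpen_lt continuous_const Complex.continuous_re).inter
      (isOpen_lt Complex.continuous_im.abs continuous_const)
  · have h1 : a.re / 2 < w.re := hw.1
    have h2 : |w.im| < |a.im| + 1 := hw.2
    have hw0 : 0 < w.re := (half_pos ha).trans h1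
    refine (hb w k hw0 (h1.le.trans ((le_abs_self _).trans (Complex.abs_re_le_norm w)))).trans ?_
    have h3 : Real.exp (-((2 * k + 1) * π * w.re - lam * |w.im|)) ≤
        Real.exp (lam * (|a.im| + 1)) * Real.exp (-(π * a.re) * k) := by
      rw [← Real.exp_add]
      refine Real.exp_le_exp.2 ?_
      have hk : (0 : ℝ) ≤ k := k.cast_nonneg
      have h4 : 2 * k * π * (a.re / 2) ≤ (2 * k + 1) * π * w.re := by
        have := mul_le_mul_of_nonneg_left h1.le (show 0 ≤ 2 * (k : ℝ) * π by positivity)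
        have := mul_pos pi_pos hw0
        nlinarith
      nlinarith
    calc K * (k + 1) ^ q * Real.exp (-((2 * k + 1) * π * w.re - lam * |w.im|))
        ≤ K * (k + 1) ^ q * (Real.exp (lam * (|a.im| + 1)) * Real.exp (-(π * a.re) * k)) := by gcongr
      _ = _ := by ring

theorem summable_besselTerm {lam : ℝ} (hlam : 0 < lam) {mu : ℝ} (hmu : 0 ≤ mu) {a : ℂ}
    (ha : 0 < a.re) : Summable (besselTerm lam mu a) := by
  obtain ⟨U, u, -, haU, -, hu, hb⟩ := besselTerm_locally_bounded hlam hmu ha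
  exact Summable.of_norm_bounded hu fun k => hb k a haU

theorem besselTerm_differentiableOn (lam : ℝ) {mu : ℝ} (hmu : 0 ≤ mu) (k : ℕ) :
    DifferentiableOn ℂ (fun a => besselTerm lam mu a k) {a : ℂ | 0 < a.re} := by
  simp only [besselTerm_eq]
  have h1 := besselV_differentiableOn hmu (besselC_re_pos lam 1 k)
  have h2 := besselV_differentiableOn hmu (besselC_re_pos lam (-1) k)
  exact ((h1.const_mul _).sub (h2.const_mul _)).const_mul _

theorem mathieuT_differentiableOn {lam : ℝ} (hlam : 0 < lam) {mu : ℝ} (hmu : 0 ≤ mu) :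
    DifferentiableOn ℂ (mathieuT lam mu) {a : ℂ | 0 < a.re} := by
  intro a ha
  obtain ⟨U, u, hU, haU, hpos, hu, hb⟩ := besselTerm_locally_bounded hlam hmu ha
  exact ((Complex.differentiableOn_tsum_of_summable_norm hu
    (fun k => (besselTerm_differentiableOn lam hmu k).mono hpos) hU hb).differentiableAt
    (hU.mem_nhds haU)).differentiableWithinAt

theorem besselConst_add_one {mu : ℝ} (hmu : 0 < mu) :
    besselConst mu = -2 * mu * besselConst (mu + 1) := by
  rw [besselConst, besselConst, show 1 - mu = -mu + 1 by ring, Real.Gamma_add_one (by linarith),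
    show 1 - (mu + 1) = -mu by ring, show 1 / 2 - mu = (1 / 2 - (mu + 1)) + 1 by ring,
    Real.rpow_add_one two_ne_zero]
  ring

/-- The ladder for `T`. The minus sign from differentiating `besselV` is taken up by `e^{±πi(μ+1)} =
-e^{±πiμ}`, and the factor `-2μ` comes from `Γ(1-μ) = -μ Γ(-μ)`. -/
theorem mathieuT_hasDerivAt {lam : ℝ} (hlam : 0 < lam) {mu : ℝ} (hmu : 0 < mu) {a : ℂ}
    (ha : 0 < a.re) : HasDerivAt (mathieuT lam mu) (-2 * mu * a * mathieuT lam (mu + 1) a) a := by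
  have hterm : ∀ k, HasDerivAt (fun a => besselTerm lam mu a k)
      (-2 * mu * a * besselTerm lam (mu + 1) a k) a := by
    intro k
    have h1 := besselV_hasDerivAt hmu (besselC_re_pos lam 1 k) ha
    have h2 := besselV_hasDerivAt hmu (besselC_re_pos lam (-1) k) ha
    simp only [besselTerm_eq]
    refine (((h1.const_mul (Complex.I * Complex.exp (-(π * mu * Complex.I)))).sub
      (h2.const_mul (Complex.I * Complex.exp (π * mu * Complex.I)))).const_mul
      (besselConst mu : ℂ)).congr_deriv ?_
    have e1 : Complex.exp (-(π * (mu + 1 : ℝ) * Complex.I)) = -Complex.exp (-(π * mu * Complex.I)) := by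
      rw [show -(π * ((mu + 1 : ℝ) : ℂ) * Complex.I) = -(π * mu * Complex.I) - π * Complex.I by
        push_cast; ring, Complex.exp_sub_pi_mul_I]
    have e2 : Complex.exp (π * (mu + 1 : ℝ) * Complex.I) = -Complex.exp (π * mu * Complex.I) := by
      rw [show (π * ((mu + 1 : ℝ) : ℂ) * Complex.I) = π * mu * Complex.I + π * Complex.I by
        push_cast; ring, Complex.exp_add_pi_mul_I]
    rw [e1, e2, besselConst_add_one hmu]
    push_cast
    ring
  obtain ⟨U, u, hU, haU, hpos, hu, hb⟩ := besselTerm_locally_bounded hlam hmu.le ha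
  have hd := fun k => (besselTerm_differentiableOn lam hmu.le k).mono hpos
  have h1 := Complex.hasSum_deriv_of_summable_norm hu hd hU hb haU
  have h2 := (Complex.differentiableOn_tsum_of_summable_norm hu hd hU hb).differentiableAt
    (hU.mem_nhds haU)
  have h3 : HasSum (fun k => deriv (fun w => besselTerm lam mu w k) a)
      (-2 * mu * a * mathieuT lam (mu + 1) a) := by
    have := (summable_besselTerm hlam (show 0 ≤ mu + 1 by linarith) ha).hasSum.mul_left (-2 * mu * a)
    refine this.congr_fun ?_
    exact fun k => (hterm k).deriv
  rw [← h1.unique h3]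
  exact h2.hasDerivAt

/-- The leading exponent is at most `-(π cos φ - λ sin φ)|a|`, which is negative exactly when `tan φ
< π/λ`; this fixes the sector for `H`. -/
theorem mathieuT_isBigO {lam : ℝ} (hlam : 0 < lam) {mu : ℝ} (hmu : 0 ≤ mu) {φ : ℝ}
    (hφ : φ < Real.arctan (π / lam)) (M : ℝ) :
    mathieuT lam mu =O[inftyInSector φ] fun a : ℂ => ‖a‖ ^ M := by
  rcases lt_or_ge φ 0 with h0 | h0
  · exact isBigO_inftyInSector (C := 0) fun a _ h => absurd ((abs_nonneg _).trans h) (not_le.2 h0)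
  have hφ2 : φ < π / 2 := hφ.trans (Real.arctan_lt_pi_div_two _)
  have hcos : 0 < Real.cos φ := Real.cos_pos_of_mem_Ioo ⟨by linarith, hφ2⟩
  have htan : Real.tan φ < π / lam := by
    have := Real.tan_lt_tan_of_lt_of_lt_pi_div_two (by linarith) (Real.arctan_lt_pi_div_two _) hφ
    rwa [Real.tan_arctan] at this
  set d := π * Real.cos φ - lam * Real.sin φ with hd
  have hd0 : 0 < d := by
    rw [Real.tan_eq_sin_div_cos, div_lt_div_iff₀ hcos hlam] at htan
    linarith
  obtain ⟨K, q, hK, hb⟩ := norm_besselTerm_le hlam hmu one_pos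
  have hsum := summable_add_one_pow_mul_exp q (d := 2 * π * Real.cos φ) (by positivity)
  set J := ∑' k : ℕ, ((k : ℝ) + 1) ^ q * Real.exp (-(2 * π * Real.cos φ) * k) with hJ
  have hT : ∀ a : ℂ, 1 ≤ ‖a‖ → |Complex.arg a| ≤ φ → ‖mathieuT lam mu a‖ ≤ K * J * Real.exp (-d * ‖a‖) := by
    intro a ha1 ha2
    have hre := norm_mul_cos_le_re hφ2 ha2
    have hre0 : 0 < a.re := lt_of_lt_of_le (by positivity) hre
    have him : |a.im| ≤ ‖a‖ * Real.sin φ := by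
      rw [← Complex.norm_mul_sin_arg a, abs_mul, abs_norm]
      refine mul_le_mul_of_nonneg_left ?_ (norm_nonneg _)
      rw [Real.abs_sin_eq_sin_abs_of_abs_le_pi (Complex.abs_arg_le_pi a)]
      exact Real.sin_le_sin_of_le_of_le_pi_div_two (by linarith [abs_nonneg (Complex.arg a), pi_pos]) hφ2.le ha2
    have hterm : ∀ k : ℕ, ‖besselTerm lam mu a k‖ ≤ K * Real.exp (-d * ‖a‖) *
        (((k : ℝ) + 1) ^ q * Real.exp (-(2 * π * Real.cos φ) * k)) := by
      intro k
      refine (hb a k hre0 ha1).trans ?_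
      have h3 : Real.exp (-((2 * k + 1) * π * a.re - lam * |a.im|)) ≤
          Real.exp (-d * ‖a‖) * Real.exp (-(2 * π * Real.cos φ) * k) := by
        rw [← Real.exp_add]
        refine Real.exp_le_exp.2 ?_
        have hk : (0 : ℝ) ≤ k := k.cast_nonneg
        have h4 : π * (‖a‖ * Real.cos φ) ≤ π * a.re := mul_le_mul_of_nonneg_left hre pi_pos.le
        have h5 : lam * |a.im| ≤ lam * (‖a‖ * Real.sin φ) := mul_le_mul_of_nonneg_left him hlam.le
        have h6 : 2 * k * π * (1 * Real.cos φ) ≤ 2 * k * π * a.re :=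
          mul_le_mul_of_nonneg_left ((mul_le_mul_of_nonneg_right ha1 hcos.le).trans hre) (by positivity)
        rw [hd]
        nlinarith
      calc K * (k + 1) ^ q * Real.exp (-((2 * k + 1) * π * a.re - lam * |a.im|))
          ≤ K * (k + 1) ^ q * (Real.exp (-d * ‖a‖) * Real.exp (-(2 * π * Real.cos φ) * k)) := by gcongr
        _ = _ := by ring
    have h := tsum_of_norm_bounded (hsum.mul_left (K * Real.exp (-d * ‖a‖))).hasSum hterm
    rw [tsum_mul_left] at h
    rw [mathieuT]
    refine h.trans (le_of_eq ?_)
    rw [← hJ]; ring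
  have hJ0 : 0 ≤ J := tsum_nonneg fun k => by positivity
  have h1 : mathieuT lam mu =O[inftyInSector φ] fun a : ℂ => Real.exp (-d * ‖a‖) :=
    isBigO_inftyInSector (C := K * J) hT
  have h2 : (fun x : ℝ => Real.exp (-d * x)) =O[atTop] fun x : ℝ => x ^ M :=
    (isLittleO_exp_neg_mul_rpow_atTop hd0 M).isBigO
  have h3 : Tendsto (fun a : ℂ => ‖a‖) (inftyInSector φ) atTop :=
    tendsto_norm_cobounded_atTop.mono_left inf_le_left
  exact h1.trans (h2.comp_tendsto h3)

/-! ### Abel–Plana for `e^{-λz} (z² + a²)^{-μ}` with `a > 0` and `μ < 1`. -/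

theorem integrable_abs_rpow_mul_exp_neg {mu : ℝ} (hmu : mu < 1) :
    Integrable fun u : ℝ => |u| ^ (-mu) * Real.exp (-2 * |u|) := by
  have h0 := integrableOn_rpow_mul_exp_neg_mul (p := -mu) (r := 2) (by linarith) two_pos
  have h1 : IntegrableOn (fun u : ℝ => |u| ^ (-mu) * Real.exp (-2 * |u|)) (Set.Ioi 0) :=
    h0.congr_fun (fun y hy => by simp only [abs_of_pos (show (0 : ℝ) < y from hy)]) measurableSet_Ioi
  have h2 : IntegrableOn (fun u : ℝ => |u| ^ (-mu) * Real.exp (-2 * |u|)) (Set.Iic 0) := by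
    rw [integrableOn_Iic_iff_integrableOn_Iio]
    have := h1.comp_neg
    rw [Set.neg_Ioi, neg_zero] at this
    simpa only [abs_neg] using this
  have := h2.union h1
  rwa [Set.Iic_union_Ioi, integrableOn_univ] at this

/-- Separates the singularities at `±a`: on either half-line the factor belonging to the far branch
point is at least `a`. -/
theorem abs_sq_sub_sq_rpow_mul_exp_le {mu : ℝ} (hmu : 0 ≤ mu) {a : ℝ} (ha : 0 < a) {y : ℝ}
    (hy1 : y ≠ a) (hy2 : y ≠ -a) :
    |y ^ 2 - a ^ 2| ^ (-mu) * Real.exp (-2 * |y|) ≤ a ^ (-mu) * Real.exp (2 * a) *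
      (|y - a| ^ (-mu) * Real.exp (-2 * |y - a|) + |y + a| ^ (-mu) * Real.exp (-2 * |y + a|)) := by
  have h1 : 0 < |y - a| := abs_pos.2 (sub_ne_zero.2 hy1)
  have h2 : 0 < |y + a| := abs_pos.2 (by intro h; exact hy2 (by linarith))
  have hfac : |y ^ 2 - a ^ 2| ^ (-mu) = |y - a| ^ (-mu) * |y + a| ^ (-mu) := by
    rw [← Real.mul_rpow h1.le h2.le, ← abs_mul]
    ring_nf
  have e1 : Real.exp (-2 * |y|) ≤ Real.exp (2 * a) * Real.exp (-2 * |y - a|) := by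
    rw [← Real.exp_add]
    refine Real.exp_le_exp.2 ?_
    have := abs_sub y a
    rw [abs_of_pos ha] at this
    linarith
  have e2 : Real.exp (-2 * |y|) ≤ Real.exp (2 * a) * Real.exp (-2 * |y + a|) := by
    rw [← Real.exp_add]
    refine Real.exp_le_exp.2 ?_
    have := abs_add_le y a
    rw [abs_of_pos ha] at this
    linarith
  rw [hfac, mul_add]
  rcases le_total 0 y with h | h
  · have h3 : |y + a| ^ (-mu) ≤ a ^ (-mu) :=
      Real.rpow_le_rpow_of_nonpos ha (by rw [abs_of_nonneg (by linarith)]; linarith) (by linarith)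
    refine le_add_of_le_of_nonneg ?_ (by positivity)
    calc |y - a| ^ (-mu) * |y + a| ^ (-mu) * Real.exp (-2 * |y|)
        ≤ |y - a| ^ (-mu) * a ^ (-mu) * (Real.exp (2 * a) * Real.exp (-2 * |y - a|)) := by gcongr
      _ = _ := by ring
  · have h3 : |y - a| ^ (-mu) ≤ a ^ (-mu) :=
      Real.rpow_le_rpow_of_nonpos ha (by rw [abs_of_nonpos (by linarith)]; linarith) (by linarith)
    refine le_add_of_nonneg_of_le (by positivity) ?_
    calc |y - a| ^ (-mu) * |y + a| ^ (-mu) * Real.exp (-2 * |y|)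
        ≤ a ^ (-mu) * |y + a| ^ (-mu) * (Real.exp (2 * a) * Real.exp (-2 * |y + a|)) := by gcongr
      _ = _ := by ring

/-- The function `e^{-λz} (z² + a²)^{-μ}`. -/
noncomputable def expQuot (lam mu a : ℝ) (z : ℂ) : ℂ :=
  Complex.exp (-(lam * z)) / (z ^ 2 + (a : ℂ) ^ 2) ^ (mu : ℂ)

theorem norm_expQuot (lam mu a : ℝ) (z : ℂ) :
    ‖expQuot lam mu a z‖ = Real.exp (-lam * z.re) / ‖z ^ 2 + (a : ℂ) ^ 2‖ ^ mu := by
  rw [expQuot, norm_div, Complex.norm_exp, Complex.norm_cpow_real]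
  simp

theorem differentiableAt_expQuot (lam mu a : ℝ) {z : ℂ} (hz : z ^ 2 + (a : ℂ) ^ 2 ∈ Complex.slitPlane) :
    DifferentiableAt ℂ (expQuot lam mu a) z := by
  have h1 : DifferentiableAt ℂ (fun z : ℂ => (z ^ 2 + (a : ℂ) ^ 2) ^ (mu : ℂ)) z :=
    DifferentiableAt.cpow_const (by fun_prop) hz
  exact DifferentiableAt.div (by fun_prop) h1 (by
    rw [Complex.cpow_ne_zero_iff]; exact Or.inl (Complex.slitPlane_ne_zero hz))

theorem norm_expQuot_le {lam mu : ℝ} (hmu : 0 ≤ mu) (a : ℝ) {δ : ℝ} (hδ : 0 < δ) {z : ℂ} (hz : δ ≤ z.re) :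
    ‖expQuot lam mu a z‖ ≤ Real.exp (-lam * z.re) / (δ ^ 2) ^ mu := by
  rw [norm_expQuot]
  have h := re_sq_le_norm_sq_add_sq a (hδ.trans_le hz)
  rw [add_comm] at h
  have h2 : δ ^ 2 ≤ z.re ^ 2 := by gcongr
  have h3 := h2.trans h
  gcongr

theorem abs_sq_sub_sq_le_norm_sq_add_sq (a x y : ℝ) :
    |y ^ 2 - a ^ 2| ≤ ‖((x : ℂ) + y * Complex.I) ^ 2 + (a : ℂ) ^ 2‖ := by
  refine abs_le_of_sq_le_sq ?_ (norm_nonneg _)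
  rw [← Complex.normSq_eq_norm_sq, Complex.normSq_apply]
  have h1 : (((x : ℂ) + y * Complex.I) ^ 2 + (a : ℂ) ^ 2).re = x ^ 2 - y ^ 2 + a ^ 2 := by
    simp [pow_two]
  have h2 : (((x : ℂ) + y * Complex.I) ^ 2 + (a : ℂ) ^ 2).im = 2 * x * y := by
    simp [pow_two]; ring
  rw [h1, h2]
  nlinarith [sq_nonneg (x ^ 2), sq_nonneg (x * a), sq_nonneg (x * y)]

/-- Mean value inequality on a compact convex rectangle that avoids the branch points. -/
theorem exists_norm_expQuot_sub_le (lam mu : ℝ) {a : ℝ} (ha : 0 < a) : ∃ M : ℝ, 0 ≤ M ∧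
    ∀ z : ℂ, 0 ≤ z.re → z.re ≤ 1 / 4 → |z.im| ≤ a / 2 →
      ‖expQuot lam mu a z - expQuot lam mu a 0‖ ≤ M * ‖z‖ := by
  set K : Set ℂ := Set.Icc 0 (1 / 4) ×ℂ Set.Icc (-(a / 2)) (a / 2) with hK
  have hKc : IsCompact K := isCompact_Icc.reProdIm isCompact_Icc
  have hKconv : Convex ℝ K := by
    have h1 : Convex ℝ (Complex.reLm ⁻¹' Set.Icc (0 : ℝ) (1 / 4)) := (convex_Icc _ _).linear_preimage _
    have h2 : Convex ℝ (Complex.imLm ⁻¹' Set.Icc (-(a / 2)) (a / 2)) := (convex_Icc _ _).linear_preimage _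
    exact h1.inter h2
  have hO : IsOpen {z : ℂ | z ^ 2 + (a : ℂ) ^ 2 ∈ Complex.slitPlane} :=
    Complex.isOpen_slitPlane.preimage (by fun_prop)
  have hKO : K ⊆ {z : ℂ | z ^ 2 + (a : ℂ) ^ 2 ∈ Complex.slitPlane} := by
    intro z hz
    have h2 : z.im ∈ Set.Icc (-(a / 2)) (a / 2) := hz.2
    have h3 : z.im ^ 2 ≤ (a / 2) ^ 2 := by nlinarith [h2.1, h2.2]
    left
    have : (z ^ 2 + (a : ℂ) ^ 2).re = z.re ^ 2 - z.im ^ 2 + a ^ 2 := by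
      simp [pow_two]
    rw [this]
    nlinarith [sq_nonneg z.re, pow_pos ha 2]
  have hd : DifferentiableOn ℂ (expQuot lam mu a) {z : ℂ | z ^ 2 + (a : ℂ) ^ 2 ∈ Complex.slitPlane} :=
    fun z hz => (differentiableAt_expQuot lam mu a hz).differentiableWithinAt
  obtain ⟨C, hC⟩ := hKc.exists_bound_of_continuousOn ((hd.deriv hO).continuousOn.mono hKO)
  have h0 : (0 : ℂ) ∈ K := by
    refine ⟨⟨by simp, by norm_num⟩, ?_, ?_⟩ <;> simp <;> linarith
  refine ⟨C, (norm_nonneg _).trans (hC 0 h0), fun z h1 h2 h3 => ?_⟩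
  have := Convex.norm_image_sub_le_of_norm_deriv_le
    (fun w hw => differentiableAt_expQuot lam mu a (hKO hw)) hC hKconv h0
    (show z ∈ K from ⟨⟨h1, h2⟩, abs_le.1 h3⟩)
  rwa [sub_zero] at this

/-- Near the origin, `|y| ≤ a/2`, the difference is `O(|z|)` and cancels the zero of the sine.
Beyond that the sine is at least `(a/4) e^{2|y|}`, and only the branch-point singularities remain,
integrable because `μ < 1`. -/
theorem exists_expQuot_dominated {lam mu : ℝ} (hlam : 0 < lam) (hmu : 0 ≤ mu) (hmu1 : mu < 1) {a : ℝ}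
    (ha : 0 < a) : ∃ b : ℝ → ℝ, Integrable b ∧ ∀ y : ℝ, y ≠ a → y ≠ -a → ∀ x : ℝ, 0 < x → x ≤ 1 / 4 →
      ‖expQuot lam mu a (x + y * Complex.I) - expQuot lam mu a 0‖ ≤
        b y * ‖Complex.sin (π * (x + y * Complex.I))‖ := by
  obtain ⟨M, hM0, hM⟩ := exists_norm_expQuot_sub_le lam mu ha
  set p : ℝ → ℝ := fun u => |u| ^ (-mu) * Real.exp (-2 * |u|) with hp
  have hpi : Integrable p := integrable_abs_rpow_mul_exp_neg hmu1
  have hp0 : ∀ u, 0 ≤ p u := fun u => by positivity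
  set C := a ^ (-mu) * Real.exp (2 * a) with hC
  refine ⟨fun y => (4 * M + 4 / a * (a ^ 2) ^ (-mu)) * Real.exp (-2 * |y|) +
    4 / a * C * (p (y - a) + p (y + a)), ?_, fun y hy1 hy2 x hx hx4 => ?_⟩
  · exact ((integrable_exp_neg_mul_abs two_pos).const_mul _).add
      (((hpi.comp_sub_right a).add (hpi.comp_add_right a)).const_mul _)
  set z : ℂ := x + y * Complex.I with hz
  have hre : z.re = x := by simp [hz]
  have him : z.im = y := by simp [hz]
  have hs0 : 0 ≤ ‖Complex.sin (π * z)‖ := norm_nonneg _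
  have hee : Real.exp (-2 * |y|) * Real.exp (2 * |y|) = 1 := by rw [← Real.exp_add]; simp
  rcases le_or_gt |y| (a / 2) with h | h
  · have h1 := hM z (by rw [hre]; exact hx.le) (by rw [hre]; exact hx4) (by rw [him]; exact h)
    have h2 := norm_mul_exp_le_norm_sin_pi_mul (z := z) (by rw [hre]; exact hx.le)
      (by rw [hre]; linarith)
    rw [him] at h2
    have h3 : ‖z‖ ≤ 4 * Real.exp (-2 * |y|) * ‖Complex.sin (π * z)‖ := by
      calc ‖z‖ = Real.exp (-2 * |y|) * (‖z‖ * Real.exp (2 * |y|)) := by linear_combination (-‖z‖) * hee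
        _ ≤ Real.exp (-2 * |y|) * (4 * ‖Complex.sin (π * z)‖) := by gcongr
        _ = _ := by ring
    refine h1.trans ((mul_le_mul_of_nonneg_left h3 hM0).trans ?_)
    rw [show M * (4 * Real.exp (-2 * |y|) * ‖Complex.sin (π * z)‖) =
      4 * M * Real.exp (-2 * |y|) * ‖Complex.sin (π * z)‖ by ring]
    refine mul_le_mul_of_nonneg_right ?_ hs0
    have h4 : 0 ≤ 4 / a * (a ^ 2) ^ (-mu) * Real.exp (-2 * |y|) := by positivity
    have h5 : 0 ≤ 4 / a * C * (p (y - a) + p (y + a)) :=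
      mul_nonneg (by positivity) (add_nonneg (hp0 _) (hp0 _))
    linarith
  · have hy2a : 0 < |y ^ 2 - a ^ 2| := by
      rw [abs_pos, sq_sub_sq]
      exact mul_ne_zero (fun h => hy2 (by linarith)) (sub_ne_zero.2 hy1)
    have h1 : ‖expQuot lam mu a z‖ ≤ |y ^ 2 - a ^ 2| ^ (-mu) := by
      rw [norm_expQuot, Real.rpow_neg hy2a.le, ← one_div]
      have := abs_sq_sub_sq_le_norm_sq_add_sq a x y
      rw [hre]
      have h2 : Real.exp (-lam * x) ≤ 1 := Real.exp_le_one_iff.2 (by nlinarith)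
      gcongr
    have h2 : ‖expQuot lam mu a 0‖ = (a ^ 2) ^ (-mu) := by
      rw [norm_expQuot, Real.rpow_neg (by positivity)]
      simp
    have h3 : 1 ≤ 4 / a * Real.exp (-2 * |y|) * ‖Complex.sin (π * z)‖ := by
      have h4 := abs_mul_exp_le_norm_sin_pi_mul z
      rw [him] at h4
      have h5 : a / 2 * Real.exp (2 * |y|) ≤ 2 * ‖Complex.sin (π * z)‖ :=
        (mul_le_mul_of_nonneg_right h.le (Real.exp_pos _).le).trans h4
      calc (1 : ℝ) = 2 / a * Real.exp (-2 * |y|) * (a / 2 * Real.exp (2 * |y|)) := by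
            rw [show 2 / a * Real.exp (-2 * |y|) * (a / 2 * Real.exp (2 * |y|)) =
              (Real.exp (-2 * |y|) * Real.exp (2 * |y|)) * (2 / a * (a / 2)) by ring, hee]
            field_simp
        _ ≤ 2 / a * Real.exp (-2 * |y|) * (2 * ‖Complex.sin (π * z)‖) := by gcongr
        _ = _ := by ring
    have h4 := abs_sq_sub_sq_rpow_mul_exp_le hmu ha hy1 hy2
    set A := |y ^ 2 - a ^ 2| ^ (-mu) with hA
    have hA0 : 0 ≤ A := by positivity
    have hB0 : 0 ≤ (a ^ 2) ^ (-mu) := by positivity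
    have h5 : ‖expQuot lam mu a z - expQuot lam mu a 0‖ ≤ A + (a ^ 2) ^ (-mu) :=
      (norm_sub_le _ _).trans (add_le_add h1 h2.le)
    calc _ ≤ (A + (a ^ 2) ^ (-mu)) * 1 := by rw [mul_one]; exact h5
      _ ≤ (A + (a ^ 2) ^ (-mu)) * (4 / a * Real.exp (-2 * |y|) * ‖Complex.sin (π * z)‖) := by gcongr
      _ = (4 / a * (a ^ 2) ^ (-mu) * Real.exp (-2 * |y|) + 4 / a * (A * Real.exp (-2 * |y|))) *
          ‖Complex.sin (π * z)‖ := by ring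
      _ ≤ _ := by
        refine mul_le_mul_of_nonneg_right ?_ hs0
        have h6 := mul_le_mul_of_nonneg_left h4 (show 0 ≤ 4 / a by positivity)
        have h7 : 0 ≤ 4 * M * Real.exp (-2 * |y|) := by positivity
        simp only [hp]
        linarith

/-- The boundary values of `e^{-λz} (z² + a²)^{-μ}` on the imaginary axis, from the right. -/
noncomputable def expQuotBoundary (lam mu a y : ℝ) : ℂ :=
  Complex.exp (-(lam * (y * Complex.I))) *
    if |y| < a then (((a ^ 2 - y ^ 2) ^ (-mu) : ℝ) : ℂ)
    else (((y ^ 2 - a ^ 2) ^ (-mu) : ℝ) : ℂ) * Complex.exp (-(SignType.sign y * (π * mu * Complex.I)))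

/-- At `x + iy` the imaginary part of `z² + a²` is `2xy`, so for `|y| > a` the negative axis is
approached from the side given by the sign of `y`. -/
theorem tendsto_expQuot (lam mu : ℝ) {a : ℝ} (ha : 0 < a) {y : ℝ} (hy1 : y ≠ a) (hy2 : y ≠ -a) :
    Tendsto (fun x : ℝ => expQuot lam mu a (x + y * Complex.I)) (𝓝[>] 0)
      (𝓝 (expQuotBoundary lam mu a y)) := by
  have hD : Tendsto (fun x : ℝ => ((x : ℂ) + y * Complex.I) ^ 2 + (a : ℂ) ^ 2) (𝓝[>] 0)
      (𝓝 ((a ^ 2 - y ^ 2 : ℝ) : ℂ)) := by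
    have h : Continuous fun x : ℝ => ((x : ℂ) + y * Complex.I) ^ 2 + (a : ℂ) ^ 2 := by fun_prop
    have h1 := (h.tendsto 0).mono_left (nhdsWithin_le_nhds (s := Set.Ioi 0))
    convert h1 using 2
    push_cast
    rw [zero_add, mul_pow, Complex.I_sq]
    ring
  have hE : Tendsto (fun x : ℝ => Complex.exp (-(lam * ((x : ℂ) + y * Complex.I)))) (𝓝[>] 0)
      (𝓝 (Complex.exp (-(lam * (y * Complex.I))))) := by
    have h : Continuous fun x : ℝ => Complex.exp (-(lam * ((x : ℂ) + y * Complex.I))) := by fun_prop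
    have h1 := (h.tendsto 0).mono_left (nhdsWithin_le_nhds (s := Set.Ioi 0))
    convert h1 using 2
    simp
  have him : ∀ x : ℝ, (((x : ℂ) + y * Complex.I) ^ 2 + (a : ℂ) ^ 2).im = 2 * x * y := fun x => by
    simp [pow_two]; ring
  simp only [expQuot, div_eq_mul_inv, expQuotBoundary]
  refine hE.mul ?_
  simp only [← Complex.cpow_neg]
  by_cases h : |y| < a
  · rw [if_pos h]
    have hpos : 0 < a ^ 2 - y ^ 2 := by
      have := abs_lt.1 h
      nlinarith
    rw [Complex.ofReal_cpow hpos.le, Complex.ofReal_neg]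
    refine Tendsto.cpow hD tendsto_const_nhds (Or.inl ?_)
    rwa [Complex.ofReal_re]
  · rw [if_neg h]
    have hle : a ≤ |y| := not_lt.1 h
    have hlt : a < |y| := by
      refine lt_of_le_of_ne hle fun he => ?_
      rcases eq_or_eq_neg_of_abs_eq he.symm with h | h
      exacts [hy1 h, hy2 h]
    have hpos : 0 < y ^ 2 - a ^ 2 := by
      rw [← sq_abs y]; nlinarith
    have hnorm : ‖((a ^ 2 - y ^ 2 : ℝ) : ℂ)‖ = y ^ 2 - a ^ 2 := by
      rw [Complex.norm_real, Real.norm_eq_abs, abs_sub_comm, abs_of_pos hpos]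
    have hre : ((a ^ 2 - y ^ 2 : ℝ) : ℂ).re < 0 := by rw [Complex.ofReal_re]; linarith
    have hne : ∀ᶠ x : ℝ in 𝓝[>] 0, ((x : ℂ) + y * Complex.I) ^ 2 + (a : ℂ) ^ 2 ≠ 0 := by
      refine hD.eventually_ne ?_
      exact_mod_cast (by linarith : a ^ 2 - y ^ 2 < 0).ne
    -- `s` will be the sign of `y`; a limit of the logarithm with argument `sπ` is turned into the
    -- phase `e^{-sπiμ}` of the power.
    have key : ∀ s : ℝ, Tendsto (fun x : ℝ => Complex.log (((x : ℂ) + y * Complex.I) ^ 2 + (a : ℂ) ^ 2))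
        (𝓝[>] 0) (𝓝 ((Real.log (y ^ 2 - a ^ 2) : ℂ) + s * (π * Complex.I))) →
        Tendsto (fun x : ℝ => (((x : ℂ) + y * Complex.I) ^ 2 + (a : ℂ) ^ 2) ^ (-(mu : ℂ))) (𝓝[>] 0)
        (𝓝 ((((y ^ 2 - a ^ 2) ^ (-mu) : ℝ) : ℂ) * Complex.exp (-(s * (π * mu * Complex.I))))) := by
      intro s hs
      have h1 := (Complex.continuous_exp.tendsto _).comp (hs.mul_const (-(mu : ℂ)))
      rw [Complex.ofReal_cpow hpos.le, Complex.cpow_def_of_ne_zero (by exact_mod_cast hpos.ne'),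
        ← Complex.exp_add, ← Complex.ofReal_log hpos.le]
      refine (h1.congr' ?_).trans (le_of_eq ?_)
      · filter_upwards [hne] with x hx
        rw [Complex.cpow_def_of_ne_zero hx]
        rfl
      · congr 2
        push_cast
        ring
    rcases lt_or_gt_of_ne (show y ≠ 0 by intro h0; rw [h0, abs_zero] at hlt; linarith) with h0 | h0
    · have hlog := Complex.tendsto_log_nhdsWithin_im_neg_of_re_neg_of_im_zero hre (Complex.ofReal_im _)
      rw [hnorm] at hlog
      have h1 := hlog.comp (tendsto_nhdsWithin_iff.2 ⟨hD, by
        filter_upwards [self_mem_nhdsWithin] with x hx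
        show (((x : ℂ) + y * Complex.I) ^ 2 + (a : ℂ) ^ 2).im < 0
        rw [him]
        exact mul_neg_of_pos_of_neg (mul_pos two_pos hx) h0⟩)
      have h2 := key (-1) (by simpa [sub_eq_add_neg, Function.comp_def] using h1)
      simpa [sign_neg h0] using h2
    · have hlog := Complex.tendsto_log_nhdsWithin_im_nonneg_of_re_neg_of_im_zero hre (Complex.ofReal_im _)
      rw [hnorm] at hlog
      have h1 := hlog.comp (tendsto_nhdsWithin_iff.2 ⟨hD, by
        filter_upwards [self_mem_nhdsWithin] with x hx
        show 0 ≤ (((x : ℂ) + y * Complex.I) ^ 2 + (a : ℂ) ^ 2).im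
        rw [him]
        exact mul_nonneg (mul_nonneg two_pos.le (le_of_lt hx)) h0.le⟩)
      have h2 := key 1 (by simpa [Function.comp_def] using h1)
      simpa [sign_pos h0] using h2

theorem expQuotBoundary_sub_of_lt {lam mu a y : ℝ} (hy : 0 < y) (hya : y < a) :
    Complex.I / 2 * ((expQuotBoundary lam mu a y - expQuotBoundary lam mu a (-y)) / (Real.sinh (π * y) : ℂ))
      = ((Real.sin (lam * y) / Real.sinh (π * y) * (a ^ 2 - y ^ 2) ^ (-mu) : ℝ) : ℂ) := by
  rw [expQuotBoundary, expQuotBoundary, abs_neg, abs_of_pos hy, if_pos hya, if_pos hya, neg_sq]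
  have e1 : Complex.exp (-(lam * (y * Complex.I))) = Complex.cos (lam * y) - Complex.sin (lam * y) * Complex.I := by
    rw [show -(lam * ((y : ℂ) * Complex.I)) = -(lam * y) * Complex.I by ring, Complex.exp_mul_I,
      Complex.cos_neg, Complex.sin_neg]
    ring
  have e2 : Complex.exp (-(lam * (((-y : ℝ) : ℂ) * Complex.I))) =
      Complex.cos (lam * y) + Complex.sin (lam * y) * Complex.I := by
    rw [show -(lam * (((-y : ℝ) : ℂ) * Complex.I)) = (lam * y) * Complex.I by push_cast; ring,
      Complex.exp_mul_I]
  rw [e1, e2]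
  push_cast
  linear_combination (-(Complex.sin (lam * y) / Complex.sinh (π * y)) *
    (((a ^ 2 - y ^ 2) ^ (-mu) : ℝ) : ℂ)) * Complex.I_sq

/-- The integrand on the cut whose integral is the `k`-th Bessel term. -/
noncomputable def besselIntegrand (lam mu a : ℝ) (k : ℕ) (y : ℝ) : ℂ :=
  Complex.I * Complex.exp (-(π * mu * Complex.I)) *
      ((((y ^ 2 - a ^ 2) ^ (-mu) : ℝ) : ℂ) * Complex.exp (-(besselC lam 1 k * y))) -
    Complex.I * Complex.exp (π * mu * Complex.I) *
      ((((y ^ 2 - a ^ 2) ^ (-mu) : ℝ) : ℂ) * Complex.exp (-(besselC lam (-1) k * y)))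

/-- A geometric series. Multiplied by `e^{∓iλy}`, its terms have the exponents `-((2k+1)π ± iλ)y`
that produce the arguments `X_k^±`. -/
theorem hasSum_exp_neg_odd_mul {y : ℝ} (hy : 0 < y) :
    HasSum (fun k : ℕ => Complex.exp (-((2 * k + 1) * π * y))) (1 / (2 * (Real.sinh (π * y) : ℂ))) := by
  have hpy : 0 < π * y := mul_pos pi_pos hy
  have hlt : Real.exp (-(2 * (π * y))) < 1 := Real.exp_lt_one_iff.2 (by linarith)
  have h := (hasSum_geometric_of_lt_one (Real.exp_pos _).le hlt).mul_left (Real.exp (-(π * y)))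
  have h2 : Real.exp (-(π * y)) * (1 - Real.exp (-(2 * (π * y))))⁻¹ = 1 / (2 * Real.sinh (π * y)) := by
    have hs : Real.sinh (π * y) ≠ 0 := (Real.sinh_pos_iff.2 hpy).ne'
    have hd : 1 - Real.exp (-(2 * (π * y))) ≠ 0 := by linarith
    rw [← div_eq_mul_inv, div_eq_div_iff hd (by positivity), Real.sinh_eq,
      show -(2 * (π * y)) = -(π * y) + -(π * y) by ring, Real.exp_add]
    have : Real.exp (-(π * y)) * Real.exp (π * y) = 1 := by rw [← Real.exp_add]; simp
    linear_combination this
  rw [h2] at h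
  have h3 := Complex.hasSum_ofReal.2 h
  push_cast at h3 ⊢
  refine h3.congr_fun ?_
  intro k
  rw [← Complex.exp_nat_mul, ← Complex.exp_add]
  congr 1
  ring

theorem hasSum_besselIntegrand {lam mu a y : ℝ} (ha : 0 < a) (hya : a < y) :
    HasSum (fun k => besselIntegrand lam mu a k y) (Complex.I / 2 *
      ((expQuotBoundary lam mu a y - expQuotBoundary lam mu a (-y)) / (Real.sinh (π * y) : ℂ))) := by
  have hy : 0 < y := ha.trans hya
  have h := (hasSum_exp_neg_odd_mul hy).mul_left (Complex.I *
    (expQuotBoundary lam mu a y - expQuotBoundary lam mu a (-y)))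
  rw [show Complex.I / 2 * ((expQuotBoundary lam mu a y - expQuotBoundary lam mu a (-y)) /
      (Real.sinh (π * y) : ℂ)) = Complex.I * (expQuotBoundary lam mu a y - expQuotBoundary lam mu a (-y)) *
      (1 / (2 * (Real.sinh (π * y) : ℂ))) by ring]
  refine h.congr_fun ?_
  intro k
  rw [besselIntegrand, expQuotBoundary, expQuotBoundary, abs_neg, abs_of_pos hy, if_neg (not_lt.2 hya.le),
    if_neg (not_lt.2 hya.le), neg_sq, sign_pos hy, sign_neg (neg_neg_of_pos hy)]
  have e1 : Complex.exp (-(besselC lam 1 k * y)) =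
      Complex.exp (-(lam * (y * Complex.I))) * Complex.exp (-((2 * k + 1) * π * y)) := by
    rw [← Complex.exp_add, besselC]; push_cast; ring_nf
  have e2 : Complex.exp (-(besselC lam (-1) k * y)) =
      Complex.exp (-(lam * (((-y : ℝ) : ℂ) * Complex.I))) * Complex.exp (-((2 * k + 1) * π * y)) := by
    rw [← Complex.exp_add, besselC]; push_cast; ring_nf
  rw [e1, e2]
  simp only [SignType.coe_one, SignType.coe_neg, one_mul, neg_mul, neg_neg]
  ring

theorem integral_besselIntegrand (lam : ℝ) {mu : ℝ} (hmu : mu < 1) {a : ℝ} (ha : 0 < a) (k : ℕ) :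
    IntegrableOn (besselIntegrand lam mu a k) (Set.Ioi a) ∧
    ∫ y in Set.Ioi a, besselIntegrand lam mu a k y = besselTerm lam mu a k := by
  obtain ⟨i1, h1⟩ := integral_sq_sub_sq_mul_exp hmu ha (besselC_re_pos lam 1 k)
  obtain ⟨i2, h2⟩ := integral_sq_sub_sq_mul_exp hmu ha (besselC_re_pos lam (-1) k)
  refine ⟨(i1.const_mul _).sub (i2.const_mul _), ?_⟩
  simp only [besselIntegrand]
  rw [integral_sub (i1.const_mul _) (i2.const_mul _), integral_const_mul, integral_const_mul, h1, h2,
    besselTerm_eq, besselConst]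
  ring

theorem norm_besselIntegrand_le (lam mu : ℝ) {a : ℝ} (ha : 0 < a) (k : ℕ) {y : ℝ} (hy : a < y) :
    ‖besselIntegrand lam mu a k y‖ ≤ 2 * ((y ^ 2 - a ^ 2) ^ (-mu) * Real.exp (-π * y)) *
      Real.exp (-(2 * π * a)) ^ k := by
  have hpos : 0 < y ^ 2 - a ^ 2 := by nlinarith
  have hn : ∀ s : ℝ, ‖Complex.exp (-(besselC lam s k * y))‖ ≤ Real.exp (-π * y) * Real.exp (-(2 * π * a)) ^ k := by
    intro s
    rw [Complex.norm_exp, ← Real.exp_nat_mul, ← Real.exp_add]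
    refine Real.exp_le_exp.2 ?_
    have h1 : (-(besselC lam s k * y)).re = -((2 * k + 1) * π * y) := by
      simp [besselC_re]
    rw [h1]
    have h2 : 2 * k * π * a ≤ 2 * k * π * y := by gcongr
    linarith
  have e1 : ‖Complex.exp (-(π * mu * Complex.I))‖ = 1 := by
    have := norm_exp_mul_I_eq_one (-(π * mu))
    rwa [show ((-(π * mu) : ℝ) : ℂ) * Complex.I = -(π * mu * Complex.I) by push_cast; ring] at this
  have e2 : ‖Complex.exp (π * mu * Complex.I)‖ = 1 := by
    have := norm_exp_mul_I_eq_one (π * mu)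
    rwa [show ((π * mu : ℝ) : ℂ) * Complex.I = (π * mu * Complex.I) by push_cast; ring] at this
  rw [besselIntegrand]
  refine (norm_sub_le _ _).trans ?_
  rw [norm_mul, norm_mul, norm_mul, norm_mul, norm_mul, norm_mul, e1, e2, Complex.norm_I,
    Complex.norm_real, Real.norm_eq_abs, abs_of_pos (Real.rpow_pos_of_pos hpos _)]
  have h1 := mul_le_mul_of_nonneg_left (hn 1) (Real.rpow_nonneg hpos.le (-mu))
  have h2 := mul_le_mul_of_nonneg_left (hn (-1)) (Real.rpow_nonneg hpos.le (-mu))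
  linarith

/-- Sum and integral may be interchanged because the integrands decay geometrically in `k` with
ratio `e^{-2πa}`, uniformly on `y > a`. -/
theorem integral_cut_eq_mathieuT (lam : ℝ) {mu : ℝ} (hmu : mu < 1) {a : ℝ} (ha : 0 < a) :
    ∫ y in Set.Ioi a, Complex.I / 2 *
      ((expQuotBoundary lam mu a y - expQuotBoundary lam mu a (-y)) / (Real.sinh (π * y) : ℂ))
      = mathieuT lam mu a := by
  have hi := fun k => (integral_besselIntegrand lam hmu ha k).1
  have hbi : IntegrableOn (fun y : ℝ => 2 * ((y ^ 2 - a ^ 2) ^ (-mu) * Real.exp (-π * y))) (Set.Ioi a) := by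
    have h := (integral_sq_sub_sq_mul_exp hmu ha (c := (π : ℂ)) (by simpa using pi_pos)).1.norm
    refine (IntegrableOn.congr_fun h (fun y hy => ?_) measurableSet_Ioi).const_mul 2
    have hpos : 0 < y ^ 2 - a ^ 2 := by
      have : a < y := hy
      nlinarith
    rw [norm_mul, Complex.norm_real, Real.norm_eq_abs, abs_of_pos (Real.rpow_pos_of_pos hpos _),
      Complex.norm_exp]
    simp
  have hs : Summable fun k => ∫ y in Set.Ioi a, ‖besselIntegrand lam mu a k y‖ := by
    refine Summable.of_nonneg_of_le (fun k => integral_nonneg fun _ => norm_nonneg _) (fun k => ?_)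
      ((summable_geometric_of_lt_one (Real.exp_pos (-(2 * π * a))).le
        (Real.exp_lt_one_iff.2 (by have := mul_pos pi_pos ha; linarith))).mul_left
        (∫ y in Set.Ioi a, 2 * ((y ^ 2 - a ^ 2) ^ (-mu) * Real.exp (-π * y))))
    rw [← integral_mul_const]
    exact setIntegral_mono_on (hi k).norm (hbi.mul_const _) measurableSet_Ioi
      fun y hy => norm_besselIntegrand_le lam mu ha k hy
  have h := hasSum_integral_of_summable_integral_norm hi hs
  rw [setIntegral_congr_fun measurableSet_Ioi
    fun y (hy : a < y) => (hasSum_besselIntegrand (lam := lam) (mu := mu) ha hy).tsum_eq.symm, ← h.tsum_eq, mathieuT]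
  exact tsum_congr fun k => (integral_besselIntegrand lam hmu ha k).2

theorem integralH_ofReal (lam mu : ℝ) {a : ℝ} (ha : 0 < a) : integralH lam mu a =
    ((∫ y in (0 : ℝ)..a, Real.sin (lam * y) / Real.sinh (π * y) * (a ^ 2 - y ^ 2) ^ (-mu) : ℝ) : ℂ) := by
  have h1 := intervalIntegral.mul_integral_comp_mul_left (a := (0 : ℝ)) (b := 1)
    (f := fun y => Real.sin (lam * y) / Real.sinh (π * y) * (a ^ 2 - y ^ 2) ^ (-mu)) a
  rw [mul_zero, mul_one] at h1
  rw [← h1, integralH]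
  have hpow : (a : ℂ) ^ ((1 - 2 * mu : ℝ) : ℂ) = ((a * (a ^ 2) ^ (-mu) : ℝ) : ℂ) := by
    rw [← Complex.ofReal_cpow ha.le, ← Real.rpow_natCast, ← Real.rpow_mul ha.le]
    nth_rw 2 [← Real.rpow_one a]
    rw [← Real.rpow_add ha]
    congr 2
    push_cast
    ring
  rw [hpow, Complex.ofReal_mul, Complex.ofReal_mul, mul_assoc]
  congr 1
  rw [← intervalIntegral.integral_const_mul, ← intervalIntegral.integral_ofReal]
  refine intervalIntegral.integral_congr fun t ht => ?_
  rw [Set.uIcc_of_le zero_le_one] at ht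
  have h2 : 0 ≤ 1 - t ^ 2 := by nlinarith [ht.1, ht.2]
  have h3 : a ^ 2 - (a * t) ^ 2 = a ^ 2 * (1 - t ^ 2) := by ring
  rw [h3, Real.mul_rpow (by positivity) h2, Real.rpow_neg h2]
  push_cast
  rw [div_eq_mul_inv, mul_assoc (lam : ℂ), mul_assoc (π : ℂ)]
  ring

/-- The core case: the Abel–Plana integral is cut at the branch point `y = a`, the lower part being
`integralH` and the upper part `T`. -/
theorem mathieuS_eq_of_real {lam : ℝ} (hlam : 0 < lam) {mu : ℝ} (hmu : 0 ≤ mu) (hmu1 : mu < 1) {a : ℝ}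
    (ha : 0 < a) : mathieuS lam mu a =
      1 / (2 * (a : ℂ) ^ ((2 * mu : ℝ) : ℂ)) + integralH lam mu a + mathieuT lam mu a := by
  have hare : 0 < (a : ℂ).re := by simpa using ha
  have hterm : ∀ n : ℕ, (-1) ^ n * expQuot lam mu a n = mathieuTerm lam mu a n := fun n => by
    rw [expQuot, mathieuTerm, mul_div_assoc]
  obtain ⟨b, hb, hdom⟩ := exists_expQuot_dominated hlam hmu hmu1 ha
  have hae : ∀ᵐ y : ℝ, y ≠ a ∧ y ≠ -a := by
    filter_upwards [Measure.ae_ne volume a, Measure.ae_ne volume (-a)] with y h1 h2 using ⟨h1, h2⟩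
  obtain ⟨hi, h⟩ := tsum_alternating_eq (g := expQuot lam mu a) (G := expQuotBoundary lam mu a) hlam
    (fun z hz => differentiableAt_expQuot lam mu a (by
      have := sq_add_sq_mem_slitPlane a hz
      rwa [add_comm] at this))
    (fun δ hδ => ⟨1 / (δ ^ 2) ^ mu, fun z hz => by
      refine (norm_expQuot_le hmu a hδ hz).trans ?_
      rw [one_div_mul_eq_div]
      exact le_mul_of_one_le_right (by positivity) (Real.one_le_exp (abs_nonneg _))⟩)
    hb (by filter_upwards [hae] with y hy using hdom y hy.1 hy.2)
    (by filter_upwards [hae] with y hy using tendsto_expQuot lam mu ha hy.1 hy.2)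
    (by simp only [hterm]; exact summable_mathieuTerm hlam hmu hare)
  simp only [hterm] at h
  rw [mathieuS, h]
  have h0 : expQuot lam mu a 0 / 2 = 1 / (2 * (a : ℂ) ^ ((2 * mu : ℝ) : ℂ)) := by
    rw [expQuot]
    have : ((0 : ℂ) ^ 2 + (a : ℂ) ^ 2) ^ (mu : ℂ) = (a : ℂ) ^ ((2 * mu : ℝ) : ℂ) := by
      rw [zero_pow two_ne_zero, zero_add, ← Complex.ofReal_pow, ← Complex.ofReal_cpow (by positivity),
        ← Complex.ofReal_cpow ha.le, Real.rpow_mul ha.le]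
      norm_num
    rw [this]
    simp
    ring
  rw [h0, add_assoc]
  congr 1
  have hi' : IntegrableOn (fun y : ℝ => Complex.I / 2 *
      ((expQuotBoundary lam mu a y - expQuotBoundary lam mu a (-y)) / (Real.sinh (π * y) : ℂ))) (Set.Ioi 0) :=
    hi.const_mul _
  rw [← integral_const_mul, ← intervalIntegral.integral_interval_add_Ioi hi'
    (hi'.mono_set (Set.Ioi_subset_Ioi ha.le)), integral_cut_eq_mathieuT lam hmu1 ha, integralH_ofReal lam mu ha,
    ← intervalIntegral.integral_ofReal, intervalIntegral.integral_of_le ha.le,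
    intervalIntegral.integral_of_le ha.le, integral_Ioc_eq_integral_Ioo, integral_Ioc_eq_integral_Ioo,
    setIntegral_congr_fun measurableSet_Ioo fun y hy => expQuotBoundary_sub_of_lt hy.1 hy.2]

/-! ### The integral and the power series of `H`. -/

theorem integral_rpow_mul_one_sub_rpow {α β : ℝ} (hα : 0 < α) (hβ : 0 < β) :
    IntegrableOn (fun y : ℝ => y ^ (α - 1) * (1 - y) ^ (β - 1)) (Set.Ioo 0 1) ∧
    ∫ y in Set.Ioo (0 : ℝ) 1, y ^ (α - 1) * (1 - y) ^ (β - 1) =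
      Real.Gamma α * Real.Gamma β / Real.Gamma (α + β) := by
  have hconv := Complex.betaIntegral_convergent (u := (α : ℂ)) (v := (β : ℂ)) (by simpa) (by simpa)
  rw [intervalIntegrable_iff_integrableOn_Ioo_of_le zero_le_one] at hconv
  have hval := Complex.betaIntegral_eq_Gamma_mul_div (α : ℂ) (β : ℂ) (by simpa) (by simpa)
  rw [Complex.betaIntegral, intervalIntegral.integral_of_le zero_le_one,
    integral_Ioc_eq_integral_Ioo] at hval
  have hcongr : ∀ y ∈ Set.Ioo (0 : ℝ) 1, (y : ℂ) ^ ((α : ℂ) - 1) * (1 - (y : ℂ)) ^ ((β : ℂ) - 1) =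
      ((y ^ (α - 1) * (1 - y) ^ (β - 1) : ℝ) : ℂ) := by
    intro y hy
    rw [Complex.ofReal_mul, Complex.ofReal_cpow hy.1.le, Complex.ofReal_cpow (by linarith [hy.2])]
    push_cast
    rfl
  rw [setIntegral_congr_fun measurableSet_Ioo hcongr, integral_complex_ofReal, ← Complex.ofReal_add,
    Complex.Gamma_ofReal, Complex.Gamma_ofReal, Complex.Gamma_ofReal] at hval
  refine ⟨?_, by exact_mod_cast hval⟩
  have := (hconv.congr_fun hcongr measurableSet_Ioo).re
  exact this

/-- The Beta integral after `y = t²`; extending by an indicator allows the change of variables to be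
made on the whole half-line. -/
theorem integral_pow_mul_one_sub_sq_rpow {mu : ℝ} (hmu : mu < 1) (k : ℕ) :
    IntegrableOn (fun t : ℝ => t ^ (2 * k) * (1 - t ^ 2) ^ (-mu)) (Set.Ioo 0 1) ∧
    ∫ t in Set.Ioo (0 : ℝ) 1, t ^ (2 * k) * (1 - t ^ 2) ^ (-mu) =
      Real.Gamma (k + 1 / 2) * Real.Gamma (1 - mu) / (2 * Real.Gamma (k + 3 / 2 - mu)) := by
  obtain ⟨hi, hv⟩ := integral_rpow_mul_one_sub_rpow (α := k + 1 / 2) (β := 1 - mu) (by positivity)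
    (by linarith)
  set g : ℝ → ℝ := (Set.Ioo (0 : ℝ) 1).indicator
    fun y => y ^ ((k + 1 / 2 : ℝ) - 1) * (1 - y) ^ (1 - mu - 1) with hg
  have hint : Set.Ioi (0 : ℝ) ∩ Set.Ioo 0 1 = Set.Ioo 0 1 := Set.inter_eq_right.2 fun x hx => hx.1
  have hgi : IntegrableOn g (Set.Ioi 0) := by
    rw [hg, integrableOn_indicator_iff measurableSet_Ioo, Set.inter_comm, hint]; exact hi
  have hgv : ∫ y in Set.Ioi (0 : ℝ), g y = Real.Gamma (k + 1 / 2) * Real.Gamma (1 - mu) /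
      Real.Gamma (k + 1 / 2 + (1 - mu)) := by
    rw [hg, setIntegral_indicator measurableSet_Ioo, hint, hv]
  have hcongr : ∀ t ∈ Set.Ioi (0 : ℝ), (|(2 : ℝ)| * t ^ ((2 : ℝ) - 1)) • g (t ^ (2 : ℝ)) =
      (Set.Ioo (0 : ℝ) 1).indicator (fun t => 2 * (t ^ (2 * k) * (1 - t ^ 2) ^ (-mu))) t := by
    intro t ht
    have ht0 : (0 : ℝ) < t := ht
    by_cases h1 : t < 1
    · have m1 : t ∈ Set.Ioo (0 : ℝ) 1 := ⟨ht0, h1⟩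
      have m2 : t ^ (2 : ℝ) ∈ Set.Ioo (0 : ℝ) 1 := by
        rw [Real.rpow_two]; exact ⟨by positivity, by nlinarith⟩
      rw [hg, Set.indicator_of_mem m1, Set.indicator_of_mem m2, ← Real.rpow_mul ht0.le, Real.rpow_two,
        abs_two, smul_eq_mul, show 1 - mu - 1 = -mu by ring]
      have : t ^ (2 * k) = t ^ ((2 : ℝ) - 1) * t ^ (2 * ((k + 1 / 2 : ℝ) - 1)) := by
        rw [← Real.rpow_add ht0, ← Real.rpow_natCast]
        congr 1
        push_cast
        ring
      rw [this]
      ring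
    · have m1 : t ∉ Set.Ioo (0 : ℝ) 1 := fun h => h1 h.2
      have m2 : t ^ (2 : ℝ) ∉ Set.Ioo (0 : ℝ) 1 := by
        rw [Real.rpow_two]
        intro h
        have := h.2
        nlinarith
      rw [hg, Set.indicator_of_notMem m1, Set.indicator_of_notMem m2, smul_zero]
  have h1 := (integrableOn_Ioi_comp_rpow_iff g two_ne_zero).2 hgi
  have h2 := integral_comp_rpow_Ioi g two_ne_zero
  rw [setIntegral_congr_fun measurableSet_Ioi hcongr, setIntegral_indicator measurableSet_Ioo, hint,
    integral_const_mul, hgv, show (k : ℝ) + 1 / 2 + (1 - mu) = k + 3 / 2 - mu by ring] at h2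
  have h3 := h1.congr_fun hcongr measurableSet_Ioi
  rw [integrableOn_indicator_iff measurableSet_Ioo, Set.inter_comm, hint] at h3
  constructor
  · have := h3.const_mul (1 / 2)
    refine this.congr (ae_of_all _ fun t => ?_)
    ring
  · have h4 : ∀ G : ℝ, Real.Gamma (k + 1 / 2) * Real.Gamma (1 - mu) / (2 * G) =
      Real.Gamma (k + 1 / 2) * Real.Gamma (1 - mu) / G / 2 := fun G => by rw [div_div, mul_comm G]
    rw [h4, ← h2]
    ring

theorem sinh_pi_mul_eq_zero {z : ℂ} (h : Complex.sinh (π * z) = 0) : ∃ k : ℤ, z = k * Complex.I := by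
  have h1 : Complex.sin (π * (z * Complex.I)) = 0 := by
    rw [← mul_assoc, Complex.sin_mul_I, h, zero_mul]
  obtain ⟨k, hk⟩ := sin_pi_mul_eq_zero h1
  refine ⟨-k, ?_⟩
  push_cast
  linear_combination (-Complex.I) * hk + z * Complex.I_sq

theorem sinh_pi_mul_ne_zero_of_re_pos {z : ℂ} (h : 0 < z.re) : Complex.sinh (π * z) ≠ 0 := by
  intro h0
  obtain ⟨k, hk⟩ := sinh_pi_mul_eq_zero h0
  rw [hk] at h
  simp at h

theorem sinh_pi_mul_ne_zero_of_norm_lt_one {z : ℂ} (hz : z ≠ 0) (h : ‖z‖ < 1) :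
    Complex.sinh (π * z) ≠ 0 := by
  intro h0
  obtain ⟨k, hk⟩ := sinh_pi_mul_eq_zero h0
  have hk0 : k ≠ 0 := by
    rintro rfl
    simp at hk
    exact hz hk
  rw [hk, norm_mul, Complex.norm_I, mul_one, Complex.norm_intCast] at h
  have : (1 : ℤ) ≤ |k| := Int.one_le_abs hk0
  have : (1 : ℝ) ≤ |(k : ℝ)| := by exact_mod_cast this
  linarith

theorem sinQuot_of_ne_zero (lam : ℝ) {x : ℂ} (hx : x ≠ 0) :
    sinQuot lam x = Complex.sin (lam * x) / Complex.sinh (π * x) := Function.update_of_ne hx _ _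

/-- Dividing numerator and denominator by `x` removes the common zero, so the prescribed value at
`0` is the analytic one. -/
theorem sinQuot_eq_dslope (lam : ℝ) : sinQuot lam = fun x =>
    dslope (fun x : ℂ => Complex.sin (lam * x)) 0 x / dslope (fun x : ℂ => Complex.sinh (π * x)) 0 x := by
  funext x
  rcases eq_or_ne x 0 with rfl | hx
  · have h1 : HasDerivAt (fun x : ℂ => Complex.sin (lam * x)) (lam : ℂ) 0 := by
      have := (Complex.hasDerivAt_sin (lam * 0)).comp (0 : ℂ) ((hasDerivAt_id (0 : ℂ)).const_mul (lam : ℂ))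
      simpa [Function.comp_def] using this
    have h2 : HasDerivAt (fun x : ℂ => Complex.sinh (π * x)) (π : ℂ) 0 := by
      have := (Complex.hasDerivAt_sinh (π * 0)).comp (0 : ℂ) ((hasDerivAt_id (0 : ℂ)).const_mul (π : ℂ))
      simpa [Function.comp_def] using this
    rw [dslope_same, dslope_same, h1.deriv, h2.deriv]
    exact Function.update_self _ _ _
  · rw [sinQuot_of_ne_zero lam hx, dslope_of_ne _ hx, dslope_of_ne _ hx, slope_def_field, slope_def_field]
    simp only [mul_zero, Complex.sin_zero, Complex.sinh_zero, sub_zero]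
    rw [div_div_div_cancel_right₀ hx]

theorem differentiableAt_sinQuot (lam : ℝ) {x : ℂ} (hx : 0 < x.re ∨ ‖x‖ < 1) :
    DifferentiableAt ℂ (sinQuot lam) x := by
  rw [sinQuot_eq_dslope]
  have h1 : DifferentiableOn ℂ (dslope (fun x : ℂ => Complex.sin (lam * x)) 0) Set.univ :=
    (Complex.differentiableOn_dslope univ_mem).2 (by fun_prop)
  have h2 : DifferentiableOn ℂ (dslope (fun x : ℂ => Complex.sinh (π * x)) 0) Set.univ :=
    (Complex.differentiableOn_dslope univ_mem).2 (by fun_prop)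
  refine (h1.differentiableAt univ_mem).div (h2.differentiableAt univ_mem) ?_
  rcases eq_or_ne x 0 with rfl | hx0
  · have h2 : HasDerivAt (fun x : ℂ => Complex.sinh (π * x)) (π : ℂ) 0 := by
      have := (Complex.hasDerivAt_sinh (π * 0)).comp (0 : ℂ) ((hasDerivAt_id (0 : ℂ)).const_mul (π : ℂ))
      simpa [Function.comp_def] using this
    rw [dslope_same, h2.deriv]
    exact_mod_cast pi_ne_zero
  · rw [dslope_of_ne _ hx0, slope_def_field]
    simp only [mul_zero, Complex.sinh_zero, sub_zero]
    refine div_ne_zero ?_ hx0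
    rcases hx with h | h
    exacts [sinh_pi_mul_ne_zero_of_re_pos h, sinh_pi_mul_ne_zero_of_norm_lt_one hx0 h]

theorem integralH_eq_sinQuot (lam mu : ℝ) {a : ℂ} (ha : 0 < a.re) : integralH lam mu a =
    a ^ ((1 - 2 * mu : ℝ) : ℂ) *
      ∫ t in Set.Ioo (0 : ℝ) 1, sinQuot lam (a * t) * (((1 - t ^ 2) ^ (-mu) : ℝ) : ℂ) := by
  rw [integralH, intervalIntegral.integral_of_le zero_le_one, integral_Ioc_eq_integral_Ioo]
  congr 1
  refine setIntegral_congr_fun measurableSet_Ioo fun t ht => ?_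
  have h0 : a * t ≠ 0 := mul_ne_zero (ne_zero_of_re_pos ha) (by exact_mod_cast ht.1.ne')
  rw [sinQuot_of_ne_zero lam h0, Real.rpow_neg (by nlinarith [ht.1, ht.2]), Complex.ofReal_inv,
    mul_assoc, mul_assoc, div_eq_mul_inv]

theorem integralH_differentiableOn (lam : ℝ) {mu : ℝ} (hmu : mu < 1) :
    DifferentiableOn ℂ (integralH lam mu) {a : ℂ | 0 < a.re} := by
  have hI : DifferentiableOn ℂ (fun a : ℂ => ∫ t in Set.Ioo (0 : ℝ) 1,
      sinQuot lam (a * t) * (((1 - t ^ 2) ^ (-mu) : ℝ) : ℂ)) {a : ℂ | 0 < a.re} := by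
    intro a ha
    have ha' : 0 < a.re := ha
    have hr : 0 < a.re / 2 := half_pos ha'
    have hsub : ∀ w ∈ Metric.closedBall a (a.re / 2), 0 < w.re := by
      intro w hw
      have h1 := (Complex.abs_re_le_norm (w - a)).trans (mem_closedBall_iff_norm.1 hw)
      have h2 := (abs_le.1 h1).1
      rw [Complex.sub_re] at h2
      linarith
    have hmem : ∀ w : ℂ, 0 < w.re → ∀ t : ℝ, 0 ≤ t → 0 < (w * t).re ∨ ‖w * t‖ < 1 := by
      intro w hw t ht
      rcases ht.eq_or_lt with rfl | h
      · right; simp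
      · left
        rw [Complex.re_mul_ofReal]
        positivity
    have hK : IsCompact (Metric.closedBall a (a.re / 2) ×ˢ Set.Icc (0 : ℝ) 1) :=
      (isCompact_closedBall _ _).prod isCompact_Icc
    obtain ⟨C, hC⟩ := hK.exists_bound_of_continuousOn (f := fun p : ℂ × ℝ => sinQuot lam (p.1 * p.2)) (by
      intro p hp
      have h1 := (differentiableAt_sinQuot lam (hmem p.1 (hsub _ hp.1) p.2 hp.2.1)).continuousAt
      have h2 : ContinuousAt (fun p : ℂ × ℝ => p.1 * (p.2 : ℂ)) p := by fun_prop
      exact (ContinuousAt.comp (f := fun p : ℂ × ℝ => p.1 * (p.2 : ℂ)) h1 h2).continuousWithinAt)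
    have hint := (integral_pow_mul_one_sub_sq_rpow hmu 0).1
    simp only [mul_zero, pow_zero, one_mul] at hint
    refine (hasDerivAt_integral_of_holomorphic hr (hint.const_mul C) ?_ ?_ ?_).2.differentiableAt.differentiableWithinAt
    · intro w hw
      refine ContinuousOn.aestronglyMeasurable (ContinuousOn.mul ?_ ?_) measurableSet_Ioo
      · intro t ht
        have h1 := (differentiableAt_sinQuot lam (hmem w (hsub _ (Metric.ball_subset_closedBall hw)) t
          ht.1.le)).continuousAt
        have h2 : ContinuousAt (fun t : ℝ => w * (t : ℂ)) t := by fun_prop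
        exact (ContinuousAt.comp (f := fun t : ℝ => w * (t : ℂ)) h1 h2).continuousWithinAt
      · refine Complex.continuous_ofReal.comp_continuousOn ?_
        refine ContinuousOn.rpow_const (by fun_prop) fun t ht => Or.inl ?_
        have : 0 < 1 - t ^ 2 := by nlinarith [ht.1, ht.2]
        exact this.ne'
    · refine (ae_restrict_mem measurableSet_Ioo).mono fun t ht w hw => ?_
      have h1 := differentiableAt_sinQuot lam (hmem w (hsub _ (Metric.ball_subset_closedBall hw)) t ht.1.le)
      have h2 : DifferentiableAt ℂ (fun w : ℂ => w * (t : ℂ)) w := by fun_prop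
      exact ((DifferentiableAt.comp (f := fun w : ℂ => w * (t : ℂ)) w h1 h2).mul_const _).differentiableWithinAt
    · refine (ae_restrict_mem measurableSet_Ioo).mono fun t ht w hw => ?_
      have h2 : 0 < 1 - t ^ 2 := by nlinarith [ht.1, ht.2]
      rw [norm_mul, Complex.norm_real, Real.norm_eq_abs, abs_of_pos (Real.rpow_pos_of_pos h2 _)]
      exact mul_le_mul_of_nonneg_right (hC (w, t) ⟨Metric.ball_subset_closedBall hw, ht.1.le, ht.2.le⟩)
        (Real.rpow_nonneg h2.le _)
  have hp : DifferentiableOn ℂ (fun a : ℂ => a ^ ((1 - 2 * mu : ℝ) : ℂ)) {a : ℂ | 0 < a.re} := fun a ha =>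
    (differentiableAt_id.cpow_const (mem_slitPlane_of_re_pos ha)).differentiableWithinAt
  exact (hp.mul hI).congr fun a ha => integralH_eq_sinQuot lam mu ha

/-- The function `H_μ^-(·; λ)`, as the difference of the sum of the series and its other components. -/
noncomputable def mathieuH (lam mu : ℝ) (a : ℂ) : ℂ :=
  mathieuS lam mu a - 1 / (2 * a ^ ((2 * mu : ℝ) : ℂ)) - mathieuT lam mu a

theorem hasDerivAt_inv_two_mul_cpow (mu : ℝ) {a : ℂ} (ha : 0 < a.re) :
    HasDerivAt (fun a : ℂ => 1 / (2 * a ^ ((2 * mu : ℝ) : ℂ)))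
      (-2 * mu * a * (1 / (2 * a ^ ((2 * (mu + 1) : ℝ) : ℂ)))) a := by
  have ha0 := ne_zero_of_re_pos ha
  have h1 := ((hasDerivAt_id a).cpow_const (c := ((-(2 * mu) : ℝ) : ℂ))
    (mem_slitPlane_of_re_pos ha)).const_mul (1 / 2 : ℂ)
  have e : (fun a : ℂ => 1 / (2 * a ^ ((2 * mu : ℝ) : ℂ))) =
      fun a : ℂ => 1 / 2 * id a ^ ((-(2 * mu) : ℝ) : ℂ) := by
    funext a
    rw [Complex.ofReal_neg, Complex.cpow_neg, id, ← div_eq_mul_inv, div_div]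
  rw [e]
  refine h1.congr_deriv ?_
  have e2 : a ^ ((2 * (mu + 1) : ℝ) : ℂ) = a ^ ((2 * mu : ℝ) : ℂ) * a ^ 2 := by
    rw [← Complex.cpow_natCast, ← Complex.cpow_add _ _ ha0]
    congr 1
    push_cast
    ring
  have hne : a ^ ((2 * mu : ℝ) : ℂ) ≠ 0 := by
    rw [Complex.cpow_ne_zero_iff]; exact Or.inl ha0
  rw [id, e2, Complex.cpow_sub _ _ ha0, Complex.cpow_one, Complex.ofReal_neg, Complex.cpow_neg]
  push_cast
  push_cast at hne
  field_simp

theorem mathieuH_differentiableOn {lam : ℝ} (hlam : 0 < lam) {mu : ℝ} (hmu : 0 ≤ mu) :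
    DifferentiableOn ℂ (mathieuH lam mu) {a : ℂ | 0 < a.re} :=
  ((mathieuS_differentiableOn hlam hmu).sub fun _ ha =>
    (hasDerivAt_inv_two_mul_cpow mu ha).differentiableAt.differentiableWithinAt).sub
    (mathieuT_differentiableOn hlam hmu)

theorem mathieuH_hasDerivAt {lam : ℝ} (hlam : 0 < lam) {mu : ℝ} (hmu : 0 < mu) {a : ℂ} (ha : 0 < a.re) :
    HasDerivAt (mathieuH lam mu) (-2 * mu * a * mathieuH lam (mu + 1) a) a := by
  refine (((mathieuS_hasDerivAt hlam hmu.le ha).sub (hasDerivAt_inv_two_mul_cpow mu ha)).sub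
    (mathieuT_hasDerivAt hlam hmu ha)).congr_deriv ?_
  rw [mathieuH]
  ring

/-- Known for `a > 0` from Abel–Plana; both sides are analytic in the half-plane. -/
theorem mathieuH_eq_integralH {lam : ℝ} (hlam : 0 < lam) {mu : ℝ} (hmu : 0 ≤ mu) (hmu1 : mu < 1) {a : ℂ}
    (ha : 0 < a.re) : mathieuH lam mu a = integralH lam mu a :=
  eqOn_re_pos_of_eq_on_pos_reals (mathieuH_differentiableOn hlam hmu) (integralH_differentiableOn lam hmu1)
    (fun x hx => by rw [mathieuH, mathieuS_eq_of_real hlam hmu hmu1 hx]; ring) a ha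

theorem sinQuot_neg (lam : ℝ) (x : ℂ) : sinQuot lam (-x) = sinQuot lam x := by
  rcases eq_or_ne x 0 with rfl | hx
  · rw [neg_zero]
  · rw [sinQuot_of_ne_zero lam hx, sinQuot_of_ne_zero lam (neg_ne_zero.2 hx), mul_neg, mul_neg,
      Complex.sin_neg, Complex.sinh_neg, neg_div_neg_eq]

theorem iteratedDeriv_odd_sinQuot (lam : ℝ) (k : ℕ) : iteratedDeriv (2 * k + 1) (sinQuot lam) 0 = 0 := by
  have h := iteratedDeriv_comp_neg (2 * k + 1) (sinQuot lam) 0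
  simp only [sinQuot_neg, neg_zero, Odd.neg_one_pow (odd_two_mul_add_one k), neg_smul, one_smul] at h
  exact self_eq_neg.1 h

theorem hasSum_sinQuot {lam : ℝ} (hlam : 0 < lam) {x : ℂ} (hx : ‖x‖ < 1) :
    HasSum (fun k : ℕ => lam / π * ((-1) ^ k * coeffA lam k * x ^ (2 * k))) (sinQuot lam x) := by
  have hd : DifferentiableOn ℂ (sinQuot lam) (Metric.ball 0 1) := fun z hz =>
    (differentiableAt_sinQuot lam (Or.inr (by simpa using hz))).differentiableWithinAt
  have h := Complex.hasSum_taylorSeries_on_ball hd (z := x) (by simpa using hx)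
  -- The function is even, so the Taylor series can be reindexed by its even powers.
  have hinj : Function.Injective fun k : ℕ => 2 * k := fun a b hab => by simpa using hab
  rw [← hinj.hasSum_iff] at h
  · refine h.congr_fun ?_
    intro k
    have hl : (lam : ℂ) ≠ 0 := by exact_mod_cast hlam.ne'
    have hp : (π : ℂ) ≠ 0 := by exact_mod_cast pi_ne_zero
    have h1 : ((-1 : ℂ) ^ k) * (-1) ^ k = 1 := by rw [← mul_pow]; simp
    simp only [Function.comp_apply, sub_zero, smul_eq_mul, coeffA]
    rw [show (lam : ℂ) / π * ((-1) ^ k * ((-1) ^ k * (π / lam) *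
      (iteratedDeriv (2 * k) (sinQuot lam) 0 / ((2 * k).factorial : ℂ))) * x ^ (2 * k)) =
      ((-1) ^ k * (-1) ^ k) * (lam / π * (π / lam)) *
      (iteratedDeriv (2 * k) (sinQuot lam) 0 / ((2 * k).factorial : ℂ)) * x ^ (2 * k) by ring, h1]
    field_simp
  · intro n hn
    rcases Nat.even_or_odd' n with ⟨k, rfl | rfl⟩
    · exact absurd ⟨k, rfl⟩ hn
    · rw [iteratedDeriv_odd_sinQuot]
      simp

/-- The Taylor series of `sinQuot` is integrated termwise against `(1-t²)^{-μ}`; for `|a| < 1` it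
converges absolutely and uniformly in `t`. -/
theorem hasSum_seriesTermH_of_lt_one {lam : ℝ} (hlam : 0 < lam) {mu : ℝ} (hmu : 0 ≤ mu) (hmu1 : mu < 1)
    {a : ℂ} (ha : 0 < a.re) (ha1 : ‖a‖ < 1) : HasSum (seriesTermH lam mu a) (mathieuH lam mu a) := by
  rw [mathieuH_eq_integralH hlam hmu hmu1 ha, integralH_eq_sinQuot lam mu ha]
  set c : ℕ → ℂ := fun k => lam / π * ((-1) ^ k * coeffA lam k * a ^ (2 * k)) with hc
  set w : ℕ → ℝ → ℝ := fun k t => t ^ (2 * k) * (1 - t ^ 2) ^ (-mu) with hw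
  have hwi := fun k => (integral_pow_mul_one_sub_sq_rpow hmu1 k).1
  have hw0 : ∀ k, ∀ t ∈ Set.Ioo (0 : ℝ) 1, 0 ≤ w k t := fun k t ht =>
    mul_nonneg (pow_nonneg ht.1.le _) (Real.rpow_nonneg (by nlinarith [ht.1, ht.2]) _)
  have hwle : ∀ k, ∀ t ∈ Set.Ioo (0 : ℝ) 1, w k t ≤ w 0 t := fun k t ht => by
    have h1 : 0 ≤ (1 - t ^ 2) ^ (-mu) := Real.rpow_nonneg (by nlinarith [ht.1, ht.2]) _
    exact mul_le_mul_of_nonneg_right (by simpa using pow_le_one₀ ht.1.le ht.2.le) h1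
  have hFi : ∀ k, IntegrableOn (fun t => c k * ((w k t : ℝ) : ℂ)) (Set.Ioo 0 1) := fun k =>
    (hwi k).ofReal.const_mul (c k)
  have hFs : Summable fun k => ∫ t in Set.Ioo (0 : ℝ) 1, ‖c k * ((w k t : ℝ) : ℂ)‖ := by
    refine Summable.of_nonneg_of_le (fun k => integral_nonneg fun _ => norm_nonneg _) (fun k => ?_)
      ((hasSum_sinQuot hlam ha1).summable.norm.mul_right (∫ t in Set.Ioo (0 : ℝ) 1, w 0 t))
    rw [← integral_const_mul]
    refine setIntegral_mono_on (hFi k).norm ((hwi 0).const_mul _) measurableSet_Ioo fun t ht => ?_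
    rw [norm_mul, Complex.norm_real, Real.norm_eq_abs, abs_of_nonneg (hw0 k t ht)]
    exact mul_le_mul_of_nonneg_left (hwle k t ht) (norm_nonneg _)
  have h := (hasSum_integral_of_summable_integral_norm hFi hFs).mul_left (a ^ ((1 - 2 * mu : ℝ) : ℂ))
  have hcongr : ∀ t ∈ Set.Ioo (0 : ℝ) 1, ∑' k, c k * ((w k t : ℝ) : ℂ) =
      sinQuot lam (a * t) * (((1 - t ^ 2) ^ (-mu) : ℝ) : ℂ) := by
    intro t ht
    have hat : ‖a * t‖ < 1 := by
      rw [norm_mul, Complex.norm_real, Real.norm_eq_abs, abs_of_pos ht.1]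
      nlinarith [ht.1, ht.2, norm_nonneg a]
    have h1 := (hasSum_sinQuot hlam hat).mul_right (((1 - t ^ 2) ^ (-mu) : ℝ) : ℂ)
    rw [← h1.tsum_eq]
    refine tsum_congr fun k => ?_
    simp only [hc, hw]
    rw [mul_pow]
    push_cast
    ring
  rw [setIntegral_congr_fun measurableSet_Ioo hcongr] at h
  refine h.congr_fun ?_
  intro k
  rw [integral_const_mul, integral_complex_ofReal, (integral_pow_mul_one_sub_sq_rpow hmu1 k).2, seriesTermH]
  simp only [hc]
  push_cast
  ring

/-- At `s = 0` both sides are `0` since `Γ 0 = 0` by convention. This lets the ladder pass the poles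
of `Γ` met at half-odd `μ`. -/
theorem Real.div_Gamma_add_one (s : ℝ) : s / Real.Gamma (s + 1) = 1 / Real.Gamma s := by
  rcases eq_or_ne s 0 with rfl | hs
  · simp [Real.Gamma_zero]
  · rw [Real.Gamma_add_one hs, div_mul_cancel_left₀ hs, one_div]

theorem seriesTermH_hasDerivAt (lam : ℝ) {mu : ℝ} (hmu : 0 < mu) {a : ℂ} (ha : 0 < a.re) (k : ℕ) :
    HasDerivAt (fun a => seriesTermH lam mu a k) (-2 * mu * a * seriesTermH lam (mu + 1) a k) a := by
  have ha0 := ne_zero_of_re_pos ha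
  have h1 := ((hasDerivAt_id a).cpow_const (c := ((1 - 2 * mu : ℝ) : ℂ))
    (mem_slitPlane_of_re_pos ha)).mul ((hasDerivAt_id a).pow (2 * k))
  have hG : (Real.Gamma (1 - mu) : ℝ) = -mu * Real.Gamma (1 - (mu + 1)) := by
    rw [show 1 - mu = -mu + 1 by ring, Real.Gamma_add_one (by linarith), show 1 - (mu + 1) = -mu by ring]
  have hG2 : ((k + 1 / 2 - mu : ℝ) : ℂ) / (Real.Gamma (k + 3 / 2 - mu) : ℂ) =
      1 / (Real.Gamma (k + 3 / 2 - (mu + 1)) : ℂ) := by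
    have := Real.div_Gamma_add_one (k + 1 / 2 - mu)
    rw [show (k : ℝ) + 1 / 2 - mu + 1 = k + 3 / 2 - mu by ring,
      show (k : ℝ) + 1 / 2 - mu = k + 3 / 2 - (mu + 1) by ring] at this
    rw [show (k : ℝ) + 1 / 2 - mu = k + 3 / 2 - (mu + 1) by ring]
    exact_mod_cast this
  set D : ℂ := lam / (2 * π) * (Real.Gamma (1 - mu) : ℂ) *
    ((-1) ^ k * coeffA lam k * (Real.Gamma (k + 1 / 2) : ℂ) / (Real.Gamma (k + 3 / 2 - mu) : ℂ)) with hD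
  have e : (fun a => seriesTermH lam mu a k) =
      fun a : ℂ => D * (id a ^ ((1 - 2 * mu : ℝ) : ℂ) * id a ^ (2 * k)) := by
    funext a
    rw [seriesTermH, hD, id]
    ring
  rw [e]
  refine (h1.const_mul D).congr_deriv ?_
  set P : ℂ := a ^ ((1 - 2 * (mu + 1) : ℝ) : ℂ) with hP
  have e1 : a ^ ((1 - 2 * mu : ℝ) : ℂ) = P * a ^ 2 := by
    rw [hP, ← Complex.cpow_natCast, ← Complex.cpow_add _ _ ha0]
    congr 1
    push_cast
    ring
  have e2 : a ^ (((1 - 2 * mu : ℝ) : ℂ) - 1) = P * a := by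
    nth_rw 2 [← Complex.cpow_one a]
    rw [hP, ← Complex.cpow_add _ _ ha0]
    congr 1
    push_cast
    ring
  have e3 : (2 * k : ℕ) * a ^ (2 * k - 1) * a = (2 * k : ℕ) * a ^ (2 * k) := by
    rcases k with _ | k
    · simp
    · rw [mul_assoc, ← pow_succ]
      congr 2
  rw [seriesTermH, ← hP]
  have e4 : ((-1 : ℂ) ^ k * coeffA lam k * (Real.Gamma (k + 1 / 2) : ℂ) /
      (Real.Gamma (k + 3 / 2 - (mu + 1)) : ℂ)) = (-1) ^ k * coeffA lam k * (Real.Gamma (k + 1 / 2) : ℂ) *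
      (((k + 1 / 2 - mu : ℝ) : ℂ) / (Real.Gamma (k + 3 / 2 - mu) : ℂ)) := by rw [hG2]; ring
  rw [e4, hD, hG]
  simp only [Pi.pow_apply, id, mul_one]
  rw [e1, e2]
  push_cast at e3 ⊢
  linear_combination (lam / (2 * π) * (-mu * (Real.Gamma (1 - (mu + 1)) : ℂ)) *
    ((-1) ^ k * coeffA lam k * (Real.Gamma (k + 1 / 2) : ℂ) / (Real.Gamma (k + 3 / 2 - mu) : ℂ)) * P * a) * e3

theorem seriesTermH_differentiableOn (lam mu : ℝ) (k : ℕ) :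
    DifferentiableOn ℂ (fun a => seriesTermH lam mu a k) {a : ℂ | 0 < a.re} := by
  intro a ha
  have h : DifferentiableAt ℂ (fun a : ℂ => a ^ ((1 - 2 * mu : ℝ) : ℂ)) a :=
    differentiableAt_id.cpow_const (mem_slitPlane_of_re_pos ha)
  simp only [seriesTermH]
  refine DifferentiableAt.differentiableWithinAt ?_
  fun_prop

theorem norm_seriesTermH (lam mu : ℝ) (a : ℂ) {r : ℝ} (hr : 0 < r) (k : ℕ) : ‖seriesTermH lam mu a k‖ =
    ‖a ^ ((1 - 2 * mu : ℝ) : ℂ)‖ / r ^ (1 - 2 * mu) * (‖a‖ / r) ^ (2 * k) * ‖seriesTermH lam mu r k‖ := by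
  have h : ‖(r : ℂ) ^ ((1 - 2 * mu : ℝ) : ℂ)‖ = r ^ (1 - 2 * mu) := Complex.norm_cpow_eq_rpow_re_of_pos hr _ |>.trans (by simp)
  have h0 : r ^ (1 - 2 * mu) ≠ 0 := (Real.rpow_pos_of_pos hr _).ne'
  simp only [seriesTermH, norm_mul, norm_div, norm_pow, h]
  rw [Complex.norm_real r, Real.norm_eq_abs, abs_of_pos hr, div_pow]
  field_simp

/-- Differentiate the expansion termwise, apply the ladder to both sides, and divide by `-2μa`,
which is nonzero as `μ > 0`. -/
theorem hasSum_seriesTermH_add_one {lam : ℝ} (hlam : 0 < lam) {mu : ℝ} (hmu : 0 < mu)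
    (h : ∀ a : ℂ, 0 < a.re → ‖a‖ < 1 → HasSum (seriesTermH lam mu a) (mathieuH lam mu a)) {a : ℂ}
    (ha : 0 < a.re) (ha1 : ‖a‖ < 1) :
    HasSum (seriesTermH lam (mu + 1) a) (mathieuH lam (mu + 1) a) := by
  -- The series at a real point `r` between `|a|` and `1` serves as majorant near `a`, since the
  -- terms scale like `(|w|/r)^{2k}`.
  obtain ⟨r, har, hr1⟩ := exists_between ha1
  have hr : 0 < r := (norm_nonneg a).trans_lt har
  have hcont : ContinuousAt (fun w : ℂ => ‖w ^ ((1 - 2 * mu : ℝ) : ℂ)‖) a :=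
    (continuousAt_id.cpow continuousAt_const (mem_slitPlane_of_re_pos ha)).norm
  have hev : ∀ᶠ w in 𝓝 a, 0 < w.re ∧ ‖w‖ < r ∧
      ‖w ^ ((1 - 2 * mu : ℝ) : ℂ)‖ < ‖a ^ ((1 - 2 * mu : ℝ) : ℂ)‖ + 1 :=
    (isOpen_re_pos.eventually_mem ha).and ((continuous_norm.continuousAt.eventually_lt continuousAt_const har).and
      (hcont.eventually_lt continuousAt_const (lt_add_one _)))
  obtain ⟨U, hU, hUo, haU⟩ := eventually_nhds_iff.1 hev
  set B := ‖a ^ ((1 - 2 * mu : ℝ) : ℂ)‖ + 1 with hB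
  have hs : Summable fun k => B / r ^ (1 - 2 * mu) * ‖seriesTermH lam mu r k‖ :=
    (h r (by simpa using hr) (by rwa [Complex.norm_real, Real.norm_eq_abs, abs_of_pos hr])).summable.norm.mul_left _
  have hle : ∀ k, ∀ w ∈ U, ‖seriesTermH lam mu w k‖ ≤ B / r ^ (1 - 2 * mu) * ‖seriesTermH lam mu r k‖ := by
    intro k w hw
    obtain ⟨h1, h2, h3⟩ := hU w hw
    rw [norm_seriesTermH lam mu w hr]
    have h4 : (‖w‖ / r) ^ (2 * k) ≤ 1 := pow_le_one₀ (by positivity) ((div_le_one hr).2 h2.le)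
    have h5 : 0 < r ^ (1 - 2 * mu) := Real.rpow_pos_of_pos hr _
    refine mul_le_mul_of_nonneg_right ?_ (norm_nonneg _)
    calc _ ≤ B / r ^ (1 - 2 * mu) * 1 := by gcongr
      _ = _ := mul_one _
  have hd : ∀ k, DifferentiableOn ℂ (fun w => seriesTermH lam mu w k) U := fun k =>
    (seriesTermH_differentiableOn lam mu k).mono fun w hw => (hU w hw).1
  have h1 := Complex.hasSum_deriv_of_summable_norm hs hd hUo hle haU
  have heq : (fun w => ∑' k, seriesTermH lam mu w k) =ᶠ[𝓝 a] mathieuH lam mu := by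
    filter_upwards [hUo.mem_nhds haU] with w hw
    exact (h w (hU w hw).1 ((hU w hw).2.1.trans hr1)).tsum_eq
  rw [heq.deriv_eq, (mathieuH_hasDerivAt hlam hmu ha).deriv] at h1
  simp only [(seriesTermH_hasDerivAt lam hmu ha _).deriv] at h1
  have hne : -2 * (mu : ℂ) * a ≠ 0 := by
    simp [hmu.ne', ne_zero_of_re_pos ha]
  exact (hasSum_mul_left_iff hne).1 h1

/-- Descend by unit steps to `μ < 1`. The value `1` must be excluded, since a step from `μ = 0`
would divide by zero. -/
theorem hasSum_seriesTermH {lam : ℝ} (hlam : 0 < lam) {mu : ℝ} (hmu : 0 ≤ mu)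
    (hne : ∀ m : ℕ, 1 ≤ m → mu ≠ m) {a : ℂ} (ha : 0 < a.re) (ha1 : ‖a‖ < 1) :
    HasSum (seriesTermH lam mu a) (mathieuH lam mu a) := by
  obtain ⟨n, hn⟩ := exists_nat_gt mu
  induction n generalizing mu a with
  | zero => exact absurd hn (by simpa using hmu)
  | succ n ih =>
    rcases lt_or_ge mu 1 with h | h
    · exact hasSum_seriesTermH_of_lt_one hlam hmu h ha ha1
    · have h1 : 1 < mu := lt_of_le_of_ne h (by simpa using (hne 1 le_rfl).symm)
      have h2 := hasSum_seriesTermH_add_one hlam (sub_pos.2 h1) (fun a ha ha1 => ih (sub_pos.2 h1).le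
        (fun m hm hmm => hne (m + 1) (by omega) (by push_cast; linarith)) ha ha1
        (by push_cast at hn; linarith)) ha ha1
      rwa [sub_add_cancel] at h2

theorem isMathieuH_mathieuH {lam : ℝ} (hlam : 0 < lam) {mu : ℝ} (hmu : 0 ≤ mu)
    (hne : ∀ m : ℕ, 1 ≤ m → mu ≠ m) : IsMathieuH lam mu (mathieuH lam mu) :=
  ⟨mathieuH_differentiableOn hlam hmu, fun _ ha ha1 => hasSum_seriesTermH hlam hmu hne ha ha1⟩

/-! ### The real form of the Bessel terms for `a > 0`. -/

open ComplexConjugate in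
theorem conj_cpow_ofReal_of_re_pos {z : ℂ} (hz : 0 < z.re) (p : ℝ) : conj z ^ (p : ℂ) = conj (z ^ (p : ℂ)) := by
  rw [Complex.conj_cpow _ _ (Complex.mem_slitPlane_iff_arg.1 (mem_slitPlane_of_re_pos hz)).1,
    Complex.conj_ofReal]

-- Schwarz reflection. For `a > 0` it makes the Bessel values at `X_k^+` and `X_k^-` complex
-- conjugates.
open ComplexConjugate in
theorem besselQuot_conj (mu : ℝ) {z : ℂ} (hz : 0 < z.re) : besselQuot mu (conj z) = conj (besselQuot mu z) := by
  have h2 : 0 < (2 * z).re := by simpa using hz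
  have hinv : 0 < ((2 * z)⁻¹).re := inv_re_pos h2
  have h3 : ∀ t : ℝ, 0 ≤ t → 0 ≤ ((t : ℂ) / (2 * z)).re := fun t ht => by
    rw [div_eq_mul_inv, Complex.re_ofReal_mul]; positivity
  have h4 : 0 < ((π : ℂ) / (2 * z)).re := by
    rw [div_eq_mul_inv, Complex.re_ofReal_mul]
    exact mul_pos pi_pos hinv
  have e1 : ((π : ℂ) / (2 * conj z)) ^ (1 / 2 : ℂ) = conj (((π : ℂ) / (2 * z)) ^ (1 / 2 : ℂ)) := by
    have := conj_cpow_ofReal_of_re_pos h4 (1 / 2)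
    rw [map_div₀, map_mul, Complex.conj_ofReal, Complex.conj_ofNat] at this
    push_cast at this
    exact this
  rw [besselQuot, besselQuot, map_div₀, conj_cpow_ofReal_of_re_pos hz, besselK, besselK, map_mul, map_div₀,
    map_mul, e1, ← Complex.exp_conj, map_neg, Complex.conj_ofReal, ← integral_conj]
  congr 2
  refine setIntegral_congr_fun measurableSet_Ioi fun t ht => ?_
  have h5 : 0 < (1 + (t : ℂ) / (2 * z)).re := by
    rw [Complex.add_re, Complex.one_re]
    linarith [h3 t (le_of_lt ht)]
  rw [map_mul, Complex.conj_ofReal, ← conj_cpow_ofReal_of_re_pos h5, map_add, map_div₀, map_mul, map_one,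
    Complex.conj_ofReal, Complex.conj_ofNat]

theorem sin_pi_mul_ne_zero_of_ne_natCast {mu : ℝ} (hmu : 0 < mu) (hne : ∀ m : ℕ, 1 ≤ m → mu ≠ m) :
    Real.sin (π * mu) ≠ 0 := by
  intro h
  obtain ⟨n, hn⟩ := Real.sin_eq_zero_iff.1 h
  have h1 : (n : ℝ) = mu := by
    have : π * ((n : ℝ) - mu) = 0 := by linarith
    rcases mul_eq_zero.1 this with h | h
    exacts [absurd h pi_ne_zero, by linarith]
  have h2 : 0 < n := by
    have : (0 : ℝ) < n := by rw [h1]; exact hmu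
    exact_mod_cast this
  lift n to ℕ using h2.le
  exact hne n (by omega) (by simpa using h1.symm)

-- With `w = e^{-πiμ} q` the bracket is `i(w - w̄) = -2 Im w = 2|q| sin(πμ - arg q)`, and the
-- reflection formula replaces `Γ(1-μ)/π` by `1/(Γ(μ) sin πμ)`.
open ComplexConjugate in
theorem besselTerm_ofReal {lam mu a : ℝ} (hmu : 0 < mu) (hne : ∀ m : ℕ, 1 ≤ m → mu ≠ m) (ha : 0 < a) (k : ℕ) :
    besselTerm lam mu a k = ((2 ^ (3 / 2 - mu) * Real.sqrt π / (a ^ (2 * mu - 1) * Real.Gamma mu)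
      * realBesselTerm lam mu a k : ℝ) : ℂ) := by
  have hs := sin_pi_mul_ne_zero_of_ne_natCast hmu hne
  set X := besselX lam 1 a k with hX
  have hXre : 0 < X.re := by
    rw [hX, besselX_eq, Complex.re_mul_ofReal]
    exact mul_pos (besselC_re_pos lam 1 k) ha
  have hXc : besselX lam (-1) a k = conj X := by
    rw [hX, besselX, besselX]
    simp only [map_add, map_mul, map_one, Complex.conj_ofReal, Complex.conj_ofNat, Complex.conj_natCast,
      Complex.conj_I]
    push_cast
    ring
  set q := besselQuot mu X with hq
  have hq2 : X ^ ((mu - 1 / 2 : ℝ) : ℂ) * besselK (1 / 2 - mu) X = q := by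
    rw [hq, besselQuot, show mu - 1 / 2 = -(1 / 2 - mu) by ring, Complex.ofReal_neg, Complex.cpow_neg]
    exact (div_eq_inv_mul _ _).symm
  have hbr : Complex.I * Complex.exp (-(π * mu * Complex.I)) * q
      - Complex.I * Complex.exp (π * mu * Complex.I) * conj q =
      ((2 * (‖q‖ * Real.sin (π * mu - Complex.arg q)) : ℝ) : ℂ) := by
    have h1 : conj (Complex.exp (-(π * mu * Complex.I)) * q) = Complex.exp (π * mu * Complex.I) * conj q := by
      rw [map_mul, ← Complex.exp_conj]
      simp
    have h2 : Complex.exp (-(π * mu * Complex.I)) * q =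
        ‖q‖ * Complex.exp ((-(π * mu - Complex.arg q) : ℝ) * Complex.I) := by
      nth_rw 1 [← Complex.norm_mul_exp_arg_mul_I q]
      rw [mul_left_comm, ← Complex.exp_add]
      push_cast
      ring_nf
    have h3 : (Complex.exp (-(π * mu * Complex.I)) * q).im = -(‖q‖ * Real.sin (π * mu - Complex.arg q)) := by
      rw [h2, Complex.im_ofReal_mul, Complex.exp_ofReal_mul_I_im, Real.sin_neg]
      ring
    have h4 := Complex.sub_conj (Complex.exp (-(π * mu * Complex.I)) * q)
    rw [h1, h3] at h4
    push_cast at h4 ⊢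
    linear_combination Complex.I * h4 - 2 * (‖q‖ * Complex.sin (π * mu - Complex.arg q)) * Complex.I_sq
  rw [besselTerm, ← hX, hXc, besselQuot_conj mu hXre, ← hq, hbr, realBesselTerm, ← hX, hq2, ← hq,
    ← Complex.ofReal_cpow ha.le, ← Complex.ofReal_mul, ← Complex.ofReal_mul]
  congr 1
  have hG : Real.Gamma (1 - mu) / π = 1 / (Real.Gamma mu * Real.sin (π * mu)) := by
    have h := Real.Gamma_mul_Gamma_one_sub mu
    have hG0 : Real.Gamma mu ≠ 0 := (Real.Gamma_pos_of_pos hmu).ne'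
    rw [eq_div_iff hs] at h
    rw [div_eq_div_iff pi_ne_zero (mul_ne_zero hG0 hs)]
    linarith
  have h2 : (2 : ℝ) ^ (3 / 2 - mu) = 2 ^ (1 / 2 - mu) * 2 := by
    rw [← Real.rpow_add_one two_ne_zero]; ring_nf
  have h3 : a ^ (1 - 2 * mu) = (a ^ (2 * mu - 1))⁻¹ := by
    rw [← Real.rpow_neg ha.le]; ring_nf
  rw [hG, h2, h3]
  ring

theorem mathieuT_ofReal {lam mu a : ℝ} (hlam : 0 < lam) (hmu : 0 < mu) (hne : ∀ m : ℕ, 1 ≤ m → mu ≠ m)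
    (ha : 0 < a) : Summable (realBesselTerm lam mu a) ∧ mathieuT lam mu a =
      ((2 ^ (3 / 2 - mu) * Real.sqrt π / (a ^ (2 * mu - 1) * Real.Gamma mu)
        * ∑' k : ℕ, realBesselTerm lam mu a k : ℝ) : ℂ) := by
  set D := 2 ^ (3 / 2 - mu) * Real.sqrt π / (a ^ (2 * mu - 1) * Real.Gamma mu) with hD
  have hD0 : D ≠ 0 := by
    have := Real.Gamma_pos_of_pos hmu
    have := Real.rpow_pos_of_pos ha (2 * mu - 1)
    positivity
  have hsum := summable_besselTerm hlam hmu.le (a := (a : ℂ)) (by simpa using ha)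
  have hterm : besselTerm lam mu a = fun k => ((D * realBesselTerm lam mu a k : ℝ) : ℂ) := by
    funext k
    exact besselTerm_ofReal hmu hne ha k
  constructor
  · rw [hterm, Complex.summable_ofReal, summable_mul_left_iff hD0] at hsum
    exact hsum
  · rw [mathieuT, hterm, ← Complex.ofReal_tsum, tsum_mul_left]

/-- In this sector `T` is smaller than any power of `|a|`, so `H` inherits the expansion of `S`. -/
theorem mathieuH_sub_isBigO {lam : ℝ} (hlam : 0 < lam) {mu : ℝ} (hmu : 0 ≤ mu) {φ : ℝ}
    (hφ : φ < Real.arctan (π / lam)) (N : ℕ) :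
    (fun a : ℂ => mathieuH lam mu a - algebraicSum lam mu N a)
      =O[inftyInSector φ] fun a : ℂ => ‖a‖ ^ (-(2 * mu + 2 * N)) := by
  refine ((mathieuS_sub_isBigO hlam hmu (hφ.trans (Real.arctan_lt_pi_div_two _)) N).sub
    (mathieuT_isBigO hlam hmu hφ _)).congr_left fun a => ?_
  rw [mathieuH]
  ring

/-! ### Hypergeometric closed forms at `μ = 1, …, 5`. -/

theorem ascPochhammer_eval_mul_add (x : ℂ) (k : ℕ) :
    (ascPochhammer ℂ k).eval x * (x + k) = x * (ascPochhammer ℂ k).eval (1 + x) := by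
  rw [← ascPochhammer_succ_eval, ascPochhammer_succ_left]
  simp [add_comm]

/-- The quotient telescopes. The numerator parameter `1` cancels `k!`, so `F_n` becomes a power
series with coefficients `(ia/(ia+k))^n`. -/
theorem ascPochhammer_eval_div {x : ℂ} (hx : x.im ≠ 0) (k : ℕ) :
    (ascPochhammer ℂ k).eval x / (ascPochhammer ℂ k).eval (1 + x) = x / (x + k) := by
  have h1 : x + k ≠ 0 := fun h => hx (by simpa using congrArg Complex.im h)
  have h2 : (ascPochhammer ℂ k).eval (1 + x) ≠ 0 := by
    rw [Ne, ascPochhammer_eval_eq_zero_iff]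
    rintro ⟨n, -, hn⟩
    apply hx
    have := congrArg Complex.im hn
    simpa using this.symm
  rw [div_eq_div_iff h2 h1]
  exact ascPochhammer_eval_mul_add x k

theorem hasSum_hyperF {lam : ℝ} (hlam : 0 < lam) (n : ℕ) {a : ℂ} (ha : a.re ≠ 0) :
    HasSum (fun k : ℕ => (-Complex.exp (-lam)) ^ k * (Complex.I * a / (Complex.I * a + k)) ^ n)
      (hyperF lam n a) := by
  have him : (Complex.I * a).im = a.re := by simp
  have hterm : ∀ k : ℕ,
      (∏ i, (ascPochhammer ℂ k).eval ((Fin.cons 1 (fun _ : Fin n => Complex.I * a) : Fin (n + 1) → ℂ) i)) /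
        (∏ _j : Fin n, (ascPochhammer ℂ k).eval (1 + Complex.I * a)) *
        ((-Complex.exp (-lam)) ^ k / (Nat.factorial k : ℂ)) =
      (-Complex.exp (-lam)) ^ k * (Complex.I * a / (Complex.I * a + k)) ^ n := by
    intro k
    have hk : (Nat.factorial k : ℂ) ≠ 0 := by exact_mod_cast k.factorial_ne_zero
    rw [Fin.prod_univ_succ]
    simp only [Fin.cons_zero, Fin.cons_succ, Finset.prod_const, Finset.card_univ, Fintype.card_fin]
    rw [ascPochhammer_eval_one, mul_div_assoc, ← div_pow, ascPochhammer_eval_div (by rwa [him])]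
    field_simp
  have hsum : Summable fun k : ℕ =>
      (-Complex.exp (-lam)) ^ k * (Complex.I * a / (Complex.I * a + k)) ^ n := by
    refine Summable.of_norm_bounded (g := fun k : ℕ => Real.exp (-lam) ^ k * (‖a‖ / |a.re|) ^ n)
      ((summable_geometric_of_lt_one (Real.exp_pos _).le (Real.exp_lt_one_iff.2 (by linarith))).mul_right _)
      fun k => ?_
    have h1 : |a.re| ≤ ‖Complex.I * a + k‖ := by
      have := Complex.abs_im_le_norm (Complex.I * a + k)
      simpa using this
    have h2 : 0 < |a.re| := abs_pos.2 ha
    rw [norm_mul, norm_pow, norm_pow, norm_neg, norm_div, norm_mul, Complex.norm_I, one_mul,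
      ← Complex.ofReal_neg, ← Complex.ofReal_exp, Complex.norm_real, Real.norm_eq_abs, Real.abs_exp]
    gcongr
  have h : hyperF lam n a = ∑' k : ℕ,
      (-Complex.exp (-lam)) ^ k * (Complex.I * a / (Complex.I * a + k)) ^ n := tsum_congr hterm
  rw [h]
  exact hsum.hasSum

theorem hasSum_hyperFsym {lam : ℝ} (hlam : 0 < lam) (n : ℕ) {a : ℂ} (ha : 0 < a.re) :
    HasSum (fun k : ℕ => (-Complex.exp (-lam)) ^ k * ((Complex.I * a / (Complex.I * a + k)) ^ n +
      (Complex.I * -a / (Complex.I * -a + k)) ^ n)) (hyperFsym lam n a) := by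
  have h := (hasSum_hyperF hlam n ha.ne').add (hasSum_hyperF hlam n (a := -a) (by simpa using ha.ne'))
  simp only [← mul_add] at h
  exact h

theorem mathieuTerm_natCast (lam : ℝ) (m : ℕ) {a : ℂ} (ha : 0 < a.re) (k : ℕ) :
    mathieuTerm lam (m : ℝ) a k =
      (-Complex.exp (-lam)) ^ k * (a ^ 2 / ((k : ℂ) ^ 2 + a ^ 2)) ^ m / a ^ (2 * m) := by
  have h0 := ne_zero_of_re_pos ha
  have h1 : (k : ℂ) ^ 2 + a ^ 2 ≠ 0 := by
    have := Complex.slitPlane_ne_zero (sq_add_sq_mem_slitPlane k ha)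
    simpa using this
  rw [mathieuTerm, Complex.ofReal_natCast, Complex.cpow_natCast, neg_pow (Complex.exp (-lam)),
    ← Complex.exp_nat_mul, div_pow, pow_mul, show (k : ℂ) * -lam = -(lam * k) by ring]
  field_simp

/-- With `w = a²/(k²+a²)` the two fractions are the roots of `X² - 2wX + w`, so their power sums are
polynomials in `w`. -/
theorem hyper_roots {a : ℂ} (ha : 0 < a.re) (k : ℕ) :
    Complex.I * a / (Complex.I * a + k) + Complex.I * -a / (Complex.I * -a + k) =
      2 * (a ^ 2 / ((k : ℂ) ^ 2 + a ^ 2)) ∧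
    Complex.I * a / (Complex.I * a + k) * (Complex.I * -a / (Complex.I * -a + k)) =
      a ^ 2 / ((k : ℂ) ^ 2 + a ^ 2) := by
  have h1 : Complex.I * a + k ≠ 0 := fun h => ha.ne' (by simpa using congrArg Complex.im h)
  have h2 : Complex.I * -a + k ≠ 0 := fun h => ha.ne' (by simpa using congrArg Complex.im h)
  have h3 : (k : ℂ) ^ 2 + a ^ 2 = (Complex.I * a + k) * (Complex.I * -a + k) := by
    linear_combination a ^ 2 * Complex.I_sq
  rw [h3]
  constructor
  · rw [div_add_div _ _ h1 h2, mul_div_assoc', div_left_inj' (mul_ne_zero h1 h2)]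
    linear_combination (-2 * a ^ 2) * Complex.I_sq
  · rw [div_mul_div_comm, div_left_inj' (mul_ne_zero h1 h2)]
    linear_combination (-a ^ 2) * Complex.I_sq

theorem mathieuS_natCast_eq {lam : ℝ} {a : ℂ} (ha : 0 < a.re) (m : ℕ) {f : ℕ → ℂ} {s : ℂ}
    (hf : HasSum (fun k => (-Complex.exp (-lam)) ^ k * f k) s)
    (h : ∀ k : ℕ, f k = (a ^ 2 / ((k : ℂ) ^ 2 + a ^ 2)) ^ m) : mathieuS lam (m : ℝ) a = s / a ^ (2 * m) := by
  rw [← (hf.div_const _).tsum_eq, mathieuS]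
  refine tsum_congr fun k => ?_
  rw [mathieuTerm_natCast lam m ha, h]

theorem mathieuS_closed_forms {lam : ℝ} (hlam : 0 < lam) {a : ℂ} (ha : 0 < a.re) :
    mathieuS lam 1 a = hyperFsym lam 1 a / (2 * a ^ 2) ∧
      mathieuS lam 2 a = 1 / (4 * a ^ 4) * (hyperFsym lam 1 a + hyperFsym lam 2 a) ∧
      mathieuS lam 3 a = 1 / (16 * a ^ 6) *
        (3 * hyperFsym lam 1 a + 3 * hyperFsym lam 2 a + 2 * hyperFsym lam 3 a) ∧
      mathieuS lam 4 a = 1 / (32 * a ^ 8) *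
        (5 * hyperFsym lam 1 a + 5 * hyperFsym lam 2 a + 4 * hyperFsym lam 3 a
          + 2 * hyperFsym lam 4 a) ∧
      mathieuS lam 5 a = 1 / (256 * a ^ 10) *
        (35 * hyperFsym lam 1 a + 35 * hyperFsym lam 2 a + 30 * hyperFsym lam 3 a
          + 20 * hyperFsym lam 4 a + 8 * hyperFsym lam 5 a) := by
  set p : ℕ → ℂ := fun k => (-Complex.exp (-lam)) ^ k with hp
  set u : ℕ → ℂ := fun k => Complex.I * a / (Complex.I * a + k) with hu
  set v : ℕ → ℂ := fun k => Complex.I * -a / (Complex.I * -a + k) with hv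
  set w : ℕ → ℂ := fun k => a ^ 2 / ((k : ℂ) ^ 2 + a ^ 2) with hw
  have hadd : ∀ k, u k + v k = 2 * w k := fun k => (hyper_roots ha k).1
  have hmul : ∀ k, u k * v k = w k := fun k => (hyper_roots ha k).2
  have s1 : ∀ k, u k ^ 1 + v k ^ 1 = 2 * w k := fun k => by rw [pow_one, pow_one, hadd]
  -- From here on, the recursion `s_{n+1} = 2w s_n - w s_{n-1}` for power sums of the two roots.
  have s2 : ∀ k, u k ^ 2 + v k ^ 2 = 4 * w k ^ 2 - 2 * w k := fun k => by
    linear_combination (u k + v k + 2 * w k) * hadd k - 2 * hmul k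
  have s3 : ∀ k, u k ^ 3 + v k ^ 3 = 8 * w k ^ 3 - 6 * w k ^ 2 := fun k => by
    linear_combination (u k ^ 2 + v k ^ 2) * hadd k + 2 * w k * s2 k - (u k + v k) * hmul k - w k * hadd k
  have s4 : ∀ k, u k ^ 4 + v k ^ 4 = 16 * w k ^ 4 - 16 * w k ^ 3 + 2 * w k ^ 2 := fun k => by
    linear_combination (u k ^ 3 + v k ^ 3) * hadd k + 2 * w k * s3 k - (u k ^ 2 + v k ^ 2) * hmul k - w k * s2 k
  have s5 : ∀ k, u k ^ 5 + v k ^ 5 = 32 * w k ^ 5 - 40 * w k ^ 4 + 10 * w k ^ 3 := fun k => by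
    linear_combination (u k ^ 4 + v k ^ 4) * hadd k + 2 * w k * s4 k - (u k ^ 3 + v k ^ 3) * hmul k - w k * s3 k
  have H : ∀ n, HasSum (fun k => p k * (u k ^ n + v k ^ n)) (hyperFsym lam n a) := fun n =>
    hasSum_hyperFsym hlam n ha
  have H1 := H 1
  have H2 := H 2
  have H3 := H 3
  have H4 := H 4
  have H5 := H 5
  simp only [s1, s2, s3, s4, s5] at H1 H2 H3 H4 H5
  refine ⟨?_, ?_, ?_, ?_, ?_⟩
  · have h := mathieuS_natCast_eq (lam := lam) ha 1 (f := fun k => w k ^ 1)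
      ((H1.div_const 2).congr_fun (fun k => by ring)) fun k => rfl
    rw [Nat.cast_one] at h
    rw [h]
    ring
  · have h := mathieuS_natCast_eq (lam := lam) ha 2 (f := fun k => w k ^ 2)
      (((H1.add H2).div_const 4).congr_fun (fun k => by ring)) fun k => rfl
    rw [Nat.cast_ofNat] at h
    rw [h]
    ring
  · have h := mathieuS_natCast_eq (lam := lam) ha 3 (f := fun k => w k ^ 3)
      (((((H1.mul_left 3).add (H2.mul_left 3)).add (H3.mul_left 2)).div_const 16).congr_fun
        (fun k => by ring)) fun k => rfl
    rw [Nat.cast_ofNat] at h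
    rw [h]
    ring
  · have h := mathieuS_natCast_eq (lam := lam) ha 4 (f := fun k => w k ^ 4)
      ((((((H1.mul_left 5).add (H2.mul_left 5)).add (H3.mul_left 4)).add (H4.mul_left 2)).div_const 32).congr_fun
        (fun k => by ring)) fun k => rfl
    rw [Nat.cast_ofNat] at h
    rw [h]
    ring
  · have h := mathieuS_natCast_eq (lam := lam) ha 5 (f := fun k => w k ^ 5)
      (((((((H1.mul_left 35).add (H2.mul_left 35)).add (H3.mul_left 30)).add (H4.mul_left 20)).add
        (H5.mul_left 8)).div_const 256).congr_fun (fun k => by ring)) fun k => rfl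
    rw [Nat.cast_ofNat] at h
    rw [h]
    ring

end

theorem mainTheorem6 (lam : ℝ) (hlam : 0 < lam) :
    -- the series converges, and the differential recurrence holds
    (∀ mu : ℝ, 0 ≤ mu → ∀ a : ℂ, 0 < a.re → Summable (mathieuTerm lam mu a)) ∧
    (∀ mu : ℝ, 0 < mu → ∀ a : ℂ, 0 < a.re →
      DifferentiableAt ℂ (mathieuS lam mu) a ∧
      mathieuS lam (mu + 1) a = -(1 / (2 * mu * a)) * deriv (mathieuS lam mu) a) ∧
    -- the representation for all `mu ≥ 0`
    (∃ H : ℝ → ℂ → ℂ,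
      (∀ mu : ℝ, 0 ≤ mu → (∀ m : ℕ, 1 ≤ m → mu ≠ m) →
        IsMathieuH lam mu (H mu) ∧
        (mu < 1 → ∀ a : ℂ, 0 < a.re → H mu a = integralH lam mu a) ∧
        (∀ a : ℂ, 0 < a.re →
          Summable (besselTerm lam mu a) ∧
          mathieuS lam mu a
            = 1 / (2 * a ^ ((2 * mu : ℝ) : ℂ)) + H mu a + mathieuT lam mu a) ∧
        (0 < mu → ∀ a : ℝ, 0 < a →
          Summable (realBesselTerm lam mu a) ∧
          mathieuS lam mu a
            = 1 / (2 * (a : ℂ) ^ ((2 * mu : ℝ) : ℂ)) + H mu a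
              + ((2 ^ (3 / 2 - mu) * Real.sqrt π / (a ^ (2 * mu - 1) * Real.Gamma mu)
                  * ∑' k : ℕ, realBesselTerm lam mu a k : ℝ) : ℂ)) ∧
        (∀ φ : ℝ, φ < Real.arctan (π / lam) → ∀ N : ℕ,
          (fun a : ℂ => H mu a - algebraicSum lam mu N a)
            =O[inftyInSector φ] fun a : ℂ => ‖a‖ ^ (-(2 * mu + 2 * N)))) ∧
      (∀ m : ℕ, 1 ≤ m → ∀ a : ℂ, 0 < a.re →
        Tendsto (fun mu : ℝ => 1 / (2 * a ^ ((2 * mu : ℝ) : ℂ)) + H mu a + mathieuT lam mu a)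
          (𝓝[≠] (m : ℝ)) (𝓝 (mathieuS lam m a)))) ∧
    -- closed forms for `mu = 1, …, 5`
    (∀ a : ℂ, 0 < a.re →
      mathieuS lam 1 a = hyperFsym lam 1 a / (2 * a ^ 2) ∧
      mathieuS lam 2 a = 1 / (4 * a ^ 4) * (hyperFsym lam 1 a + hyperFsym lam 2 a) ∧
      mathieuS lam 3 a = 1 / (16 * a ^ 6) *
        (3 * hyperFsym lam 1 a + 3 * hyperFsym lam 2 a + 2 * hyperFsym lam 3 a) ∧
      mathieuS lam 4 a = 1 / (32 * a ^ 8) *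
        (5 * hyperFsym lam 1 a + 5 * hyperFsym lam 2 a + 4 * hyperFsym lam 3 a
          + 2 * hyperFsym lam 4 a) ∧
      mathieuS lam 5 a = 1 / (256 * a ^ 10) *
        (35 * hyperFsym lam 1 a + 35 * hyperFsym lam 2 a + 30 * hyperFsym lam 3 a
          + 20 * hyperFsym lam 4 a + 8 * hyperFsym lam 5 a)) ∧
    -- the algebraic expansion for all `mu ≥ 0`, uniformly in closed subsectors of `|arg a| < π/2`
    (∀ mu : ℝ, 0 ≤ mu → ∀ φ : ℝ, φ < π / 2 → ∀ N : ℕ,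
      (fun a : ℂ => mathieuS lam mu a
          - (1 / (2 * a ^ ((2 * mu : ℝ) : ℂ)) + algebraicSum lam mu N a))
        =O[inftyInSector φ] fun a : ℂ => ‖a‖ ^ (-(2 * mu + 2 * N))) ∧
    -- the case `mu = 0`
    (∀ a : ℂ, 0 < a.re →
      (∀ N : ℕ, 1 ≤ N → 1 / (2 * a ^ ((2 * (0 : ℝ) : ℝ) : ℂ)) + algebraicSum lam 0 N a
        = Complex.exp lam / (1 + Complex.exp lam)) ∧
      mathieuS lam 0 a = Complex.exp lam / (1 + Complex.exp lam)) := by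
  refine ⟨fun mu hmu a ha => summable_mathieuTerm hlam hmu ha, fun mu hmu a ha =>
    ⟨(mathieuS_hasDerivAt hlam hmu.le ha).differentiableAt, mathieuS_add_one hlam hmu ha⟩,
    -- One witness for all `μ`: the representation holds by its definition, and
    -- `isMathieuH_mathieuH` identifies it with the required analytic function.
    ⟨mathieuH lam, fun mu hmu hne => ⟨isMathieuH_mathieuH hlam hmu hne,
      fun hmu1 a ha => mathieuH_eq_integralH hlam hmu hmu1 ha,
      fun a ha => ⟨summable_besselTerm hlam hmu ha, by rw [mathieuH]; ring⟩,
      fun hmu0 a ha => ⟨(mathieuT_ofReal hlam hmu0 hne ha).1, ?_⟩,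
      fun φ hφ N => mathieuH_sub_isBigO hlam hmu hφ N⟩,
      fun m hm a ha => ?_⟩,
    fun a ha => mathieuS_closed_forms hlam ha,
    fun mu hmu φ hφ N => mathieuS_sub_isBigO hlam hmu hφ N,
    fun a _ => ⟨fun N hN => algebraicSum_zero_order hlam a hN, mathieuS_zero hlam a⟩⟩
  · rw [← (mathieuT_ofReal hlam hmu0 hne ha).2, mathieuH]
    ring
  -- The three pieces add up to `S_μ` identically in `μ`, so the limit is the continuity of `S` in
  -- `μ`.
  · have h := (mathieuS_tendsto hlam (by exact_mod_cast hm : (0 : ℝ) < m) ha).mono_left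
      (nhdsWithin_le_nhds (s := {(m : ℝ)}ᶜ))
    refine h.congr fun mu => ?_
    rw [mathieuH]
    ring
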